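/- **Setting.** Let $\mathcal H_1$ be a complex Hilbert space of finite dimension $N$ and let $Z$ be a CAR field over $\mathcal H_1$ acting irreducibly on a finite dimensional Hilbert space $\mathcal K$: $\psi\mapsto Z(\psi)\in\mathcal B(\mathcal K)$ is conjugate linear, $Z(\psi)Z^*(\phi)+Z^*(\phi)Z(\psi)=\langle\psi,\phi\rangle\mathbb 1$, $Z(\psi)Z(\phi)+Z(\phi)Z(\psi)=0$, and $\mathcal K\neq0$ has no non-trivial subspace invariant under all $Z(\psi),Z^*(\psi)$. The CAR algebra is $\mathcal A_{\mathcal H_1}=\mathcal B(\mathcal K)$. Write $\tau$ for the normalized trace and $\dagger$ for the adjoint of a linear map with respect to $\langle X,Y\rangle=\tau(X^*Y)$. Let $\mathcal N=\sum_jZ^*(e_j)Z(e_j)$ for an orthonormal basis $(e_j)$ of $\mathcal H_1$ and $W=e^{i\pi\mathcal N}$. States are identified with their density matrices $\rho\ge0$, $\tau(\rho)=1$, so that $\rho(X)=\tau(X\rho)$. For $0\le Q=\sum_j\mu_j|\psi_j\rangle\langle\psi_j|\le\mathbb 1$ with $(\psi_j)$ orthonormal, let $\rho_Q=\prod_j\bigl(2(1-\mu_j)Z(\psi_j)Z^*(\psi_j)+2\mu_jZ^*(\psi_j)Z(\psi_j)\bigr)$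 be the gauge invariant Gaussian state with symbol $Q$. **The operation $\Phi_{S,R}$.** Let $(S,R)$ be a compatible pair on $\mathcal H_1$, that is, $\|S\|\le1$ and $0\le R\le\mathbb 1-SS^*$. Let $T_{S,R}$ be the unique operator with $0\le T_{S,R}\le\mathbb 1$, $\ker(\mathbb 1-SS^*)\subseteq\ker T_{S,R}$ and $R=(\mathbb 1-SS^*)^{1/2}T_{S,R}(\mathbb 1-SS^*)^{1/2}$. Extend $Z$ to the CAR field $Z(\psi\oplus\eta)=Z(\psi)\otimes W+\mathbb 1\otimes Z(\eta)$ over $\mathcal H_1\oplus\mathcal H_1$ acting on $\mathcal K\otimes\mathcal K$, let $$U_S=\begin{pmatrix}-(\mathbb 1-SS^*)^{1/2}&S\\S^*&(\mathbb 1-S^*S)^{1/2}\end{pmatrix},$$ and let $\alpha$ be the $*$-automorphism of $\mathcal B(\mathcal K\otimes\mathcal K)$ with $\alpha(Z(x))=Z(U_Sx)$ for all $x\in\mathcal H_1\oplus\mathcal H_1$. Then $\Phi_{S,R}(\rho)=\mathbb E\bigl(\alpha^{-1}(\rho_{T_{S,R}}\,\rho)\bigr)$, where $\rho_{T_{S,R}}$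 is regarded as an element of the subalgebra $\mathcal A_{\mathcal H_1\oplus0}$ generated by the $Z(\psi\oplus0)$, $\rho$ as an element of the subalgebra $\mathcal A_{0\oplus\mathcal H_1}$ generated by the $Z(0\oplus\eta)$, $\mathbb E$ is the $\tau$-orthogonal projection onto $\mathcal A_{\mathcal H_1\oplus0}$, and both subalgebras are identified with $\mathcal A_{\mathcal H_1}$ through the fields. **The Fermionic Mehler semigroup.** Let $H,A$ be operators on $\mathcal H_1$ with $0\le A\le2H$ and $[H,A]=0$, and put $$T=\lim_{\epsilon\downarrow0}(2H+\epsilon\mathbb 1)^{-1/2}A(2H+\epsilon\mathbb 1)^{-1/2}.$$ Let $(\eta_j)$ be an orthonormal basis of eigenvectors of $T$, $T\eta_j=\lambda_j\eta_j$, let $\phi_j=(2H)^{1/2}\eta_j$, and define $$\begin{aligned}\mathcal L^\dagger_{-H,A}(X)={}&\sum_{j}(1-\lambda_j)\bigl(Z^*(\phi_j)WXWZ(\phi_j)-\tfrac12Z^*(\phi_j)Z(\phi_j)X-\tfrac12XZ^*(\phi_j)Z(\phi_j)\bigr)\\&+\sum_{j}\lambda_j\bigl(Z(\phi_j)WXWZ^*(\phi_j)-\tfrac12Z(\phi_j)Z^*(\phi_j)X-\tfrac12XZ(\phi_j)Z^*(\phi_j)\bigr).\end{aligned}$$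 Let $\mathcal L_{-H,A}=(\mathcal L^\dagger_{-H,A})^\dagger$, and for $t\ge0$ let $\mathcal P_t=e^{t\mathcal L_{-H,A}}$. **Theorem.** The limit $T$ exists and $0\le T\le\mathbb 1$. Moreover: 1. For all $t\ge0$, $(e^{-tH},(\mathbb 1-e^{-2tH})T)$ is a compatible pair and, on all of $\mathcal A_{\mathcal H_1}$, $$\mathcal P_t=\Phi_{e^{-tH},(\mathbb 1-e^{-2tH})T}.$$ In particular, $\mathcal L^\dagger_{-H,A}(X)=\lim_{t\downarrow0}\frac1t\bigl(\Phi^\dagger_{e^{-tH},(\mathbb 1-e^{-2tH})T}(X)-X\bigr)$ for all $X\in\mathcal A_{\mathcal H_1}$. 2. (Detailed balance) For all $t\ge0$, $\mathcal P_t^\dagger$ is self-adjoint with respect to the GNS inner product induced by $\rho_T$: $\rho_T(X^*\mathcal P_t^\dagger(Y))=\rho_T(\mathcal P_t^\dagger(X)^*Y)$ for all $X,Y\in\mathcal A_{\mathcal H_1}$. The state $\rho_T$ is a steady state: $\mathcal P_t\rho_T=\rho_T$ for all $t\ge0$. 3. If $H>0$, then $\rho_T$ is the unique steady state, that is, the only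 state $\rho$ with $\mathcal P_t\rho=\rho$ for all $t\ge0$, and $\lim_{t\to\infty}\mathcal P_t\rho=\rho_T$ for every state $\rho$. -/

import Mathlib

open Filter Topology Module
open scoped TensorProduct InnerProductSpace

noncomputable section

namespace FermiMehler

/-- Finite-dimensional complex inner product spaces are complete. -/
instance instCompleteOfFiniteDimensional (E : Type*) [NormedAddCommGroup E]
    [InnerProductSpace ℂ E] [FiniteDimensional ℂ E] : CompleteSpace E :=
  FiniteDimensional.complete ℂ E

/-- The operators on a (finite-dimensional) Hilbert space. The star operation is the adjoint, the
order is the Loewner order, the norm is the operator norm. -/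
abbrev Op (E : Type*) [NormedAddCommGroup E] [InnerProductSpace ℂ E] : Type _ := E →L[ℂ] E

section Trace

variable {E : Type*} [NormedAddCommGroup E] [InnerProductSpace ℂ E]

/-- The normalized trace `τ(X) = Tr X / dim E`. -/
def tau (X : Op E) : ℂ := LinearMap.trace ℂ E (X : E →ₗ[ℂ] E) / (finrank ℂ E : ℂ)

theorem tau_smul (c : ℂ) (X : Op E) : tau (c • X) = c * tau X := by
  simp [tau, mul_div_assoc]

theorem tau_sum {ι : Type*} (s : Finset ι) (f : ι → Op E) :
    tau (∑ i ∈ s, f i) = ∑ i ∈ s, tau (f i) := by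
  simp [tau, Finset.sum_div]

variable [FiniteDimensional ℂ E]
variable {F : Type*} [NormedAddCommGroup F] [InnerProductSpace ℂ F] [FiniteDimensional ℂ F]

theorem tau_star (X : Op E) : tau (star X) = star (tau X) := by
  simp only [tau]
  rw [LinearMap.trace_eq_sum_inner _ (stdOrthonormalBasis ℂ E),
    LinearMap.trace_eq_sum_inner _ (stdOrthonormalBasis ℂ E)]
  simp [star_div₀, ContinuousLinearMap.star_eq_adjoint, ContinuousLinearMap.adjoint_inner_right]

/-- The rank-one operator `|e_i⟩⟨e_j|` of the standard orthonormal basis of `E`. -/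
def matrixUnit (E : Type*) [NormedAddCommGroup E] [InnerProductSpace ℂ E]
    [FiniteDimensional ℂ E] (i j : Fin (finrank ℂ E)) : Op E :=
  InnerProductSpace.rankOne ℂ (stdOrthonormalBasis ℂ E i) (stdOrthonormalBasis ℂ E j)

/-- The adjoint `L†` of a linear map `L` between operator algebras, for the inner products
`⟨X, Y⟩ = τ(X* Y)`. The matrix units are orthogonal, and each has squared norm `1 / dim E`. The
defining relation of the adjoint is `tau_star_mul_hsAdjoint`. -/
def hsAdjoint (L : Op E →ₗ[ℂ] Op F) : Op F →ₗ[ℂ] Op E where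
  toFun X := (finrank ℂ E : ℂ) •
    ∑ i, ∑ j, tau (star (L (matrixUnit E i j)) * X) • matrixUnit E i j
  map_add' X Y := by
    simp [tau, mul_add, add_div, add_smul, Finset.sum_add_distrib]
  map_smul' c X := by
    simp only [tau, Algebra.mul_smul_comm, ContinuousLinearMap.toLinearMap_smul, map_smul,
      smul_eq_mul, mul_div_assoc, mul_smul, RingHom.id_apply, ← Finset.smul_sum]
    rw [smul_comm]

theorem sum_tau_matrixUnit (Y : Op E) :
    (finrank ℂ E : ℂ) • ∑ i, ∑ j, tau (star (matrixUnit E i j) * Y) • matrixUnit E i j = Y := by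
  set b := stdOrthonormalBasis ℂ E with hb
  have key : ∀ i j, tau (star (matrixUnit E i j) * Y) = ⟪b i, Y (b j)⟫_ℂ / (finrank ℂ E : ℂ) := by
    intro i j
    have h : star (matrixUnit E i j) * Y = InnerProductSpace.rankOne ℂ (b j) (star Y (b i)) := by
      rw [matrixUnit, ContinuousLinearMap.star_eq_adjoint, InnerProductSpace.adjoint_rankOne,
        ContinuousLinearMap.mul_def, InnerProductSpace.rankOne_comp,
        ContinuousLinearMap.star_eq_adjoint]
    rw [tau, h, InnerProductSpace.trace_rankOne, ContinuousLinearMap.star_eq_adjoint,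
      ContinuousLinearMap.adjoint_inner_left]
  rcases Nat.eq_zero_or_pos (finrank ℂ E) with h0 | h0
  · have := Module.finrank_zero_iff.mp h0
    ext x
    exact Subsingleton.elim _ _
  · have hne : (finrank ℂ E : ℂ) ≠ 0 := by exact_mod_cast h0.ne'
    have hext : ∀ k, ((finrank ℂ E : ℂ) •
        ∑ i, ∑ j, tau (star (matrixUnit E i j) * Y) • matrixUnit E i j) (b k) = Y (b k) := by
      intro k
      rw [_root_.smul_apply, _root_.sum_apply]
      conv_rhs => rw [← b.sum_repr' (Y (b k))]
      rw [Finset.smul_sum]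
      refine Finset.sum_congr rfl fun i _ => ?_
      rw [_root_.sum_apply, Finset.sum_eq_single k]
      · rw [key, _root_.smul_apply, matrixUnit, ← hb, InnerProductSpace.rankOne_apply,
          orthonormal_iff_ite.mp b.orthonormal]
        simp [smul_smul, mul_div_cancel₀ _ hne]
      · intro j _ hj
        rw [_root_.smul_apply, matrixUnit, ← hb, InnerProductSpace.rankOne_apply,
          orthonormal_iff_ite.mp b.orthonormal]
        simp [hj]
      · simp
    have : ((finrank ℂ E : ℂ) •
        ∑ i, ∑ j, tau (star (matrixUnit E i j) * Y) • matrixUnit E i j : Op E).toLinearMap =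
        Y.toLinearMap := b.toBasis.ext fun k => by simpa using hext k
    exact ContinuousLinearMap.coe_inj.mp this

/-- The defining relation `⟨Y, L† X⟩ = ⟨L Y, X⟩` of the adjoint. -/
theorem tau_star_mul_hsAdjoint (L : Op E →ₗ[ℂ] Op F) (X : Op F) (Y : Op E) :
    tau (star Y * hsAdjoint L X) = tau (star (L Y) * X) := by
  have h : hsAdjoint L X = (finrank ℂ E : ℂ) •
      ∑ i, ∑ j, tau (star (L (matrixUnit E i j)) * X) • matrixUnit E i j := rfl
  conv_rhs => rw [← sum_tau_matrixUnit Y]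
  rw [h]
  simp only [map_smul, map_sum, star_smul, star_sum, Finset.mul_sum, Finset.sum_mul,
    mul_smul_comm, smul_mul_assoc, tau_smul, tau_sum, star_natCast]
  refine Finset.sum_congr rfl fun i _ => Finset.sum_congr rfl fun j _ => ?_
  rw [← tau_star, star_mul, star_star, mul_comm (tau _)]

end Trace

section Fields

variable {V : Type*} [AddCommGroup V] [Module ℂ V]
variable {H₁ : Type*} [NormedAddCommGroup H₁] [InnerProductSpace ℂ H₁] [FiniteDimensional ℂ H₁]
variable {K : Type*} [NormedAddCommGroup K] [InnerProductSpace ℂ K] [FiniteDimensional ℂ K]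

/-- The canonical anticommutation relations for a conjugate linear map `Z` from the one-particle
space `H₁` to the operators on `K`. -/
structure IsCARField (Z : H₁ →ₗ⋆[ℂ] Op K) : Prop where
  anticomm_star : ∀ ψ φ : H₁, Z ψ * star (Z φ) + star (Z φ) * Z ψ = ⟪ψ, φ⟫_ℂ • (1 : Op K)
  anticomm : ∀ ψ φ : H₁, Z ψ * Z φ + Z φ * Z ψ = 0
  star_anticomm : ∀ ψ φ : H₁, star (Z ψ) * star (Z φ) + star (Z φ) * star (Z ψ) = 0

/-- `K ≠ 0` and no nontrivial subspace of `K` is invariant under all `Z ψ` and `(Z ψ)*`. -/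
structure ActsIrreducibly (Z : H₁ →ₗ⋆[ℂ] Op K) : Prop where
  nontrivial : Nontrivial K
  eq_bot_or_eq_top : ∀ p : Submodule ℂ K,
    (∀ ψ, ∀ x ∈ p, Z ψ x ∈ p ∧ star (Z ψ) x ∈ p) → p = ⊥ ∨ p = ⊤

/-- The number operator `𝒩 = ∑ Z(e_j)* Z(e_j)`, for an orthonormal basis `e` of `H₁` (the sum does
not depend on the basis). -/
def numberOp (Z : H₁ →ₗ⋆[ℂ] Op K) : Op K :=
  ∑ j, star (Z (stdOrthonormalBasis ℂ H₁ j)) * Z (stdOrthonormalBasis ℂ H₁ j)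

/-- The parity operator `W = e^{iπ𝒩} = (-1)^𝒩`: the self-adjoint unitary that anticommutes with all
`Z ψ`. The principal automorphism is `X ↦ W X W`. -/
def parityOp (Z : H₁ →ₗ⋆[ℂ] Op K) : Op K :=
  NormedSpace.exp ((Complex.I * (Real.pi : ℂ)) • numberOp Z)

/-- For self-adjoint `T`, an orthonormal basis of eigenvectors of `T`. -/
def eigenBasis (T : Op H₁) : OrthonormalBasis (Fin (finrank ℂ H₁)) ℂ H₁ :=
  open Classical in
  if h : (T : H₁ →ₗ[ℂ] H₁).IsSymmetric then h.eigenvectorBasis rfl else stdOrthonormalBasis ℂ H₁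

/-- The eigenvalues of a self-adjoint `T` that belong to the vectors of `eigenBasis T`. -/
def eigenVal (T : Op H₁) (j : Fin (finrank ℂ H₁)) : ℝ := (⟪eigenBasis T j, T (eigenBasis T j)⟫_ℂ).re

theorem apply_eigenBasis {T : Op H₁} (hT : IsSelfAdjoint T) (j : Fin (finrank ℂ H₁)) :
    T (eigenBasis T j) = (eigenVal T j : ℂ) • eigenBasis T j := by
  have h : (T : H₁ →ₗ[ℂ] H₁).IsSymmetric :=
    ContinuousLinearMap.isSelfAdjoint_iff_isSymmetric.mp hT
  have h1 : T (eigenBasis T j) = (h.eigenvalues rfl j : ℂ) • eigenBasis T j := by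
    simp only [eigenBasis, dif_pos h]
    exact h.apply_eigenvectorBasis rfl j
  have h2 : eigenVal T j = h.eigenvalues rfl j := by
    rw [eigenVal, h1, inner_smul_right, orthonormal_iff_ite.mp (eigenBasis T).orthonormal]
    simp
  rw [h2, h1]

/-- The density matrix, with respect to `τ`, of the gauge invariant Gaussian state with symbol `Q`,
where `0 ≤ Q ≤ 1`: with `Q = ∑ μ_j |ψ_j⟩⟨ψ_j|` it is the product of the commuting factors
`(1 - μ_j) 2 Z(ψ_j) Z(ψ_j)* + μ_j 2 Z(ψ_j)* Z(ψ_j)`. -/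
def gaussianDensity (Z : H₁ →ₗ⋆[ℂ] Op K) (Q : Op H₁) : Op K :=
  (List.ofFn fun j : Fin (finrank ℂ H₁) =>
    (2 * (1 - eigenVal Q j) : ℂ) • (Z (eigenBasis Q j) * star (Z (eigenBasis Q j))) +
    (2 * eigenVal Q j : ℂ) • (star (Z (eigenBasis Q j)) * Z (eigenBasis Q j))).prod

/-- `ρ` is the density matrix of a state with respect to `τ`. -/
def IsDensity (ρ : Op K) : Prop := 0 ≤ ρ ∧ tau ρ = 1

/-- The GNS inner product `⟨X, Y⟩ = ρ(X* Y) = τ(X* Y ρ)` induced by the state with density matrix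
`ρ`. -/
def gnsInner (ρ X Y : Op K) : ℂ := tau (star X * Y * ρ)

/-- The CAR field over `H₁ ⊕ H₁` acting on `K ⊗ K`: `Z(ψ ⊕ η) = Z(ψ) ⊗ W + 1 ⊗ Z(η)`. -/
def doubledField (Z : H₁ →ₗ⋆[ℂ] Op K) : (H₁ × H₁) →ₗ⋆[ℂ] Op (K ⊗[ℂ] K) where
  toFun x := TensorProduct.mapL (Z x.1) (parityOp Z) + TensorProduct.mapL 1 (Z x.2)
  map_add' x y := by
    simp only [Prod.fst_add, Prod.snd_add, map_add, TensorProduct.mapL_add_left,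
      TensorProduct.mapL_add_right]
    abel
  map_smul' c x := by
    simp only [Prod.smul_fst, Prod.smul_snd, LinearMap.map_smulₛₗ, TensorProduct.mapL_smul_left,
      TensorProduct.mapL_smul_right, smul_add]

/-- The embedding of the CAR algebra over `H₁` (all operators on `K`) as the subalgebra of the CAR
algebra over `H₁ ⊕ H₁` generated by the `Z(ψ ⊕ 0) = Z(ψ) ⊗ W`: the `*`-homomorphism that maps `Z ψ`
to `Z(ψ ⊕ 0)`. It is `X ↦ X ⊗ 1` on the even part `(X + W X W) / 2` and `X ↦ X ⊗ W` on the odd part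
`(X - W X W) / 2`. -/
def embedLeft (Z : H₁ →ₗ⋆[ℂ] Op K) : Op K →ₗ[ℂ] Op (K ⊗[ℂ] K) where
  toFun X :=
    TensorProduct.mapL ((2⁻¹ : ℂ) • (X + parityOp Z * X * parityOp Z)) 1 +
    TensorProduct.mapL ((2⁻¹ : ℂ) • (X - parityOp Z * X * parityOp Z)) (parityOp Z)
  map_add' X Y := by
    simp only [mul_add, add_mul, smul_add, sub_eq_add_neg, neg_add,
      TensorProduct.mapL_add_left]
    abel
  map_smul' c X := by
    simp only [RingHom.id_apply, mul_smul_comm, smul_mul_assoc, ← smul_add, ← smul_sub,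
      smul_comm _ c, TensorProduct.mapL_smul_left]
    rw [smul_add]

/-- The embedding of the CAR algebra over `H₁` as the subalgebra generated by the
`Z(0 ⊕ η) = 1 ⊗ Z(η)`. -/
def embedRight (X : Op K) : Op (K ⊗[ℂ] K) := TensorProduct.mapL 1 X

/-- The tracial conditional expectation of the CAR algebra over `H₁ ⊕ H₁` onto the subalgebra over
`H₁ ⊕ 0`, followed by the identification of this subalgebra with the CAR algebra over `H₁`. The
conditional expectation is the orthogonal projection for the inner product `τ(X* Y)`, which
`embedLeft` preserves, so this is the adjoint of `embedLeft`. -/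
def condExpLeft (Z : H₁ →ₗ⋆[ℂ] Op K) : Op (K ⊗[ℂ] K) →ₗ[ℂ] Op K := hsAdjoint (embedLeft Z)

/-- The `*`-automorphism `α_U` with `α_U(Z x) = Z(U x)` for all `x`. For an irreducible CAR field `Z`
and a unitary `U` it exists and is unique. -/
def quasiFreeAut (Z : V →ₗ⋆[ℂ] Op K) (U : V →ₗ[ℂ] V) : Op K ≃ₐ[ℂ] Op K :=
  Classical.epsilon fun α : Op K ≃ₐ[ℂ] Op K =>
    (∀ X, α (star X) = star (α X)) ∧ ∀ x, α (Z x) = Z (U x)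

/-- The action `ρ ↦ 𝒰* ρ 𝒰` on density matrices of the dual of `α_U = 𝒰 · 𝒰*`. -/
def dualQuasiFree (Z : V →ₗ⋆[ℂ] Op K) (U : V →ₗ[ℂ] V) : Op K →ₗ[ℂ] Op K :=
  (quasiFreeAut Z U).symm.toLinearMap

/-- The self-adjoint unitary dilation of a contraction `S`, with block matrix
`[-(1 - S S*)^{1/2}, S; S*, (1 - S* S)^{1/2}]`. -/
def dilation (S : Op H₁) : (H₁ × H₁) →ₗ[ℂ] (H₁ × H₁) :=
  LinearMap.prod
    (LinearMap.coprod (-(CFC.sqrt (1 - S * star S) : Op H₁) : Op H₁).toLinearMap S.toLinearMap)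
    (LinearMap.coprod (star S).toLinearMap (CFC.sqrt (1 - star S * S) : Op H₁).toLinearMap)

/-- A compatible pair: a contraction `S` and an operator `R` with `0 ≤ R ≤ 1 - S S*`. -/
def IsCompatiblePair (S R : Op H₁) : Prop := ‖S‖ ≤ 1 ∧ 0 ≤ R ∧ R ≤ 1 - S * star S

/-- For a compatible pair `(S, R)`, the unique `T` with `0 ≤ T ≤ 1`, `ker (1 - S S*) ⊆ ker T` and
`R = (1 - S S*)^{1/2} T (1 - S S*)^{1/2}`. -/
def ancillaSymbol (S R : Op H₁) : Op H₁ :=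
  Classical.epsilon fun T : Op H₁ => 0 ≤ T ∧ T ≤ 1 ∧
    (∀ ψ, (1 - S * star S) ψ = 0 → T ψ = 0) ∧
    R = CFC.sqrt (1 - S * star S) * T * CFC.sqrt (1 - S * star S)

/-- The Evans-Hugenholtz-Kadison operation `Φ_{S,R}`: adjoin an ancilla in the Gaussian state
`ρ_T`, apply the dual quasi-free automorphism of the dilation of `S`, and take the tracial
conditional expectation: `ρ ↦ E(α̂_{U_S}(ρ_T ρ))`, where `ρ_T` lies in the left and `ρ` in the right
copy of the CAR algebra. -/
def ehk (Z : H₁ →ₗ⋆[ℂ] Op K) (S R : Op H₁) : Op K →ₗ[ℂ] Op K where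
  toFun ρ := condExpLeft Z (dualQuasiFree (doubledField Z) (dilation S)
    (embedLeft Z (gaussianDensity Z (ancillaSymbol S R)) * embedRight ρ))
  map_add' X Y := by
    simp only [embedRight, TensorProduct.mapL_add_right, mul_add, map_add]
  map_smul' c X := by
    simp only [embedRight, TensorProduct.mapL_smul_right, mul_smul_comm, map_smul,
      RingHom.id_apply]

/-- The expression whose limit as `ε ↓ 0` is the operator `T`. -/
def mehlerSymbolApprox (H A : Op H₁) (ε : ℝ) : Op H₁ :=
  ((2 : ℂ) • H + (ε : ℂ) • 1) ^ (-1 / 2 : ℝ) * A * ((2 : ℂ) • H + (ε : ℂ) • 1) ^ (-1 / 2 : ℝ)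

/-- `T = lim_{ε ↓ 0} (2H + ε)^{-1/2} A (2H + ε)^{-1/2}`. -/
def mehlerSymbol (H A : Op H₁) : Op H₁ := limUnder (𝓝[>] (0 : ℝ)) (mehlerSymbolApprox H A)

/-- The map `X ↦ L W X W L' - (1/2) L L' X - (1/2) X L L'`, where `W` is the parity operator. -/
def twistedLindblad (Z : H₁ →ₗ⋆[ℂ] Op K) (L L' : Op K) : Op K →ₗ[ℂ] Op K where
  toFun X := L * parityOp Z * X * parityOp Z * L' -
    (2⁻¹ : ℂ) • (L * L' * X) - (2⁻¹ : ℂ) • (X * (L * L'))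
  map_add' X Y := by
    simp only [mul_add, add_mul, smul_add]
    abel
  map_smul' c X := by
    simp only [RingHom.id_apply, mul_smul_comm, smul_mul_assoc, smul_sub, smul_comm _ c]

/-- The Lindblad generator `ℒ†_{-H,A}` on observables. With `T` as in `mehlerSymbol`,
`T η_j = λ_j η_j` and `φ_j = (2H)^{1/2} η_j` it is the sum over `j` of
`(1 - λ_j) (Z*(φ_j) W X W Z(φ_j) - ½ Z*(φ_j) Z(φ_j) X - ½ X Z*(φ_j) Z(φ_j))` and
`λ_j (Z(φ_j) W X W Z*(φ_j) - ½ Z(φ_j) Z*(φ_j) X - ½ X Z(φ_j) Z*(φ_j))`. -/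
def mehlerGeneratorDual (Z : H₁ →ₗ⋆[ℂ] Op K) (H A : Op H₁) : Op K →ₗ[ℂ] Op K :=
  let T := mehlerSymbol H A
  let φ : Fin (finrank ℂ H₁) → H₁ := fun j => CFC.sqrt ((2 : ℂ) • H) (eigenBasis T j)
  ∑ j, ((1 - eigenVal T j : ℂ) • twistedLindblad Z (star (Z (φ j))) (Z (φ j)) +
    (eigenVal T j : ℂ) • twistedLindblad Z (Z (φ j)) (star (Z (φ j))))

/-- The generator `ℒ_{-H,A}` on density matrices. -/
def mehlerGenerator (Z : H₁ →ₗ⋆[ℂ] Op K) (H A : Op H₁) : Op K →ₗ[ℂ] Op K :=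
  hsAdjoint (mehlerGeneratorDual Z H A)

/-- The Fermionic Mehler semigroup `e^{t ℒ_{-H,A}}`, acting on density matrices. -/
def mehlerSemigroup (Z : H₁ →ₗ⋆[ℂ] Op K) (H A : Op H₁) (t : ℝ) : Op K →L[ℂ] Op K :=
  NormedSpace.exp ((t : ℂ) • LinearMap.toContinuousLinearMap (mehlerGenerator Z H A))

/-- The adjoint semigroup `(e^{t ℒ_{-H,A}})†`, acting on observables. -/
def mehlerSemigroupDual (Z : H₁ →ₗ⋆[ℂ] Op K) (H A : Op H₁) (t : ℝ) : Op K →ₗ[ℂ] Op K :=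
  hsAdjoint (mehlerSemigroup Z H A t : Op K →ₗ[ℂ] Op K)

/-- The contraction `e^{-tH}`. -/
def mehlerS (H : Op H₁) (t : ℝ) : Op H₁ := NormedSpace.exp (-(t : ℂ) • H)

/-- The operator `(1 - e^{-2tH}) T`. -/
def mehlerR (H A : Op H₁) (t : ℝ) : Op H₁ :=
  (1 - NormedSpace.exp (-(2 * t : ℂ) • H)) * mehlerSymbol H A

/-- The density matrix `ρ_T` of the gauge invariant Gaussian state with symbol `T`. -/
def mehlerState (Z : H₁ →ₗ⋆[ℂ] Op K) (H A : Op H₁) : Op K := gaussianDensity Z (mehlerSymbol H A)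

end Fields

end FermiMehler
end

open FermiMehler

/-!
The operators `H` and `A` commute, so they have a joint orthonormal eigenbasis `e`, with
eigenvalues `h k` and `a k` (`exists_joint_diagOp`). The symbol `T` is then diagonal with the
eigenvalues `a k / (2 * h k)`. The idea is to exhibit one basis of the algebra in which all the
maps of the theorem are diagonal.

Write `z k = Z (e k)` and `μ k = a k / (2 * h k)`. An ordered product of elements chosen, one for
each `k`, from `1`, `z k`, `z k*`, `z k* z k - μ k` is called a monomial; its degree in the mode
`k` is the number, 0, 1 or 2, of field operators in the factor `k`. By Burnside's theorem the
field operators generate all operators on `K`, and the commutation relations order their products,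
so the monomials span (`span_monomials_eq_top`). In particular an operator `Y` is determined by
the traces `τ(M* Y)` with the monomials `M`.

* The generator `ℒ†` is defined by some eigenbasis of `T`. It is sesquilinear in the vectors of
  that basis, so it can be computed in the basis `e`, where it is the sum over `k` of `2 * h k`
  times the thermalization of the mode `k` (`mehlerGeneratorDual_diagOp`). The parity operator `W`
  makes the thermalization of the mode `k` a bimodule map over the elements that commute with the
  Jordan-Wigner transforms `W z k` and `W z k*` (`modeGenerator_bimodule`), among them the other
  modes. Hence `ℒ†` maps a monomial to `-∑ k, h k * deg k` times itself.
* The dilation of `S = exp (-t H)` rotates, for each `k`, the mode `k` of the ancilla with the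
  mode `k` of the system; its automorphism is a product of inner automorphisms by reflections
  (`exists_beamSplitter`). An algebra automorphism preserves the trace, so `τ(M* Φ(ρ))` is the
  trace of the ancilla state times `ρ` times the rotated monomial. The ancilla state is Gaussian,
  so only the terms without an excitation of the ancilla contribute, and what remains is `∏ k, exp
  (-t h k) ^ deg k` times `τ(M* ρ)` (`tau_star_mul_ehk`).

So the semigroup and the operations `Φ` multiply `τ(M* ρ)` by the same factor, and they are equal
(`mehlerSemigroup_eq_ehk`). The derivative at zero is read off on monomials.

What is needed of Gaussian densities follows from the relations of `IsModeKMS`. They hold for each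
eigenvector of the symbol (`isModeKMS_gaussianDensity`), so the eigenbasis that defines the
density does not matter, and they imply that a product of an excitation other than `1` with
elements of the commutant of its mode has expectation zero (`trace_excitation_eq_zero`). This
gives the stationarity of `ρ_T`. They also make the thermalization of each mode symmetric for the
GNS inner product (`trace_modeGenerator`), which is detailed balance for the generator, and hence
for the semigroup. If `H > 0` then every monomial except `1` decays, which gives the convergence
to `ρ_T`, and with it the uniqueness of the steady state.
-/

noncomputable section

namespace FermiMehler

/-! ### A single fermionic mode in a star algebra -/

section Mode

variable {R : Type*} [Ring R] [StarRing R]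

/-- `z` is the annihilator of a fermionic mode and `W` a self-adjoint unitary (the parity) that
anticommutes with it. -/
structure IsMode (W z : R) : Prop where
  parity_sq : W * W = 1
  star_parity : star W = W
  parity_mul : W * z = -(z * W)
  sq : z * z = 0
  anticomm : z * star z + star z * z = 1

namespace IsMode

variable {W z : R}

theorem star_sq (h : IsMode W z) : star z * star z = 0 := by
  rw [← star_mul, h.sq, star_zero]

theorem parity_mul_star (h : IsMode W z) : W * star z = -(star z * W) := by
  have := congrArg star h.parity_mul
  rw [star_mul, star_neg, star_mul, h.star_parity] at this
  rw [this, neg_neg]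

theorem mul_star (h : IsMode W z) : z * star z = 1 - star z * z :=
  eq_sub_of_add_eq h.anticomm

theorem num_mul (h : IsMode W z) : star z * z * z = 0 := by rw [mul_assoc, h.sq, mul_zero]

theorem mul_num (h : IsMode W z) : z * (star z * z) = z := by
  rw [← mul_assoc, h.mul_star, sub_mul, h.num_mul, one_mul, sub_zero]

theorem star_mul_num (h : IsMode W z) : star z * (star z * z) = 0 := by
  rw [← mul_assoc, h.star_sq, zero_mul]

theorem num_mul_star (h : IsMode W z) : star z * z * star z = star z := by
  rw [mul_assoc, h.mul_star, mul_sub, h.star_mul_num, mul_one, sub_zero]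

theorem num_sq (h : IsMode W z) : star z * z * (star z * z) = star z * z := by
  rw [mul_assoc, h.mul_num]

theorem star_num : star (star z * z) = star z * z := by rw [star_mul, star_star]

theorem parity_commute_num (h : IsMode W z) : Commute W (star z * z) := by
  rw [commute_iff_eq, ← mul_assoc, h.parity_mul_star, neg_mul, mul_assoc, h.parity_mul, mul_neg,
    neg_neg, mul_assoc]

end IsMode

variable [Algebra ℂ R]

/-- The elements that commute with the Jordan-Wigner transforms `W z` and `W z*` of a mode; it
contains every element that is built from the other modes. -/
def modeCommutant (W z : R) : Subalgebra ℂ R := Subalgebra.centralizer ℂ {W * z, W * star z}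

theorem mem_modeCommutant {W z a : R} :
    a ∈ modeCommutant W z ↔ Commute (W * z) a ∧ Commute (W * star z) a := by
  simp [modeCommutant, Subalgebra.mem_centralizer_iff, commute_iff_eq]

theorem star_mem_modeCommutant {W z a : R} (h : IsMode W z) (ha : a ∈ modeCommutant W z) :
    star a ∈ modeCommutant W z := by
  rw [mem_modeCommutant] at ha ⊢
  obtain ⟨h1, h2⟩ := ha
  constructor
  · have := h2.star_star
    rwa [star_mul, star_star, h.star_parity, ← neg_neg (z * W), ← h.parity_mul,
      Commute.neg_left_iff] at this
  · have := h1.star_star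
    rwa [star_mul, h.star_parity, ← neg_neg (star z * W), ← h.parity_mul_star,
      Commute.neg_left_iff] at this

theorem mem_modeCommutant_of_anticomm {W z a : R} (hW : W * a = -(a * W)) (h1 : z * a = -(a * z))
    (h2 : star z * a = -(a * star z)) : a ∈ modeCommutant W z := by
  rw [mem_modeCommutant]
  constructor <;> rw [commute_iff_eq, mul_assoc]
  · rw [h1, mul_neg, ← mul_assoc, hW, neg_mul, neg_neg, mul_assoc]
  · rw [h2, mul_neg, ← mul_assoc, hW, neg_mul, neg_neg, mul_assoc]

theorem num_commute {W z a : R} (h : IsMode W z) (ha : a ∈ modeCommutant W z) :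
    Commute (star z * z) a := by
  rw [mem_modeCommutant] at ha
  have : star z * z = -((W * star z) * (W * z)) := by
    rw [h.parity_mul_star, neg_mul, neg_neg, mul_assoc, ← mul_assoc W W, h.parity_sq, one_mul]
  rw [this]
  exact (ha.2.mul_left ha.1).neg_left

/-- The relations that characterize, up to other modes, an even element which on the mode `z` is the
Gaussian density with occupation probability `μ`. -/
structure IsModeKMS (W z : R) (μ : ℝ) (ρ : R) : Prop where
  ann : (1 - μ : ℂ) • (z * ρ) = (μ : ℂ) • (ρ * z)
  cre : (μ : ℂ) • (star z * ρ) = (1 - μ : ℂ) • (ρ * star z)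
  parity : Commute W ρ

theorem IsModeKMS.num_commute {W z ρ : R} {μ : ℝ} (h : IsMode W z) (hρ : IsModeKMS W z μ ρ) :
    Commute (star z * z) ρ := by
  have h1 : (1 - μ : ℂ) • (star z * z * ρ) = (1 - μ : ℂ) • (ρ * (star z * z)) := by
    rw [mul_assoc, ← mul_smul_comm, hρ.ann, mul_smul_comm, ← mul_assoc, ← smul_mul_assoc, hρ.cre,
      smul_mul_assoc, mul_assoc]
  have h2 : (μ : ℂ) • (star z * z * ρ) = (μ : ℂ) • (ρ * (star z * z)) := by
    have : (μ : ℂ) • (z * star z * ρ) = (μ : ℂ) • (ρ * (z * star z)) := by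
      rw [mul_assoc, ← mul_smul_comm, hρ.cre, mul_smul_comm, ← mul_assoc, ← smul_mul_assoc, hρ.ann,
        smul_mul_assoc, mul_assoc]
    rw [h.mul_star, sub_mul, mul_sub, one_mul, mul_one, smul_sub, smul_sub] at this
    exact sub_right_injective this
  have h3 : (1 - μ : ℂ) • (star z * z * ρ) + (μ : ℂ) • (star z * z * ρ) =
    (1 - μ : ℂ) • (ρ * (star z * z)) + (μ : ℂ) • (ρ * (star z * z)) := by rw [h1, h2]
  rwa [← add_smul, ← add_smul, sub_add_cancel, one_smul, one_smul] at h3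

variable {M : Type*} [AddCommGroup M] [Module ℂ M]

variable {W z ρ a b : R} {μ : ℝ}

theorem trace_ann_eq_zero (φ : R →ₗ[ℂ] M) (hφ : ∀ a b, φ (a * b) = φ (b * a)) (h : IsMode W z)
    (hρ : Commute (star z * z) ρ) (ha : a ∈ modeCommutant W z) (hb : b ∈ modeCommutant W z) :
    φ (ρ * (a * z * b)) = 0 := by
  have hb' := num_commute h hb
  have ha' := num_commute h ha
  calc φ (ρ * (a * z * b)) = φ (ρ * a * z * b * (star z * z)) := by
        conv_lhs => rw [← h.mul_num]
        simp only [mul_assoc]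
        rw [← hb'.eq]
        simp only [mul_assoc]
    _ = φ ((star z * z * ρ) * a * z * b) := by rw [hφ]; simp only [mul_assoc]
    _ = φ (ρ * ((star z * z) * a) * z * b) := by rw [hρ.eq]; simp only [mul_assoc]
    _ = φ (ρ * a * ((star z * z) * z) * b) := by rw [ha'.eq]; simp only [mul_assoc]
    _ = 0 := by rw [h.num_mul]; simp

theorem trace_cre_eq_zero (φ : R →ₗ[ℂ] M) (hφ : ∀ a b, φ (a * b) = φ (b * a)) (h : IsMode W z)
    (hρ : Commute (star z * z) ρ) (ha : a ∈ modeCommutant W z) (hb : b ∈ modeCommutant W z) :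
    φ (ρ * (a * star z * b)) = 0 := by
  have hb' := num_commute h hb
  have ha' := num_commute h ha
  calc φ (ρ * (a * star z * b)) = φ (ρ * ((star z * z) * a) * star z * b) := by
        conv_lhs => rw [← h.num_mul_star]
        rw [ha'.eq]
        simp only [mul_assoc]
    _ = φ (star z * z * (ρ * a * star z * b)) := by
        rw [← mul_assoc ρ, ← hρ.eq]; simp only [mul_assoc]
    _ = φ (ρ * a * star z * (b * (star z * z))) := by rw [hφ]; simp only [mul_assoc]
    _ = φ (ρ * a * (star z * (star z * z)) * b) := by rw [← hb'.eq]; simp only [mul_assoc]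
    _ = 0 := by rw [h.star_mul_num]; simp

/-- The occupation number has the conditional expectation `μ`, given the other modes. -/
theorem trace_num_eq (φ : R →ₗ[ℂ] M) (hφ : ∀ a b, φ (a * b) = φ (b * a)) (h : IsMode W z)
    (hρ : IsModeKMS W z μ ρ) (ha : a ∈ modeCommutant W z) :
    φ (ρ * (star z * z * a)) = (μ : ℂ) • φ (ρ * a) := by
  obtain ⟨h1, h2⟩ := mem_modeCommutant.mp ha
  -- Move the creator around the trace, in its Jordan-Wigner form, which commutes with `a`.
  have hc : star z * z = -((W * star z) * (W * z)) := by
    rw [h.parity_mul_star, neg_mul, neg_neg, mul_assoc, ← mul_assoc W W, h.parity_sq, one_mul]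
  have hc' : z * star z = -((W * z) * (W * star z)) := by
    rw [h.parity_mul, neg_mul, neg_neg, mul_assoc, ← mul_assoc W W, h.parity_sq, one_mul]
  have hcre : (μ : ℂ) • (W * star z * ρ) = (1 - μ : ℂ) • (ρ * (W * star z)) := by
    rw [mul_assoc, ← mul_smul_comm, hρ.cre, mul_smul_comm, ← mul_assoc, hρ.parity.eq, mul_assoc]
  have key : (1 - μ : ℂ) • φ (ρ * (star z * z * a)) = (μ : ℂ) • φ (ρ * (z * star z * a)) := by
    calc (1 - μ : ℂ) • φ (ρ * (star z * z * a))
        = φ (-(((1 - μ : ℂ) • (ρ * (W * star z))) * (W * z * a))) := by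
          rw [← map_smul, hc]
          simp only [mul_assoc, smul_mul_assoc, neg_mul, mul_neg, smul_neg]
      _ = (μ : ℂ) • φ (-(W * star z * (ρ * (W * z * a)))) := by
          rw [← hcre, ← map_smul]; simp only [mul_assoc, smul_mul_assoc, smul_neg]
      _ = (μ : ℂ) • φ (-(ρ * (W * z * (a * (W * star z))))) := by
          rw [map_neg, hφ, map_neg]; simp only [mul_assoc]
      _ = _ := by
          rw [← h2.eq, hc']; simp only [mul_assoc, neg_mul, mul_neg]
  rw [h.mul_star, sub_mul, one_mul, mul_sub, map_sub, smul_sub, sub_smul, one_smul] at key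
  exact sub_left_injective key

/-- The basis `1, z, z*, z* z - μ` of the algebra of a single mode. -/
inductive Excitation
  | vac | ann | cre | num

namespace Excitation

/-- The degree of an excitation: the number of field operators in it. -/
def deg : Excitation → ℕ
  | vac => 0
  | ann => 1
  | cre => 1
  | num => 2

/-- The excitation of the adjoint operator. -/
def adj : Excitation → Excitation
  | vac => vac
  | ann => cre
  | cre => ann
  | num => num

/-- The operator of an excitation of the mode `z` that has occupation probability `μ`. -/
def op (z : R) (μ : ℝ) : Excitation → R
  | vac => 1
  | ann => z
  | cre => star z
  | num => star z * z - (μ : ℂ) • 1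

theorem deg_eq_zero {x : Excitation} (h : x.deg = 0) : x = vac := by
  cases x <;> simp [deg] at h ⊢

theorem deg_adj (x : Excitation) : x.adj.deg = x.deg := by cases x <;> rfl

theorem star_op [StarModule ℂ R] (z : R) (μ : ℝ) (x : Excitation) :
    star (x.op z μ) = x.adj.op z μ := by
  cases x <;> simp [op, adj]

end Excitation

/-- In a state that is Gaussian on a mode the excitations of this mode have no correlations with the
other modes. -/
theorem trace_excitation_eq_zero (φ : R →ₗ[ℂ] M) (hφ : ∀ a b, φ (a * b) = φ (b * a))
    (h : IsMode W z) (hρ : IsModeKMS W z μ ρ) (ha : a ∈ modeCommutant W z)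
    (hb : b ∈ modeCommutant W z) {x : Excitation} (hx : x ≠ .vac) :
    φ (ρ * (a * x.op z μ * b)) = 0 := by
  cases x with
  | vac => exact absurd rfl hx
  | ann => exact trace_ann_eq_zero φ hφ h (hρ.num_commute h) ha hb
  | cre => exact trace_cre_eq_zero φ hφ h (hρ.num_commute h) ha hb
  | num =>
    have h1 : a * (star z * z - (μ : ℂ) • 1) * b = star z * z * (a * b) - (μ : ℂ) • (a * b) := by
      rw [mul_sub, ← (num_commute h ha).eq, sub_mul, mul_smul_comm, mul_one, smul_mul_assoc,
        mul_assoc]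
    rw [Excitation.op, h1, mul_sub, map_sub, trace_num_eq φ hφ h hρ (mul_mem ha hb), mul_smul_comm,
      map_smul, sub_self]

/-- The generator of the thermalization of a mode to the occupation probability `μ`, at rate one. -/
def modeGenerator (W z : R) (μ : ℝ) (X : R) : R :=
  (1 - μ : ℂ) • (star z * W * X * W * z - (2⁻¹ : ℂ) • (star z * z * X) -
    (2⁻¹ : ℂ) • (X * (star z * z))) +
  (μ : ℂ) • (z * W * X * W * star z - (2⁻¹ : ℂ) • (z * star z * X) -
    (2⁻¹ : ℂ) • (X * (z * star z)))

/-- The thermalization of a mode does not act on the other modes. This is where the twist of the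
jump terms by the parity is needed. -/
theorem modeGenerator_bimodule {W z a b : R} (h : IsMode W z) (ha : a ∈ modeCommutant W z)
    (hb : b ∈ modeCommutant W z) (μ : ℝ) (x : R) :
    modeGenerator W z μ (a * x * b) = a * modeGenerator W z μ x * b := by
  obtain ⟨a1, a2⟩ := mem_modeCommutant.mp ha
  obtain ⟨b1, b2⟩ := mem_modeCommutant.mp hb
  have e1 : star z * W * (a * x * b) * W * z = a * (star z * W * x * W * z) * b := by
    have : star z * W = -(W * star z) := by rw [h.parity_mul_star, neg_neg]
    calc star z * W * (a * x * b) * W * z = -((W * star z * a) * x * (b * (W * z))) := by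
          rw [this]; simp only [mul_assoc, neg_mul]
      _ = _ := by rw [a2.eq, ← b1.eq, this]; simp only [mul_assoc, neg_mul, mul_neg]
  have e2 : z * W * (a * x * b) * W * star z = a * (z * W * x * W * star z) * b := by
    have : z * W = -(W * z) := by rw [h.parity_mul, neg_neg]
    calc z * W * (a * x * b) * W * star z = -((W * z * a) * x * (b * (W * star z))) := by
          rw [this]; simp only [mul_assoc, neg_mul]
      _ = _ := by rw [a1.eq, ← b2.eq, this]; simp only [mul_assoc, neg_mul, mul_neg]
  have n1 : star z * z * (a * x * b) = a * (star z * z * x) * b := by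
    rw [← mul_assoc, ← mul_assoc, (num_commute h ha).eq]; simp only [mul_assoc]
  have n2 : (a * x * b) * (star z * z) = a * (x * (star z * z)) * b := by
    rw [mul_assoc, ← (num_commute h hb).eq]; simp only [mul_assoc]
  have n3 : z * star z * (a * x * b) = a * (z * star z * x) * b := by
    rw [h.mul_star]; simp only [sub_mul, mul_sub, one_mul, n1]
  have n4 : (a * x * b) * (z * star z) = a * (x * (z * star z)) * b := by
    rw [h.mul_star]; simp only [sub_mul, mul_sub, mul_one, n2]
  simp only [modeGenerator, e1, e2, n1, n2, n3, n4, mul_add, add_mul, mul_sub, sub_mul,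
    mul_smul_comm, smul_mul_assoc]

theorem modeGenerator_op {W z : R} (h : IsMode W z) (μ : ℝ) (x : Excitation) :
    modeGenerator W z μ (x.op z μ) = -(x.deg / 2 : ℂ) • x.op z μ := by
  have hW1 := h.parity_mul
  have hW2 := h.parity_mul_star
  have hW2' : ∀ y, W * (star z * y) = -(star z * (W * y)) := fun y => by
    rw [← mul_assoc, hW2, neg_mul, mul_assoc]
  have hz' : ∀ y, z * (z * y) = 0 := fun y => by rw [← mul_assoc, h.sq, zero_mul]
  have hs' : ∀ y, star z * (star z * y) = 0 := fun y => by rw [← mul_assoc, h.star_sq, zero_mul]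
  have hc' : ∀ y, z * (star z * y) = y - star z * (z * y) := fun y => by
    rw [← mul_assoc, h.mul_star, sub_mul, one_mul, mul_assoc]
  cases x <;>
  · simp only [modeGenerator, Excitation.op, Excitation.deg, mul_assoc, mul_sub, sub_mul, hW1, hW2,
      hW2', hz', hs', hc', h.parity_sq, h.sq, h.mul_star, mul_neg, neg_mul,
      mul_one, one_mul, mul_zero, sub_zero, zero_mul, mul_smul_comm, smul_mul_assoc]
    push_cast
    module

/-- The generator of the thermalization of a mode is symmetric for the GNS inner product of a state
that is Gaussian on this mode. -/
theorem trace_modeGenerator [StarModule ℂ R] (φ : R →ₗ[ℂ] M) (hφ : ∀ a b, φ (a * b) = φ (b * a))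
    {W z ρ : R} {μ : ℝ} (h : IsMode W z) (hρ : IsModeKMS W z μ ρ) (X Y : R) :
    φ (star X * modeGenerator W z μ Y * ρ) = φ (star (modeGenerator W z μ X) * Y * ρ) := by
  have hn := hρ.num_commute h
  have hn' : Commute (z * star z) ρ := by rw [h.mul_star]; exact (Commute.one_left _).sub_left hn
  -- The two jump terms are exchanged.
  have j1 : (1 - μ : ℂ) • φ (star X * (star z * W * Y * W * z) * ρ) =
      (μ : ℂ) • φ (z * W * star X * W * star z * Y * ρ) := by
    calc (1 - μ : ℂ) • φ (star X * (star z * W * Y * W * z) * ρ)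
        = φ (star X * (star z * W * Y * W) * ((1 - μ : ℂ) • (z * ρ))) := by
          rw [← map_smul, mul_smul_comm]; simp only [mul_assoc]
      _ = (μ : ℂ) • φ (star X * (star z * W * Y) * (W * ρ) * z) := by
          rw [hρ.ann, mul_smul_comm, map_smul]; simp only [mul_assoc]
      _ = (μ : ℂ) • φ ((star X * (star z * W * Y) * ρ) * (W * z)) := by
          rw [hρ.parity.eq]; simp only [mul_assoc]
      _ = (μ : ℂ) • φ ((W * z) * star X * (star z * W) * Y * ρ) := by
          rw [hφ]; simp only [mul_assoc]
      _ = _ := by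
          rw [h.parity_mul, ← neg_neg (star z * W), ← h.parity_mul_star]
          simp only [mul_assoc, neg_mul, mul_neg, neg_neg]
  have j2 : (μ : ℂ) • φ (star X * (z * W * Y * W * star z) * ρ) =
      (1 - μ : ℂ) • φ (star z * W * star X * W * z * Y * ρ) := by
    calc (μ : ℂ) • φ (star X * (z * W * Y * W * star z) * ρ)
        = φ (star X * (z * W * Y * W) * ((μ : ℂ) • (star z * ρ))) := by
          rw [← map_smul, mul_smul_comm]; simp only [mul_assoc]
      _ = (1 - μ : ℂ) • φ (star X * (z * W * Y) * (W * ρ) * star z) := by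
          rw [hρ.cre, mul_smul_comm, map_smul]; simp only [mul_assoc]
      _ = (1 - μ : ℂ) • φ ((star X * (z * W * Y) * ρ) * (W * star z)) := by
          rw [hρ.parity.eq]; simp only [mul_assoc]
      _ = (1 - μ : ℂ) • φ ((W * star z) * star X * (z * W) * Y * ρ) := by
          rw [hφ]; simp only [mul_assoc]
      _ = _ := by
          rw [h.parity_mul_star, ← neg_neg (z * W), ← h.parity_mul]
          simp only [mul_assoc, neg_mul, mul_neg, neg_neg]
  have m : ∀ n : R, Commute n ρ → φ (star X * (Y * n) * ρ) = φ (n * star X * Y * ρ) := by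
    intro n hn
    calc φ (star X * (Y * n) * ρ) = φ (star X * Y * (n * ρ)) := by simp only [mul_assoc]
      _ = _ := by rw [hn.eq, ← mul_assoc, hφ]; simp only [mul_assoc]
  have m1 := m _ hn
  have m2 := m _ hn'
  simp only [modeGenerator, mul_add, add_mul, mul_sub, sub_mul, smul_sub, map_add,
    map_sub, mul_smul_comm, smul_mul_assoc, map_smul, j1, j2, m1, m2, star_add, star_sub,
    star_smul, star_mul, star_star, h.star_parity]
  simp only [RCLike.star_def, map_one, Complex.conj_ofReal, map_inv₀, Complex.conj_ofNat, mul_assoc]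
  module

end Mode

/-! ### Families of modes and their monomials -/

section ModeFamily

variable {R ι : Type*} [Ring R] [StarRing R]

/-- A family of modes with a common parity, whose annihilators and creators anticommute. -/
structure IsModeFamily (W : R) (z : ι → R) : Prop where
  mode : ∀ k, IsMode W (z k)
  anticomm : ∀ j k, j ≠ k → z j * z k = -(z k * z j)
  anticomm_star : ∀ j k, j ≠ k → z j * star (z k) = -(star (z k) * z j)

/-- A duplicate-free list splits at each of its members. -/
theorem exists_split_of_mem {l : List ι} (hl : l.Nodup) {k : ι} (hk : k ∈ l) :
    ∃ l₁ l₂, l = l₁ ++ k :: l₂ ∧ k ∉ l₁ ∧ k ∉ l₂ := by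
  obtain ⟨l₁, l₂, rfl⟩ := List.append_of_mem hk
  rw [List.nodup_middle, List.nodup_cons, List.mem_append] at hl
  exact ⟨l₁, l₂, rfl, fun h => hl.1 (Or.inl h), fun h => hl.1 (Or.inr h)⟩

namespace IsModeFamily

variable {W : R} {z : ι → R}

theorem star_anticomm (h : IsModeFamily W z) {j k : ι} (hjk : j ≠ k) :
    star (z j) * z k = -(z k * star (z j)) := by
  rw [h.anticomm_star k j hjk.symm, neg_neg]

theorem star_anticomm_star (h : IsModeFamily W z) {j k : ι} (hjk : j ≠ k) :
    star (z j) * star (z k) = -(star (z k) * star (z j)) := by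
  rw [← star_mul, h.anticomm k j hjk.symm, star_neg, star_mul]

theorem commute_num (h : IsModeFamily W z) {j k : ι} (hjk : j ≠ k) :
    Commute (z j) (star (z k) * z k) := by
  rw [commute_iff_eq, ← mul_assoc, h.anticomm_star j k hjk, neg_mul, mul_assoc, h.anticomm j k hjk,
    mul_neg, neg_neg, mul_assoc]

theorem star_commute_num (h : IsModeFamily W z) {j k : ι} (hjk : j ≠ k) :
    Commute (star (z j)) (star (z k) * z k) := by
  have := (h.commute_num hjk).star_star
  rwa [IsMode.star_num] at this

variable [Algebra ℂ R]

theorem ann_mem (h : IsModeFamily W z) {j k : ι} (hjk : j ≠ k) : z j ∈ modeCommutant W (z k) :=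
  mem_modeCommutant_of_anticomm (h.mode j).parity_mul (h.anticomm k j hjk.symm)
    (h.star_anticomm hjk.symm)

theorem cre_mem (h : IsModeFamily W z) {j k : ι} (hjk : j ≠ k) :
    star (z j) ∈ modeCommutant W (z k) :=
  star_mem_modeCommutant (h.mode k) (h.ann_mem hjk)

end IsModeFamily

variable [Algebra ℂ R]

theorem Excitation.op_mem (S : Subalgebra ℂ R) {z : R} (hz : z ∈ S) (hz' : star z ∈ S) (μ : ℝ)
    (x : Excitation) : x.op z μ ∈ S := by
  cases x with
  | vac => exact one_mem S
  | ann => exact hz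
  | cre => exact hz'
  | num => exact sub_mem (mul_mem hz' hz) (S.smul_mem (one_mem S) _)

/-- The ordered product of excitations of the modes in the list `l`. -/
def excitationProd (z : ι → R) (μ : ι → ℝ) (l : List ι) (m : ι → Excitation) : R :=
  (l.map fun k => (m k).op (z k) (μ k)).prod

variable {W : R} {z : ι → R} {μ : ι → ℝ} {l : List ι} {k : ι}

theorem excitationProd_mem (h : IsModeFamily W z) (hk : k ∉ l) (m : ι → Excitation) :
    excitationProd z μ l m ∈ modeCommutant W (z k) := by
  refine list_prod_mem fun x hx => ?_
  obtain ⟨j, hj, rfl⟩ := List.mem_map.mp hx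
  have hjk : j ≠ k := fun e => hk (e ▸ hj)
  exact Excitation.op_mem _ (h.ann_mem hjk) (h.cre_mem hjk) _ _

theorem star_excitationProd [StarModule ℂ R] (l : List ι) (m : ι → Excitation) :
    star (excitationProd z μ l m) = excitationProd z μ l.reverse fun k => (m k).adj := by
  induction l with
  | nil => simp [excitationProd]
  | cons k l ih =>
    simp only [excitationProd, List.map_cons, List.prod_cons, star_mul, Excitation.star_op,
      List.reverse_cons, List.map_append, List.prod_append, List.map_nil, List.prod_nil,
      mul_one] at ih ⊢
    rw [ih]

/-- A monomial splits into the excitation of the mode `k` and two factors that do not involve this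
mode. -/
theorem exists_excitationProd_eq (h : IsModeFamily W z) (hl : l.Nodup) (hk : k ∈ l)
    (m : ι → Excitation) : ∃ a ∈ modeCommutant W (z k), ∃ b ∈ modeCommutant W (z k),
      excitationProd z μ l m = a * (m k).op (z k) (μ k) * b := by
  obtain ⟨l₁, l₂, rfl, h₁, h₂⟩ := exists_split_of_mem hl hk
  refine ⟨_, excitationProd_mem (μ := μ) h h₁ m, _, excitationProd_mem (μ := μ) h h₂ m, ?_⟩
  simp [excitationProd, mul_assoc]

theorem trace_excitationProd_eq_zero {M : Type*} [AddCommGroup M] [Module ℂ M] (φ : R →ₗ[ℂ] M)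
    (hφ : ∀ a b, φ (a * b) = φ (b * a)) (h : IsModeFamily W z) (hl : l.Nodup) (hk : k ∈ l) {ρ : R}
    (hρ : IsModeKMS W (z k) (μ k) ρ) {m : ι → Excitation} (hm : m k ≠ .vac) :
    φ (excitationProd z μ l m * ρ) = 0 := by
  obtain ⟨a, ha, b, hb, e⟩ := exists_excitationProd_eq (μ := μ) h hl hk m
  rw [hφ, e]
  exact trace_excitation_eq_zero φ hφ (h.mode k) hρ ha hb hm

/-- The monomials are eigenvectors of the generators of the thermalization of the modes. -/
theorem modeGenerator_excitationProd (h : IsModeFamily W z) (hl : l.Nodup) (hk : k ∈ l)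
    (m : ι → Excitation) : modeGenerator W (z k) (μ k) (excitationProd z μ l m) =
      -((m k).deg / 2 : ℂ) • excitationProd z μ l m := by
  obtain ⟨a, ha, b, hb, e⟩ := exists_excitationProd_eq (μ := μ) h hl hk m
  rw [e, modeGenerator_bimodule (h.mode k) ha hb, modeGenerator_op (h.mode k), mul_smul_comm,
    smul_mul_assoc]

/-! ### The monomials span -/

/-- The algebra of a single mode, as a subspace. -/
def modeSpan (z : R) (μ : ℝ) : Submodule ℂ R := Submodule.span ℂ (Set.range (Excitation.op z μ))

theorem op_mem_modeSpan (z : R) (μ : ℝ) (x : Excitation) : x.op z μ ∈ modeSpan z μ :=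
  Submodule.subset_span ⟨x, rfl⟩

theorem modeSpan_mul_self {W z : R} (h : IsMode W z) (μ : ℝ) :
    modeSpan z μ * modeSpan z μ ≤ modeSpan z μ := by
  have key : ∀ a b c d : ℂ, ∀ y : R, y = a • 1 + b • z + c • star z + d • (star z * z) →
      y ∈ modeSpan z μ := by
    rintro a b c d y rfl
    have h0 := op_mem_modeSpan z μ .vac
    have h3 : star z * z ∈ modeSpan z μ := by
      have := add_mem (op_mem_modeSpan z μ .num) ((modeSpan z μ).smul_mem (μ : ℂ) h0)
      simpa [Excitation.op] using this
    exact add_mem (add_mem (add_mem (Submodule.smul_mem _ _ h0)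
      (Submodule.smul_mem _ _ (op_mem_modeSpan z μ .ann)))
      (Submodule.smul_mem _ _ (op_mem_modeSpan z μ .cre))) (Submodule.smul_mem _ _ h3)
  rw [modeSpan, Submodule.span_mul_span, Submodule.span_le]
  rintro _ ⟨_, ⟨x, rfl⟩, _, ⟨y, rfl⟩, rfl⟩
  change Excitation.op z μ x * Excitation.op z μ y ∈ modeSpan z μ
  by_cases hx : x = .vac
  · subst hx
    simpa [Excitation.op] using op_mem_modeSpan z μ y
  by_cases hy : y = .vac
  · subst hy
    simpa [Excitation.op] using op_mem_modeSpan z μ x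
  have e1 := h.mul_num
  have e2 := h.star_mul_num
  have e3 := h.num_mul
  have e4 := h.num_mul_star
  have e5 := h.num_sq
  have e6 := h.sq
  have e7 := h.star_sq
  have e8 := h.mul_star
  cases x <;> cases y <;> first | exact absurd rfl hx | exact absurd rfl hy | skip
  · exact key 0 0 0 0 _ (by simp [Excitation.op, e6])
  · exact key 1 0 0 (-1) _ (by simp only [Excitation.op, e8]; module)
  · exact key 0 (1 - μ) 0 0 _ (by
      simp only [Excitation.op, mul_sub, e1, mul_smul_comm, mul_one]; module)
  · exact key 0 0 0 1 _ (by simp [Excitation.op])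
  · exact key 0 0 0 0 _ (by simp [Excitation.op, e7])
  · exact key 0 0 (-μ) 0 _ (by
      simp only [Excitation.op, mul_sub, e2, mul_smul_comm, mul_one]; module)
  · exact key 0 (-μ) 0 0 _ (by
      simp only [Excitation.op, sub_mul, e3, smul_mul_assoc, one_mul]; module)
  · exact key 0 0 (1 - μ) 0 _ (by
      simp only [Excitation.op, sub_mul, e4, smul_mul_assoc, one_mul]; module)
  · exact key (μ ^ 2) 0 0 (1 - 2 * μ) _ (by
      simp only [Excitation.op, sub_mul, mul_sub, e5, smul_mul_assoc, mul_smul_comm, one_mul,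
        mul_one]
      module)

theorem commute_op {a z : R} (h1 : Commute a z) (h2 : Commute a (star z)) (μ : ℝ) (y : Excitation) :
    Commute a (y.op z μ) := by
  cases y with
  | vac => exact Commute.one_right a
  | ann => exact h1
  | cre => exact h2
  | num => exact (h2.mul_right h1).sub_right ((Commute.one_right a).smul_right _)

/-- The excitations of two modes commute up to sign, so products of modes can be reordered. -/
theorem modeSpan_mul_le (h : IsModeFamily W z) (μ : ι → ℝ) (j k : ι) :
    modeSpan (z j) (μ j) * modeSpan (z k) (μ k) ≤ modeSpan (z k) (μ k) * modeSpan (z j) (μ j) := by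
  by_cases hjk : j = k
  · rw [hjk]
  have key : ∀ x y : Excitation, ∃ c : ℂ, x.op (z j) (μ j) * y.op (z k) (μ k) =
      c • (y.op (z k) (μ k) * x.op (z j) (μ j)) := by
    intro x y
    have hx : x = .vac ∨ x = .num → ∃ c : ℂ, x.op (z j) (μ j) * y.op (z k) (μ k) =
        c • (y.op (z k) (μ k) * x.op (z j) (μ j)) := by
      intro hx
      have : ∀ b, Commute (star (z j) * z j) b → Commute (x.op (z j) (μ j)) b := by
        rintro b hb
        rcases hx with rfl | rfl
        · exact Commute.one_left _
        · exact hb.sub_left ((Commute.one_left b).smul_left _)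
      refine ⟨1, ?_⟩
      rw [one_smul]
      exact commute_op (this _ (h.commute_num (Ne.symm hjk)).symm)
        (this _ (h.star_commute_num (Ne.symm hjk)).symm) _ y
    have hy : y = .vac ∨ y = .num → ∃ c : ℂ, x.op (z j) (μ j) * y.op (z k) (μ k) =
        c • (y.op (z k) (μ k) * x.op (z j) (μ j)) := by
      intro hy
      have : ∀ b, Commute (star (z k) * z k) b → Commute (y.op (z k) (μ k)) b := by
        rintro b hb
        rcases hy with rfl | rfl
        · exact Commute.one_left _
        · exact hb.sub_left ((Commute.one_left b).smul_left _)
      refine ⟨1, ?_⟩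
      rw [one_smul]
      exact (commute_op (this _ (h.commute_num hjk).symm)
        (this _ (h.star_commute_num hjk).symm) _ x).symm
    have e : ∀ a b : R, a * b = -(b * a) → a * b = (-1 : ℂ) • (b * a) := by
      intro a b hab
      rw [hab, neg_one_smul]
    cases x with
    | vac => exact hx (Or.inl rfl)
    | num => exact hx (Or.inr rfl)
    | ann =>
      cases y with
      | vac => exact hy (Or.inl rfl)
      | num => exact hy (Or.inr rfl)
      | ann => exact ⟨-1, e _ _ (h.anticomm j k hjk)⟩
      | cre => exact ⟨-1, e _ _ (h.anticomm_star j k hjk)⟩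
    | cre =>
      cases y with
      | vac => exact hy (Or.inl rfl)
      | num => exact hy (Or.inr rfl)
      | ann => exact ⟨-1, e _ _ (h.star_anticomm hjk)⟩
      | cre => exact ⟨-1, e _ _ (h.star_anticomm_star hjk)⟩
  conv_lhs => rw [modeSpan, modeSpan, Submodule.span_mul_span]
  rw [Submodule.span_le]
  rintro _ ⟨_, ⟨x, rfl⟩, _, ⟨y, rfl⟩, rfl⟩
  obtain ⟨c, hc⟩ := key x y
  change _ * _ ∈ _
  rw [hc]
  exact Submodule.smul_mem _ _ (Submodule.mul_mem_mul (op_mem_modeSpan _ _ _)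
    (op_mem_modeSpan _ _ _))

theorem modeSpan_mul_prod_le (h : IsModeFamily W z) (μ : ι → ℝ) {k : ι} {l : List ι} (hk : k ∈ l) :
    modeSpan (z k) (μ k) * (l.map fun j => modeSpan (z j) (μ j)).prod ≤
      (l.map fun j => modeSpan (z j) (μ j)).prod := by
  induction l with
  | nil => simp at hk
  | cons i l ih =>
    rw [List.map_cons, List.prod_cons, ← mul_assoc]
    rcases List.mem_cons.mp hk with rfl | hk
    · exact mul_le_mul' (modeSpan_mul_self (h.mode k) _) le_rfl
    · refine (mul_le_mul' (modeSpan_mul_le h μ k i) le_rfl).trans ?_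
      rw [mul_assoc]
      exact mul_le_mul' le_rfl (ih hk)

theorem prod_modeSpan_le (z : ι → R) (μ : ι → ℝ) {l : List ι} (hl : l.Nodup) :
    (l.map fun j => modeSpan (z j) (μ j)).prod ≤
      Submodule.span ℂ (Set.range (excitationProd z μ l)) := by
  classical
  induction l with
  | nil =>
    rw [List.map_nil, List.prod_nil, Submodule.one_eq_span]
    refine Submodule.span_mono ?_
    rintro _ rfl
    exact ⟨fun _ => .vac, rfl⟩
  | cons k l ih =>
    rw [List.nodup_cons] at hl
    rw [List.map_cons, List.prod_cons]
    refine (mul_le_mul' le_rfl (ih hl.2)).trans ?_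
    rw [modeSpan, Submodule.span_mul_span]
    refine Submodule.span_mono ?_
    rintro _ ⟨_, ⟨x, rfl⟩, _, ⟨m, rfl⟩, rfl⟩
    refine ⟨Function.update m k x, ?_⟩
    simp only [excitationProd, List.map_cons, List.prod_cons, Function.update_self]
    congr 2
    refine List.map_congr_left fun j hj => ?_
    rw [Function.update_of_ne (fun e : j = k => hl.1 (e ▸ hj))]

/-- If the modes generate the algebra, then the monomials span it. -/
theorem span_excitationProd (h : IsModeFamily W z) (μ : ι → ℝ) {l : List ι} (hl : l.Nodup)
    (hl' : ∀ k, k ∈ l)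
    (hgen : Algebra.adjoin ℂ (Set.range z ∪ Set.range fun k => star (z k)) = ⊤) :
    Submodule.span ℂ (Set.range (excitationProd z μ l)) = ⊤ := by
  set P := (l.map fun j => modeSpan (z j) (μ j)).prod with hP
  have h1 : (1 : R) ∈ P := by
    rw [← List.prod_replicate (n := l.length) (a := (1 : R)) |>.trans (one_pow _)]
    clear_value P
    subst hP
    clear hl hl'
    induction l with
    | nil => exact Submodule.one_le.mp le_rfl
    | cons k l ih =>
      simp only [List.map_cons, List.prod_cons, List.length_cons, List.replicate_succ]
      exact Submodule.mul_mem_mul (op_mem_modeSpan _ _ .vac) ih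
  have h2 : ∀ a : R, ∀ b ∈ P, a * b ∈ P := by
    intro a
    have ha : a ∈ Algebra.adjoin ℂ (Set.range z ∪ Set.range fun k => star (z k)) := by
      rw [hgen]; trivial
    induction ha using Algebra.adjoin_induction with
    | mem x hx =>
      intro b hb
      rcases hx with ⟨k, rfl⟩ | ⟨k, rfl⟩
      · exact modeSpan_mul_prod_le h μ (hl' k)
          (Submodule.mul_mem_mul (op_mem_modeSpan _ _ .ann) hb)
      · exact modeSpan_mul_prod_le h μ (hl' k)
          (Submodule.mul_mem_mul (op_mem_modeSpan _ _ .cre) hb)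
    | algebraMap c =>
      intro b hb
      rw [← Algebra.smul_def]
      exact P.smul_mem c hb
    | add x y _ _ hx hy =>
      intro b hb
      rw [add_mul]
      exact add_mem (hx b hb) (hy b hb)
    | mul x y _ _ hx hy =>
      intro b hb
      rw [mul_assoc]
      exact hx _ (hy b hb)
  refine top_le_iff.mp fun a _ => prod_modeSpan_le z μ hl ?_
  simpa using h2 a 1 h1

/-! ### Products of Gaussian densities of modes -/

/-- The Gaussian density, with occupation probability `μ`, of a mode. -/
def modeDensity (z : R) (μ : ℝ) : R :=
  (2 * (1 - μ) : ℂ) • (z * star z) + (2 * μ : ℂ) • (star z * z)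

theorem modeDensity_mem (S : Subalgebra ℂ R) {z : R} (hz : z ∈ S) (hz' : star z ∈ S) (μ : ℝ) :
    modeDensity z μ ∈ S :=
  add_mem (S.smul_mem (mul_mem hz hz') _) (S.smul_mem (mul_mem hz' hz) _)

theorem isModeKMS_modeDensity {W z : R} (h : IsMode W z) (μ : ℝ) :
    IsModeKMS W z μ (modeDensity z μ) where
  ann := by
    simp only [modeDensity, mul_add, add_mul, mul_smul_comm, smul_mul_assoc, h.mul_star, mul_sub,
      sub_mul, h.mul_num, h.num_mul, one_mul, mul_one]
    module
  cre := by
    simp only [modeDensity, mul_add, add_mul, mul_smul_comm, smul_mul_assoc, h.mul_star, mul_sub,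
      sub_mul, h.star_mul_num, h.num_mul_star, one_mul, mul_one]
    module
  parity := by
    have hn := h.parity_commute_num
    rw [modeDensity, h.mul_star]
    exact (((Commute.one_right W).sub_right hn).smul_right _).add_right (hn.smul_right _)

theorem commute_modeDensity {a z : R} (h : Commute a (star z * z)) {W : R} (hz : IsMode W z)
    (μ : ℝ) : Commute a (modeDensity z μ) := by
  rw [modeDensity, hz.mul_star]
  exact (((Commute.one_right a).sub_right h).smul_right _).add_right (h.smul_right _)

theorem IsModeKMS.mul {W z ρ a b : R} {μ : ℝ} (h : IsModeKMS W z μ ρ) (ha : Commute z a)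
    (ha' : Commute (star z) a) (haW : Commute W a) (hb : Commute z b) (hb' : Commute (star z) b)
    (hbW : Commute W b) : IsModeKMS W z μ (a * ρ * b) where
  ann := by
    have e1 : z * (a * ρ * b) = a * (z * ρ) * b := by
      rw [← mul_assoc, ← mul_assoc, ha.eq, mul_assoc a z]
    have e2 : a * ρ * b * z = a * (ρ * z) * b := by
      rw [mul_assoc, ← hb.eq]; simp only [mul_assoc]
    rw [e1, e2, ← smul_mul_assoc, ← mul_smul_comm, h.ann, mul_smul_comm, smul_mul_assoc]
  cre := by
    have e1 : star z * (a * ρ * b) = a * (star z * ρ) * b := by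
      rw [← mul_assoc, ← mul_assoc, ha'.eq, mul_assoc a (star z)]
    have e2 : a * ρ * b * star z = a * (ρ * star z) * b := by
      rw [mul_assoc, ← hb'.eq]; simp only [mul_assoc]
    rw [e1, e2, ← smul_mul_assoc, ← mul_smul_comm, h.cre, mul_smul_comm, smul_mul_assoc]
  parity := (haW.mul_right h.parity).mul_right hbW

theorem isModeKMS_prod_modeDensity (h : IsModeFamily W z) (μ : ι → ℝ) {l : List ι} (hl : l.Nodup)
    {k : ι} (hk : k ∈ l) :
    IsModeKMS W (z k) (μ k) (l.map fun j => modeDensity (z j) (μ j)).prod := by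
  obtain ⟨l₁, l₂, rfl, h₁, h₂⟩ := exists_split_of_mem hl hk
  have c : ∀ (y : R) (l : List ι), (∀ j ∈ l, Commute y (star (z j) * z j)) →
      Commute y (l.map fun j => modeDensity (z j) (μ j)).prod := by
    intro y l hy
    refine Commute.list_prod_right _ _ fun x hx => ?_
    obtain ⟨j, hj, rfl⟩ := List.mem_map.mp hx
    exact commute_modeDensity (hy j hj) (h.mode j) _
  have ne : ∀ {l : List ι}, k ∉ l → ∀ j ∈ l, k ≠ j := fun hk j hj e => hk (e ▸ hj)
  rw [List.map_append, List.prod_append, List.map_cons, List.prod_cons, ← mul_assoc]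
  exact (isModeKMS_modeDensity (h.mode k) (μ k)).mul
    (c _ _ fun j hj => h.commute_num (ne h₁ j hj))
    (c _ _ fun j hj => h.star_commute_num (ne h₁ j hj))
    (c _ _ fun j _ => (h.mode j).parity_commute_num)
    (c _ _ fun j hj => h.commute_num (ne h₂ j hj))
    (c _ _ fun j hj => h.star_commute_num (ne h₂ j hj))
    (c _ _ fun j _ => (h.mode j).parity_commute_num)

theorem trace_prod_modeDensity (φ : R →ₗ[ℂ] ℂ) (hφ : ∀ a b, φ (a * b) = φ (b * a))
    (h : IsModeFamily W z) (μ : ι → ℝ) {l : List ι} (hl : l.Nodup) :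
    φ (l.map fun j => modeDensity (z j) (μ j)).prod = φ 1 := by
  induction l with
  | nil => simp
  | cons k l ih =>
    rw [List.nodup_cons] at hl
    rw [List.map_cons, List.prod_cons, ← ih hl.2]
    set C := (l.map fun j => modeDensity (z j) (μ j)).prod
    have hC : C ∈ modeCommutant W (z k) := by
      refine list_prod_mem fun x hx => ?_
      obtain ⟨j, hj, rfl⟩ := List.mem_map.mp hx
      have hjk : j ≠ k := fun e => hl.1 (e ▸ hj)
      exact modeDensity_mem _ (h.ann_mem hjk) (h.cre_mem hjk) _
    -- The tracial state is itself Gaussian, with occupation probabilities one half.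
    have h1 : IsModeKMS W (z k) (1 / 2) 1 := by
      refine ⟨?_, ?_, Commute.one_right W⟩ <;>
      · rw [mul_one, one_mul]
        congr 1
        push_cast
        norm_num
    have := trace_num_eq φ hφ (h.mode k) h1 hC
    rw [one_mul, one_mul] at this
    rw [modeDensity, (h.mode k).mul_star, add_mul, smul_mul_assoc, smul_mul_assoc, sub_mul, one_mul,
      map_add, map_smul, map_smul, map_sub, this]
    simp only [smul_eq_mul]
    push_cast
    ring

end ModeFamily

/-! ### Exponentials -/

section Exp

variable {R : Type*} [NormedRing R] [NormedAlgebra ℂ R] [CompleteSpace R]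

theorem exp_smul_of_idempotent (c : ℂ) {p : R} (hp : p * p = p) :
    NormedSpace.exp (c • p) = 1 + (Complex.exp c - 1) • p := by
  have h1 := NormedSpace.exp_series_hasSum_exp' (𝕂 := ℂ) (c • p)
  have h2 := (NormedSpace.exp_series_hasSum_exp' (𝕂 := ℂ) c).smul_const p
  have h3 := (hasSum_ite_eq (0 : ℕ) (1 - p)).add h2
  have e : ∀ n : ℕ, ((n.factorial : ℂ)⁻¹) • (c • p) ^ n =
      (if n = 0 then 1 - p else 0) + ((n.factorial : ℂ)⁻¹ • c ^ n) • p := by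
    intro n
    rcases n with _ | n
    · simp
    · have : p ^ (n + 1) = p := by
        induction n with
        | zero => simp
        | succ n ih => rw [pow_succ, ih, hp]
      rw [smul_pow, this, smul_smul, smul_eq_mul]
      simp
  simp_rw [e] at h1
  rw [h1.unique h3, ← Complex.exp_eq_exp_ℂ]
  module

/-- An eigenfunctional of an operator is an eigenfunctional of its exponential. -/
theorem apply_exp_of_comp_eq_smul {E F : Type*} [NormedAddCommGroup E] [NormedSpace ℂ E]
    [CompleteSpace E] [NormedAddCommGroup F] [NormedSpace ℂ F] (f : E →L[ℂ] F) (A : E →L[ℂ] E)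
    (c : ℂ) (h : ∀ x, f (A x) = c • f x) (x : E) :
    f (NormedSpace.exp A x) = Complex.exp c • f x := by
  have h1 := ((NormedSpace.exp_series_hasSum_exp' (𝕂 := ℂ) A).mapL
    (ContinuousLinearMap.apply ℂ E x)).mapL f
  have h2 := (NormedSpace.exp_series_hasSum_exp' (𝕂 := ℂ) c).smul_const (f x)
  have e : ∀ n : ℕ, f ((A ^ n) x) = c ^ n • f x := by
    intro n
    induction n with
    | zero => simp
    | succ n ih => rw [pow_succ', mul_apply_eq_comp, h, ih, smul_smul, pow_succ']
  rw [Complex.exp_eq_exp_ℂ]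
  refine h1.unique ?_
  convert h2 using 2 with n
  rw [ContinuousLinearMap.apply_apply, _root_.smul_apply, map_smul, e, smul_assoc]

end Exp

/-! ### The normalized trace -/

section Tau

variable {E : Type*} [NormedAddCommGroup E] [InnerProductSpace ℂ E]

/-- The normalized trace as a linear functional. -/
def tauLinear (E : Type*) [NormedAddCommGroup E] [InnerProductSpace ℂ E] : Op E →ₗ[ℂ] ℂ where
  toFun := tau
  map_add' X Y := by simp [tau, add_div]
  map_smul' := tau_smul

theorem tau_add (X Y : Op E) : tau (X + Y) = tau X + tau Y := (tauLinear E).map_add X Y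

theorem tau_mul_comm (X Y : Op E) : tau (X * Y) = tau (Y * X) := by
  have := LinearMap.trace_mul_comm ℂ (X : E →ₗ[ℂ] E) Y
  simp only [tau]
  exact congrArg (· / _) this

theorem tauLinear_mul_comm (X Y : Op E) : tauLinear E (X * Y) = tauLinear E (Y * X) :=
  tau_mul_comm X Y

variable [FiniteDimensional ℂ E]

theorem tau_one [Nontrivial E] : tau (1 : Op E) = 1 := by
  have h : (finrank ℂ E : ℂ) ≠ 0 := by exact_mod_cast (finrank_pos (R := ℂ) (M := E)).ne'
  simp only [tau]
  rw [ContinuousLinearMap.toLinearMap_one, LinearMap.trace_one, div_self h]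

theorem tau_algEquiv (α : Op E ≃ₐ[ℂ] Op E) (X : Op E) : tau (α X) = tau X := by
  let c : Module.End ℂ E ≃ₐ[ℂ] Op E := Module.End.toContinuousLinearMap E
  obtain ⟨T, hT⟩ := ((c.trans α).trans c.symm).eq_linearEquivConjAlgEquiv
  have h : c.symm (α X) = T.conjAlgEquiv ℂ (c.symm X) := by
    rw [← hT]; simp
  have h' : ((α X : Op E) : E →ₗ[ℂ] E) = T.conj (X : E →ₗ[ℂ] E) := h
  rw [tau, tau, h', LinearMap.trace_conj']

theorem tau_mul_algEquiv_symm (α : Op E ≃ₐ[ℂ] Op E) (X Y : Op E) :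
    tau (X * α.symm Y) = tau (α X * Y) := by
  rw [← tau_algEquiv α, map_mul, AlgEquiv.apply_symm_apply]

/-- The trace pairing is nondegenerate. -/
theorem ext_tau {X Y : Op E} (h : ∀ A : Op E, tau (star A * X) = tau (star A * Y)) : X = Y := by
  rw [← sum_tau_matrixUnit X, ← sum_tau_matrixUnit Y]
  simp only [h]

end Tau

/-! ### Irreducible families of operators -/

/-- Burnside's theorem: an algebra of operators on a finite dimensional space without nontrivial
invariant subspaces consists of all operators. -/
theorem subalgebra_eq_top_of_irreducible {E : Type*} [AddCommGroup E] [Module ℂ E]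
    [FiniteDimensional ℂ E] [Nontrivial E] (S : Subalgebra ℂ (Module.End ℂ E))
    (hS : ∀ p : Submodule ℂ E, (∀ a ∈ S, ∀ x ∈ p, a x ∈ p) → p = ⊥ ∨ p = ⊤) : S = ⊤ := by
  classical
  have hsub : ∀ q : Submodule S E, q = ⊥ ∨ q = ⊤ := by
    intro q
    rcases hS (q.restrictScalars ℂ) fun a ha x hx => q.smul_mem (⟨a, ha⟩ : S) hx with h | h
    · left
      rwa [Submodule.restrictScalars_eq_bot_iff] at h
    · right
      rwa [Submodule.restrictScalars_eq_top_iff] at h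
  have hsimple : IsSimpleModule S E := { eq_bot_or_eq_top := hsub }
  -- Schur's lemma
  have schur : ∀ g : Module.End S E, ∃ c : ℂ, ∀ x, g x = c • x := by
    intro g
    obtain ⟨c, hc⟩ := Module.End.exists_eigenvalue (g.restrictScalars ℂ : Module.End ℂ E)
    refine ⟨c, fun x => ?_⟩
    rcases hS (Module.End.eigenspace (g.restrictScalars ℂ : Module.End ℂ E) c) (fun a ha x hx => by
      rw [Module.End.mem_eigenspace_iff] at hx ⊢
      have h1 : g (a x) = a (g x) := g.map_smul (⟨a, ha⟩ : S) x
      have h2 : g x = c • x := hx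
      change g (a x) = c • a x
      rw [h1, h2, map_smul]) with h | h
    · exact absurd h hc
    · have : x ∈ Module.End.eigenspace (g.restrictScalars ℂ : Module.End ℂ E) c := by
        rw [h]; trivial
      exact Module.End.mem_eigenspace_iff.mp this
  refine top_le_iff.mp fun a _ => ?_
  let f : Module.End (Module.End S E) E :=
    { toFun := a
      map_add' := map_add a
      map_smul' := fun g x => by
        obtain ⟨c, hc⟩ := schur g
        simp only [Module.End.smul_def, RingHom.id_apply, hc, map_smul] }
  let b := Module.finBasis ℂ E
  obtain ⟨r, hr⟩ := jacobson_density f (Finset.univ.image b)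
  have : a = r := b.ext fun i => hr (b i) (Finset.mem_image_of_mem _ (Finset.mem_univ i))
  rw [this]
  exact r.2

/-! ### The parity operator and the modes of a CAR field -/

section CAR

variable {H₁ : Type*} [NormedAddCommGroup H₁] [InnerProductSpace ℂ H₁]
variable {K : Type*} [NormedAddCommGroup K] [InnerProductSpace ℂ K]

theorem field_expand {ι : Type*} [Fintype ι] (Z : H₁ →ₗ⋆[ℂ] Op K) (e : OrthonormalBasis ι ℂ H₁)
    (ψ : H₁) : Z ψ = ∑ k, ⟪ψ, e k⟫_ℂ • Z (e k) := by
  conv_lhs => rw [← e.sum_repr' ψ]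
  rw [map_sum]
  refine Finset.sum_congr rfl fun k _ => ?_
  rw [LinearMap.map_smulₛₗ, inner_conj_symm]

variable [FiniteDimensional ℂ K] {Z : H₁ →ₗ⋆[ℂ] Op K}

theorem adjoin_field_eq_top (hirr : ActsIrreducibly Z) {ι : Type*} [Fintype ι]
    (e : OrthonormalBasis ι ℂ H₁) :
    Algebra.adjoin ℂ ((Set.range fun k => Z (e k)) ∪ Set.range fun k => star (Z (e k))) = ⊤ := by
  have := hirr.nontrivial
  set S := Algebra.adjoin ℂ ((Set.range fun k => Z (e k)) ∪ Set.range fun k => star (Z (e k)))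
    with hS
  let c : Op K ≃ₐ[ℂ] Module.End ℂ K := (Module.End.toContinuousLinearMap K).symm
  have hmem : ∀ ψ, Z ψ ∈ S ∧ star (Z ψ) ∈ S := by
    intro ψ
    rw [field_expand Z e ψ]
    constructor
    · exact sum_mem fun k _ => S.smul_mem (Algebra.subset_adjoin (Or.inl ⟨k, rfl⟩)) _
    · rw [star_sum]
      refine sum_mem fun k _ => ?_
      rw [star_smul]
      exact S.smul_mem (Algebra.subset_adjoin (Or.inr ⟨k, rfl⟩)) _
  have h : S.map (c : Op K →ₐ[ℂ] Module.End ℂ K) = ⊤ := by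
    refine subalgebra_eq_top_of_irreducible _ fun p hp => hirr.eq_bot_or_eq_top p fun ψ x hx => ?_
    exact ⟨hp _ ⟨Z ψ, (hmem ψ).1, rfl⟩ x hx, hp _ ⟨star (Z ψ), (hmem ψ).2, rfl⟩ x hx⟩
  refine top_le_iff.mp fun a _ => ?_
  obtain ⟨b, hb, hab⟩ : c a ∈ S.map (c : Op K →ₐ[ℂ] Module.End ℂ K) := by rw [h]; trivial
  rwa [← c.injective hab]

variable [FiniteDimensional ℂ H₁]

/-- An annihilator lowers the particle number by one. -/
theorem semiconjBy_numberOp (hZ : IsCARField Z) (ψ : H₁) :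
    SemiconjBy (Z ψ) (numberOp Z) (numberOp Z + 1) := by
  set e := stdOrthonormalBasis ℂ H₁ with he
  have key : ∀ j, Z ψ * (star (Z (e j)) * Z (e j)) =
      star (Z (e j)) * Z (e j) * Z ψ + ⟪ψ, e j⟫_ℂ • Z (e j) := by
    intro j
    rw [← mul_assoc, eq_sub_of_add_eq (hZ.anticomm_star ψ (e j)), sub_mul, smul_mul_assoc, one_mul,
      mul_assoc, eq_neg_of_add_eq_zero_left (hZ.anticomm ψ (e j)), mul_neg, mul_assoc,
      sub_neg_eq_add, add_comm]
  rw [SemiconjBy, numberOp, ← he, Finset.mul_sum, add_mul, one_mul, Finset.sum_mul]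
  refine (Finset.sum_congr rfl fun j _ => key j).trans ?_
  rw [Finset.sum_add_distrib, ← field_expand Z e ψ]

theorem parityOp_mul (hZ : IsCARField Z) (ψ : H₁) : parityOp Z * Z ψ = -(Z ψ * parityOp Z) := by
  let _ : NormedAlgebra ℚ (Op K) := .restrictScalars ℚ ℂ _
  have h1 : SemiconjBy (Z ψ) ((Complex.I * (Real.pi : ℂ)) • numberOp Z)
      ((Complex.I * (Real.pi : ℂ)) • numberOp Z + (Complex.I * (Real.pi : ℂ)) • 1) := by
    have := semiconjBy_numberOp hZ ψ
    rw [SemiconjBy] at this ⊢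
    rw [mul_smul_comm, this, ← smul_add, smul_mul_assoc]
  have h2 := h1.exp_right
  rw [NormedSpace.exp_add_of_commute ((Commute.one_right _).smul_right _),
    exp_smul_of_idempotent _ (one_mul (1 : Op K)), mul_comm Complex.I, Complex.exp_pi_mul_I] at h2
  rw [parityOp, mul_comm Complex.I, h2.eq]
  simp only [mul_add, add_mul, mul_smul_comm, smul_mul_assoc, mul_one]
  module

theorem isSelfAdjoint_numberOp (Z : H₁ →ₗ⋆[ℂ] Op K) : star (numberOp Z) = numberOp Z := by
  simp [numberOp]

theorem parityOp_sq (hZ : IsCARField Z) : parityOp Z * parityOp Z = 1 := by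
  let _ : NormedAlgebra ℚ (Op K) := .restrictScalars ℚ ℂ _
  set e := stdOrthonormalBasis ℂ H₁ with he
  have hee : ∀ j k, ⟪e j, e k⟫_ℂ = if j = k then 1 else 0 := orthonormal_iff_ite.mp e.orthonormal
  have hs : ∀ ψ, Z ψ * Z ψ = 0 := fun ψ => by
    have := hZ.anticomm ψ ψ
    rwa [← two_smul ℂ, smul_eq_zero_iff_right two_ne_zero] at this
  have hid : ∀ j, star (Z (e j)) * Z (e j) * (star (Z (e j)) * Z (e j)) =
      star (Z (e j)) * Z (e j) := by
    intro j
    have h := eq_sub_of_add_eq (hZ.anticomm_star (e j) (e j))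
    rw [hee, if_pos rfl, one_smul] at h
    calc _ = star (Z (e j)) * (Z (e j) * star (Z (e j))) * Z (e j) := by simp only [mul_assoc]
      _ = _ := by
        rw [h, mul_sub, sub_mul, mul_one, mul_assoc, mul_assoc, hs, mul_zero, mul_zero, sub_zero]
  have hcomm : ∀ j k, j ≠ k → Commute (star (Z (e j)) * Z (e j)) (star (Z (e k)) * Z (e k)) := by
    intro j k hjk
    have a1 : Z (e j) * star (Z (e k)) = -(star (Z (e k)) * Z (e j)) := by
      apply eq_neg_of_add_eq_zero_left
      rw [hZ.anticomm_star, hee, if_neg hjk, zero_smul]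
    have a2 : star (Z (e j)) * Z (e k) = -(Z (e k) * star (Z (e j))) := by
      apply eq_neg_of_add_eq_zero_right
      rw [hZ.anticomm_star, hee, if_neg hjk.symm, zero_smul]
    have a3 := eq_neg_of_add_eq_zero_left (hZ.anticomm (e j) (e k))
    have a4 := eq_neg_of_add_eq_zero_left (hZ.star_anticomm (e j) (e k))
    have c1 : Commute (Z (e j)) (star (Z (e k)) * Z (e k)) := by
      rw [commute_iff_eq, ← mul_assoc, a1, neg_mul, mul_assoc, a3, mul_neg, neg_neg, mul_assoc]
    have c2 : Commute (star (Z (e j))) (star (Z (e k)) * Z (e k)) := by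
      rw [commute_iff_eq, ← mul_assoc, a4, neg_mul, mul_assoc, a2, mul_neg, neg_neg, mul_assoc]
    exact c2.mul_left c1
  rw [parityOp, ← NormedSpace.exp_add_of_commute (Commute.refl _), ← add_smul, numberOp, ← he,
    Finset.smul_sum, NormedSpace.exp_sum_of_commute]
  · refine Finset.noncommProd_induction _ _ _ (fun x => x = 1) (fun a b ha hb => ?_) rfl
      fun j _ => ?_
    · rw [ha, hb, one_mul]
    · rw [exp_smul_of_idempotent _ (hid j)]
      have : Complex.exp (Complex.I * Real.pi + Complex.I * Real.pi) = 1 := by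
        rw [← Complex.exp_two_pi_mul_I]; congr 1; ring
      rw [this, sub_self, zero_smul, add_zero]
  · intro j _ k _ hjk
    exact ((hcomm j k hjk).smul_left _).smul_right _

theorem star_parityOp (hZ : IsCARField Z) : star (parityOp Z) = parityOp Z := by
  let _ : NormedAlgebra ℚ (Op K) := .restrictScalars ℚ ℂ _
  have h : star (parityOp Z) * parityOp Z = 1 := by
    rw [parityOp, NormedSpace.star_exp, star_smul, isSelfAdjoint_numberOp,
      ← NormedSpace.exp_add_of_commute (((Commute.refl _).smul_left _).smul_right _), ← add_smul]
    simp
  calc star (parityOp Z) = star (parityOp Z) * parityOp Z * parityOp Z := by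
        rw [mul_assoc, parityOp_sq hZ, mul_one]
    _ = parityOp Z := by rw [h, one_mul]

/-- The annihilators of an orthonormal basis form a family of modes. -/
theorem isModeFamily (hZ : IsCARField Z) {ι : Type*} [Fintype ι] (e : OrthonormalBasis ι ℂ H₁) :
    IsModeFamily (parityOp Z) fun k => Z (e k) where
  mode k :=
    { parity_sq := parityOp_sq hZ
      star_parity := star_parityOp hZ
      parity_mul := parityOp_mul hZ _
      sq := by
        have := hZ.anticomm (e k) (e k)
        rwa [← two_smul ℂ, smul_eq_zero_iff_right two_ne_zero] at this
      anticomm := by rw [hZ.anticomm_star]; simp }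
  anticomm j k _ := eq_neg_of_add_eq_zero_left (hZ.anticomm _ _)
  anticomm_star j k hjk := by
    apply eq_neg_of_add_eq_zero_left
    rw [hZ.anticomm_star, e.orthonormal.2 hjk, zero_smul]

/-- The monomials in the modes of an orthonormal basis span the CAR algebra. -/
theorem span_monomials_eq_top (hZ : IsCARField Z) (hirr : ActsIrreducibly Z) {n : ℕ}
    (e : OrthonormalBasis (Fin n) ℂ H₁) (μ : Fin n → ℝ) :
    Submodule.span ℂ (Set.range (excitationProd (fun k => Z (e k)) μ (List.finRange n))) = ⊤ :=
  span_excitationProd (isModeFamily hZ e) μ (List.nodup_finRange n) List.mem_finRange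
    (adjoin_field_eq_top hirr e)

/-! ### Gaussian densities -/

theorem gaussianDensity_eq (Z : H₁ →ₗ⋆[ℂ] Op K) (Q : Op H₁) :
    gaussianDensity Z Q = ((List.finRange (finrank ℂ H₁)).map fun j =>
      modeDensity (Z (eigenBasis Q j)) (eigenVal Q j)).prod := by
  rw [gaussianDensity, List.ofFn_eq_map]
  rfl

/-- The Gaussian density satisfies the relations of `IsModeKMS` for each eigenvector of its symbol,
not only for the eigenvectors that define it. -/
theorem isModeKMS_gaussianDensity (hZ : IsCARField Z) {Q : Op H₁} (hQ : IsSelfAdjoint Q) {ψ : H₁}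
    {μ : ℝ} (hψ : Q ψ = (μ : ℂ) • ψ) : IsModeKMS (parityOp Z) (Z ψ) μ (gaussianDensity Z Q) := by
  set f := eigenBasis Q
  set ρ := gaussianDensity Z Q with hρ
  have hk : ∀ k, IsModeKMS (parityOp Z) (Z (f k)) (eigenVal Q k) ρ := by
    intro k
    rw [hρ, gaussianDensity_eq]
    exact isModeKMS_prod_modeDensity (isModeFamily hZ f) _ (List.nodup_finRange _)
      (List.mem_finRange k)
  -- The coefficients of `ψ` vanish off the eigenspace of `μ`.
  have hc : ∀ k, ⟪ψ, f k⟫_ℂ ≠ 0 → eigenVal Q k = μ := by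
    intro k hne
    have h1 : ⟪Q ψ, f k⟫_ℂ = ⟪ψ, Q (f k)⟫_ℂ := by
      conv_lhs => rw [← hQ.star_eq]
      rw [ContinuousLinearMap.star_eq_adjoint, ContinuousLinearMap.adjoint_inner_left]
    rw [hψ, apply_eigenBasis hQ, inner_smul_left, inner_smul_right, Complex.conj_ofReal] at h1
    exact_mod_cast (mul_right_cancel₀ hne h1).symm
  have hW : ∀ c : ℂ, ∀ k, eigenVal Q k = μ ∨ c = 0 → IsModeKMS (parityOp Z) (c • Z (f k)) μ ρ := by
    rintro c k (h | rfl)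
    · subst h
      refine ⟨?_, ?_, (hk k).parity⟩
      · rw [smul_mul_assoc, mul_smul_comm, smul_comm, (hk k).ann, smul_comm]
      · rw [star_smul, smul_mul_assoc, mul_smul_comm, smul_comm, (hk k).cre, smul_comm]
    · refine ⟨?_, ?_, (hk k).parity⟩ <;> simp
  have hall : ∀ k, IsModeKMS (parityOp Z) (⟪ψ, f k⟫_ℂ • Z (f k)) μ ρ := fun k => hW _ k (by
    by_cases h : ⟪ψ, f k⟫_ℂ = 0
    · exact Or.inr h
    · exact Or.inl (hc k h))
  rw [field_expand Z f ψ]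
  refine ⟨?_, ?_, ?_⟩
  · rw [Finset.sum_mul, Finset.mul_sum, Finset.smul_sum, Finset.smul_sum]
    exact Finset.sum_congr rfl fun k _ => (hall k).ann
  · rw [star_sum, Finset.sum_mul, Finset.mul_sum, Finset.smul_sum, Finset.smul_sum]
    exact Finset.sum_congr rfl fun k _ => (hall k).cre
  · rw [hρ, gaussianDensity_eq]
    refine Commute.list_prod_right _ _ fun x hx => ?_
    obtain ⟨j, -, rfl⟩ := List.mem_map.mp hx
    exact (isModeKMS_modeDensity ((isModeFamily hZ f).mode j) _).parity

theorem eigenVal_nonneg {Q : Op H₁} (hQ : 0 ≤ Q) (j : Fin (finrank ℂ H₁)) : 0 ≤ eigenVal Q j :=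
  ((ContinuousLinearMap.nonneg_iff_isPositive Q).mp hQ).re_inner_nonneg_right _

theorem eigenVal_le_one {Q : Op H₁} (hQ : Q ≤ 1) (j : Fin (finrank ℂ H₁)) : eigenVal Q j ≤ 1 := by
  have h := (ContinuousLinearMap.le_def Q 1).mp hQ |>.re_inner_nonneg_right (eigenBasis Q j)
  rw [_root_.sub_apply, inner_sub_right, map_sub, one_apply_eq_self] at h
  simpa [eigenVal] using h

theorem tau_gaussianDensity [Nontrivial K] (hZ : IsCARField Z) (Q : Op H₁) :
    tau (gaussianDensity Z Q) = 1 := by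
  rw [gaussianDensity_eq]
  exact (trace_prod_modeDensity (tauLinear K) tauLinear_mul_comm (isModeFamily hZ (eigenBasis Q)) _
    (List.nodup_finRange _)).trans tau_one

theorem modeDensity_nonneg (z : Op K) {μ : ℝ} (h0 : 0 ≤ μ) (h1 : μ ≤ 1) : 0 ≤ modeDensity z μ := by
  have e1 : (2 * (1 - μ) : ℂ) • (z * star z) = (2 * (1 - μ) : ℝ) • (z * star z) := by
    rw [← Complex.coe_smul]; push_cast; rfl
  have e2 : (2 * μ : ℂ) • (star z * z) = (2 * μ : ℝ) • (star z * z) := by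
    rw [← Complex.coe_smul]; push_cast; rfl
  rw [modeDensity, e1, e2]
  exact add_nonneg (smul_nonneg (by linarith) (mul_star_self_nonneg z))
    (smul_nonneg (by linarith) (star_mul_self_nonneg z))

theorem isDensity_gaussianDensity [Nontrivial K] (hZ : IsCARField Z) {Q : Op H₁} (h0 : 0 ≤ Q)
    (h1 : Q ≤ 1) : IsDensity (gaussianDensity Z Q) := by
  refine ⟨?_, tau_gaussianDensity hZ Q⟩
  rw [gaussianDensity_eq]
  have hf := isModeFamily hZ (eigenBasis Q)
  have hl := List.nodup_finRange (finrank ℂ H₁)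
  generalize List.finRange (finrank ℂ H₁) = l at hl
  induction l with
  | nil => simp
  | cons k l ih =>
    rw [List.nodup_cons] at hl
    rw [List.map_cons, List.prod_cons]
    refine Commute.mul_nonneg (modeDensity_nonneg _ (eigenVal_nonneg h0 k) (eigenVal_le_one h1 k))
      (ih hl.2) (Commute.list_prod_right _ _ fun x hx => ?_)
    obtain ⟨j, hj, rfl⟩ := List.mem_map.mp hx
    have hjk : k ≠ j := fun e => hl.1 (e ▸ hj)
    refine commute_modeDensity ?_ (hf.mode j) _
    exact (commute_modeDensity ((hf.star_commute_num hjk.symm).mul_left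
      (hf.commute_num hjk.symm)) (hf.mode k) _).symm

end CAR

/-! ### Beam splitters -/

section BeamSplitter

variable {R : Type*} [Ring R]

theorem anticomm_lin [Algebra ℂ R] {a b c : R} (x y : ℂ) (h1 : c * a = -(a * c))
    (h2 : c * b = -(b * c)) :
    c * (x • a + y • b) = -((x • a + y • b) * c) := by
  rw [mul_add, add_mul, mul_smul_comm, mul_smul_comm, smul_mul_assoc, smul_mul_assoc, h1, h2]
  module

variable [StarRing R]

theorem commute_num_of_anticomm {f g : R} (h1 : g * f = -(f * g))
    (h2 : g * star f = -(star f * g)) : Commute g (star f * f) := by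
  rw [commute_iff_eq, ← mul_assoc, h2, neg_mul, mul_assoc, h1, mul_neg, neg_neg, mul_assoc]

variable [Algebra ℂ R]

/-- The self-adjoint unitary `1 - 2 f* f` that implements the reflection `f ↦ -f` of a mode. -/
def modeReflection (f : R) : R := 1 - (2 : ℂ) • (star f * f)

theorem modeReflection_conj {W f : R} (h : IsMode W f) :
    modeReflection f * f * modeReflection f = -f := by
  simp only [modeReflection, mul_sub, sub_mul, mul_one, one_mul, mul_smul_comm, smul_mul_assoc,
    h.num_mul, h.mul_num, smul_zero, sub_zero]
  module

variable [StarModule ℂ R]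

variable {ι : Type*} {W : R} {z : ι → R}

/-- A rotation of two modes of a family is a mode. -/
theorem isMode_rotation (h : IsModeFamily W z) {i j : ι} (hij : i ≠ j) {a b : ℝ}
    (hab : a ^ 2 + b ^ 2 = 1) : IsMode W ((a : ℂ) • z i + (b : ℂ) • z j) where
  parity_sq := (h.mode i).parity_sq
  star_parity := (h.mode i).star_parity
  parity_mul := anticomm_lin _ _ (h.mode i).parity_mul (h.mode j).parity_mul
  sq := by
    simp only [mul_add, add_mul, mul_smul_comm, smul_mul_assoc, (h.mode i).sq, (h.mode j).sq,
      h.anticomm i j hij]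
    module
  anticomm := by
    have hab' : (a : ℂ) ^ 2 + (b : ℂ) ^ 2 = 1 := by exact_mod_cast hab
    simp only [star_add, star_smul, mul_add, add_mul, mul_smul_comm, smul_mul_assoc,
      (h.mode i).mul_star, (h.mode j).mul_star, h.anticomm_star i j hij,
      h.anticomm_star j i hij.symm, RCLike.star_def, Complex.conj_ofReal]
    calc _ = ((a : ℂ) ^ 2 + (b : ℂ) ^ 2) • (1 : R) := by module
      _ = 1 := by rw [hab', one_smul]

theorem star_modeReflection (f : R) : star (modeReflection f) = modeReflection f := by
  simp [modeReflection]

theorem modeReflection_mem_unitary {W f : R} (h : IsMode W f) :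
    modeReflection f ∈ unitary R := by
  have : modeReflection f * modeReflection f = 1 := by
    simp only [modeReflection, mul_sub, sub_mul, mul_one, one_mul, mul_smul_comm, smul_mul_assoc,
      h.num_sq]
    module
  rw [Unitary.mem_iff, star_modeReflection]
  exact ⟨this, this⟩

theorem modeReflection_conj_of_commute {W f g : R} (h : IsMode W f) (hg : Commute g (star f * f)) :
    modeReflection f * g * modeReflection f = g := by
  have : Commute g (modeReflection f) := (Commute.one_right g).sub_right (hg.smul_right _)
  have hu := (Unitary.mem_iff.mp (modeReflection_mem_unitary h)).2
  rw [star_modeReflection] at hu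
  rw [← this.eq, mul_assoc, hu, mul_one]

variable {κ : Type*} {y : κ ⊕ κ → R}

/-- The quasi-free automorphism of the self-adjoint unitary with the blocks `[-c, s; s, c]` exists:
it is a product of reflections. -/
theorem exists_beamSplitter (h : IsModeFamily W y) (s c : κ → ℝ) (hs : ∀ k, 0 ≤ s k)
    (hc : ∀ k, 0 ≤ c k) (hsc : ∀ k, s k ^ 2 + c k ^ 2 = 1) {l : List κ} (hl : l.Nodup) :
    ∃ α : R ≃⋆ₐ[ℂ] R,
      (∀ k ∈ l, α (y (.inl k)) = (-c k : ℂ) • y (.inl k) + (s k : ℂ) • y (.inr k) ∧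
        α (y (.inr k)) = (s k : ℂ) • y (.inl k) + (c k : ℂ) • y (.inr k)) ∧
      ∀ k ∉ l, α (y (.inl k)) = y (.inl k) ∧ α (y (.inr k)) = y (.inr k) := by
  induction l with
  | nil => exact ⟨StarAlgEquiv.refl ℂ R, by simp, fun k _ => ⟨rfl, rfl⟩⟩
  | cons k l ih =>
    rw [List.nodup_cons] at hl
    obtain ⟨α, h1, h2⟩ := ih hl.2
    -- `(a, b)` is the eigenvector of `[-c, s; s, c]` for the eigenvalue `-1`.
    set a : ℝ := √((1 + c k) / 2) with ha
    set b : ℝ := -√((1 - c k) / 2) with hb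
    have hck : c k ≤ 1 := by nlinarith [hsc k, sq_nonneg (s k), hc k]
    have ha2 : a ^ 2 = (1 + c k) / 2 := Real.sq_sqrt (by linarith [hc k])
    have hb2 : b ^ 2 = (1 - c k) / 2 := by rw [hb, neg_sq]; exact Real.sq_sqrt (by linarith)
    have hab : a * b = -(s k / 2) := by
      have e : (1 + c k) / 2 * ((1 - c k) / 2) = (s k / 2) ^ 2 := by linear_combination (-hsc k) / 4
      rw [hb, mul_neg, ha, ← Real.sqrt_mul (by linarith [hc k]), e,
        Real.sqrt_sq (by linarith [hs k])]
    have hab1 : a ^ 2 + b ^ 2 = 1 := by rw [ha2, hb2]; ring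
    have hne : (Sum.inl k : κ ⊕ κ) ≠ .inr k := by simp
    set f : R := (a : ℂ) • y (.inl k) + (b : ℂ) • y (.inr k) with hf
    set g : R := (b : ℂ) • y (.inl k) + (-a : ℂ) • y (.inr k) with hg
    have hfm : IsMode W f := isMode_rotation h hne hab1
    have hgf : Commute g (star f * f) := by
      refine commute_num_of_anticomm ?_ ?_
      · simp only [hf, hg, mul_add, add_mul, mul_smul_comm, smul_mul_assoc, (h.mode _).sq,
          h.anticomm _ _ hne]
        module
      · simp only [hf, hg, star_add, star_smul, mul_add, add_mul, mul_smul_comm, smul_mul_assoc,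
          (h.mode _).mul_star, h.anticomm_star _ _ hne, h.anticomm_star _ _ hne.symm,
          RCLike.star_def, Complex.conj_ofReal]
        module
    have ha2' : (a : ℂ) ^ 2 = (1 + c k) / 2 := by exact_mod_cast ha2
    have hb2' : (b : ℂ) ^ 2 = (1 - c k) / 2 := by exact_mod_cast hb2
    have hab' : (a : ℂ) * b = -(s k / 2) := by exact_mod_cast hab
    have eL : y (.inl k) = (a : ℂ) • f + (b : ℂ) • g := by
      have : (a : ℂ) • f + (b : ℂ) • g = ((a : ℂ) ^ 2 + (b : ℂ) ^ 2) • y (.inl k) := by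
        rw [hf, hg]; module
      rw [this, ha2', hb2']
      module
    have eR : y (.inr k) = (b : ℂ) • f + (-a : ℂ) • g := by
      have : (b : ℂ) • f + (-a : ℂ) • g = ((a : ℂ) ^ 2 + (b : ℂ) ^ 2) • y (.inr k) := by
        rw [hf, hg]; module
      rw [this, ha2', hb2']
      module
    let u : unitary R := ⟨modeReflection f, modeReflection_mem_unitary hfm⟩
    let β : R ≃⋆ₐ[ℂ] R := Unitary.conjStarAlgAut ℂ R u
    have hβ : ∀ x, β x = modeReflection f * x * modeReflection f := by
      intro x
      simp only [β, Unitary.conjStarAlgAut_apply]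
      simp only [u, star_modeReflection]
    have βf : β f = -f := by rw [hβ, modeReflection_conj hfm]
    have βg : β g = g := by rw [hβ, modeReflection_conj_of_commute hfm hgf]
    have βL : β (y (.inl k)) = (-c k : ℂ) • y (.inl k) + (s k : ℂ) • y (.inr k) := by
      have : β (y (.inl k)) =
          ((b : ℂ) ^ 2 - (a : ℂ) ^ 2) • y (.inl k) + (-(2 : ℂ) * (a * b)) • y (.inr k) := by
        conv_lhs => rw [eL]
        rw [map_add, map_smul, map_smul, βf, βg, hf, hg]
        module
      rw [this, ha2', hb2', hab']
      module
    have βR : β (y (.inr k)) = (s k : ℂ) • y (.inl k) + (c k : ℂ) • y (.inr k) := by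
      have : β (y (.inr k)) =
          (-(2 : ℂ) * (a * b)) • y (.inl k) + ((a : ℂ) ^ 2 - (b : ℂ) ^ 2) • y (.inr k) := by
        conv_lhs => rw [eR]
        rw [map_add, map_smul, map_smul, βf, βg, hf, hg]
        module
      rw [this, ha2', hb2', hab']
      module
    have βne : ∀ i : κ ⊕ κ, i ≠ .inl k → i ≠ .inr k → β (y i) = y i := by
      intro i hi1 hi2
      rw [hβ]
      refine modeReflection_conj_of_commute hfm (commute_num_of_anticomm ?_ ?_)
      · exact anticomm_lin _ _ (h.anticomm _ _ hi1) (h.anticomm _ _ hi2)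
      · rw [hf, star_add, star_smul, star_smul]
        exact anticomm_lin _ _ (h.anticomm_star _ _ hi1) (h.anticomm_star _ _ hi2)
    refine ⟨α.trans β, fun j hj => ?_, fun j hj => ?_⟩
    · simp only [StarAlgEquiv.trans_apply]
      by_cases hjk : j = k
      · subst hjk
        rw [(h2 j hl.1).1, (h2 j hl.1).2]
        exact ⟨βL, βR⟩
      · have hj' : j ∈ l := (List.mem_cons.mp hj).resolve_left hjk
        have i1 := βne (.inl j) (by simpa using hjk) (by simp)
        have i2 := βne (.inr j) (by simp) (by simpa using hjk)
        rw [(h1 j hj').1, (h1 j hj').2, map_add, map_add, map_smul, map_smul, map_smul, map_smul,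
          i1, i2]
        exact ⟨rfl, rfl⟩
    · simp only [StarAlgEquiv.trans_apply]
      rw [List.mem_cons, not_or] at hj
      rw [(h2 j hj.2).1, (h2 j hj.2).2]
      exact ⟨βne _ (by simpa using hj.1) (by simp), βne _ (by simp) (by simpa using hj.1)⟩

/-- The effect on one mode of mixing it with an ancilla in a Gaussian state and tracing out the
ancilla: each excitation is damped. -/
theorem trace_beamSplitter_op (φ : R →ₗ[ℂ] ℂ) (hφ : ∀ a b, φ (a * b) = φ (b * a))
    (h : IsModeFamily W y) {k : κ} {s c μ ν : ℝ} (hsc : s ^ 2 + c ^ 2 = 1)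
    (hμν : c ^ 2 * (ν - μ) = 0) {ρ a b : R} (hρ : IsModeKMS W (y (.inl k)) ν ρ)
    (ha : a ∈ modeCommutant W (y (.inl k))) (hb : b ∈ modeCommutant W (y (.inl k)))
    (x : Excitation) :
    φ (ρ * (a * x.op ((-c : ℂ) • y (.inl k) + (s : ℂ) • y (.inr k)) μ * b)) =
      (s : ℂ) ^ x.deg * φ (ρ * (a * x.op (y (.inr k)) μ * b)) := by
  have hm := h.mode (.inl k)
  have hne : (Sum.inr k : κ ⊕ κ) ≠ .inl k := by simp
  have hR := h.ann_mem hne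
  have hR' := h.cre_mem hne
  have v := fun (x : Excitation) (hx : x ≠ .vac) a ha b hb =>
    trace_excitation_eq_zero (a := a) (b := b) φ hφ hm hρ ha hb hx
  have v1 := v .ann (by simp) a ha b hb
  have v2 := v .cre (by simp) a ha b hb
  have v3 := v .num (by simp) a ha b hb
  have v4 := v .ann (by simp) _ (mul_mem ha hR') b hb
  have v5 := v .cre (by simp) a ha _ (mul_mem hR hb)
  cases x with
  | vac => simp [Excitation.op, Excitation.deg]
  | ann =>
    simp only [Excitation.op, Excitation.deg, mul_add, add_mul, mul_smul_comm, smul_mul_assoc,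
      map_add, map_smul] at v1 ⊢
    rw [v1]
    simp
  | cre =>
    simp only [Excitation.op, Excitation.deg, star_add, star_smul, mul_add, add_mul, mul_smul_comm,
      smul_mul_assoc, map_add, map_smul] at v2 ⊢
    rw [v2]
    simp
  | num =>
    have hsc' : (s : ℂ) ^ 2 + (c : ℂ) ^ 2 = 1 := by exact_mod_cast hsc
    have hμν' : (c : ℂ) ^ 2 * (ν - μ) = 0 := by exact_mod_cast hμν
    simp only [Excitation.op, Excitation.deg, star_add, star_smul, mul_add, add_mul, mul_sub,
      sub_mul, mul_smul_comm, smul_mul_assoc, map_add, map_sub, map_smul, mul_one, RCLike.star_def,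
      map_neg, Complex.conj_ofReal, smul_eq_mul, mul_assoc] at v3 v4 v5 ⊢
    rw [v4, v5]
    linear_combination (c : ℂ) ^ 2 * v3 + φ (ρ * (a * b)) * hμν' + μ * φ (ρ * (a * b)) * hsc'

/-- Mixing with an ancilla in a Gaussian state damps each monomial by the product of the damping
factors of its excitations. -/
theorem trace_beamSplitter_prod (φ : R →ₗ[ℂ] ℂ) (hφ : ∀ a b, φ (a * b) = φ (b * a))
    (h : IsModeFamily W y) {s c μ ν : κ → ℝ} (hsc : ∀ k, s k ^ 2 + c k ^ 2 = 1)
    (hμν : ∀ k, c k ^ 2 * (ν k - μ k) = 0) {ρ : R}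
    (hρ : ∀ k, IsModeKMS W (y (.inl k)) (ν k) ρ) (m : κ → Excitation) {l : List κ} (hl : l.Nodup)
    (a : R) (ha : ∀ k ∈ l, a ∈ modeCommutant W (y (.inl k))) :
    φ (ρ * (a * excitationProd (fun k => (-c k : ℂ) • y (.inl k) + (s k : ℂ) • y (.inr k)) μ l m)) =
      (l.map fun k => (s k : ℂ) ^ (m k).deg).prod *
        φ (ρ * (a * excitationProd (fun k => y (.inr k)) μ l m)) := by
  induction l generalizing a with
  | nil => simp [excitationProd]
  | cons k l ih =>
    rw [List.nodup_cons] at hl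
    simp only [excitationProd, List.map_cons, List.prod_cons] at ih ⊢
    have hb : (l.map fun j => (m j).op ((-c j : ℂ) • y (.inl j) + (s j : ℂ) • y (.inr j)) (μ j)).prod
        ∈ modeCommutant W (y (.inl k)) := by
      refine list_prod_mem fun x hx => ?_
      obtain ⟨j, hj, rfl⟩ := List.mem_map.mp hx
      have hjk : j ≠ k := fun e => hl.1 (e ▸ hj)
      have i1 : (Sum.inl j : κ ⊕ κ) ≠ .inl k := by simpa using hjk
      have i2 : (Sum.inr j : κ ⊕ κ) ≠ .inl k := by simp
      have hz := add_mem (Subalgebra.smul_mem _ (h.ann_mem i1) (-c j : ℂ))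
        (Subalgebra.smul_mem _ (h.ann_mem i2) (s j : ℂ))
      exact Excitation.op_mem _ hz (star_mem_modeCommutant (h.mode _) hz) _ _
    have i2 : ∀ j, (Sum.inr k : κ ⊕ κ) ≠ .inl j := by simp
    rw [← mul_assoc a, trace_beamSplitter_op φ hφ h (hsc k) (hμν k) (hρ k)
      (ha k List.mem_cons_self) hb (m k), ih hl.2 _ fun j hj =>
        mul_mem (ha j (List.mem_cons_of_mem k hj))
          (Excitation.op_mem _ (h.ann_mem (i2 j)) (h.cre_mem (i2 j)) _ _)]
    simp only [mul_assoc]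

end BeamSplitter

/-! ### The doubled CAR algebra -/

section Doubled

variable {H₁ : Type*} [NormedAddCommGroup H₁] [InnerProductSpace ℂ H₁] [FiniteDimensional ℂ H₁]
variable {K : Type*} [NormedAddCommGroup K] [InnerProductSpace ℂ K]

open TensorProduct (mapL mapL_mul)

theorem mapL_one_one : (mapL 1 1 : Op (K ⊗[ℂ] K)) = 1 := TensorProduct.mapL_id_id

theorem mapL_neg_left (A B : Op K) : mapL (-A) B = -(mapL A B : Op (K ⊗[ℂ] K)) := by
  apply eq_neg_of_add_eq_zero_left
  rw [← TensorProduct.mapL_add_left, neg_add_cancel, TensorProduct.mapL_zero_left]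

theorem mapL_neg_right (A B : Op K) : mapL A (-B) = -(mapL A B : Op (K ⊗[ℂ] K)) := by
  apply eq_neg_of_add_eq_zero_left
  rw [← TensorProduct.mapL_add_right, neg_add_cancel, TensorProduct.mapL_zero_right]

variable [FiniteDimensional ℂ K] {Z : H₁ →ₗ⋆[ℂ] Op K}

theorem star_mapL (A B : Op K) : star (mapL A B : Op (K ⊗[ℂ] K)) = mapL (star A) (star B) :=
  TensorProduct.adjoint_mapL A B

theorem tau_mapL (A B : Op K) : tau (mapL A B : Op (K ⊗[ℂ] K)) = tau A * tau B := by
  simp only [tau]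
  rw [TensorProduct.toLinearMap_mapL, LinearMap.trace_tensorProduct', finrank_tensorProduct]
  push_cast
  rw [div_mul_div_comm]

theorem embedLeft_apply (Z : H₁ →ₗ⋆[ℂ] Op K) (X : Op K) : embedLeft Z X =
    mapL ((2⁻¹ : ℂ) • (X + parityOp Z * X * parityOp Z)) 1 +
    mapL ((2⁻¹ : ℂ) • (X - parityOp Z * X * parityOp Z)) (parityOp Z) := rfl

/-- Even elements need no Jordan-Wigner twist. -/
theorem embedLeft_of_even (hZ : IsCARField Z) {X : Op K} (h : Commute (parityOp Z) X) :
    embedLeft Z X = mapL X 1 := by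
  have e : parityOp Z * X * parityOp Z = X := by
    rw [h.eq, mul_assoc, parityOp_sq hZ, mul_one]
  have e2 : (2⁻¹ : ℂ) • (X + X) = X := by module
  rw [embedLeft_apply, e, e2, sub_self, smul_zero, TensorProduct.mapL_zero_left, add_zero]

theorem embedLeft_field (hZ : IsCARField Z) (ψ : H₁) :
    embedLeft Z (Z ψ) = mapL (Z ψ) (parityOp Z) := by
  have e : parityOp Z * Z ψ * parityOp Z = -Z ψ := by
    rw [parityOp_mul hZ, neg_mul, mul_assoc, parityOp_sq hZ, mul_one]
  have e2 : (2⁻¹ : ℂ) • (Z ψ - -Z ψ) = Z ψ := by module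
  rw [embedLeft_apply, e, e2, add_neg_cancel, smul_zero, TensorProduct.mapL_zero_left, zero_add]

theorem embedLeft_one (hZ : IsCARField Z) : embedLeft Z 1 = 1 := by
  rw [embedLeft_of_even hZ (Commute.one_right _), mapL_one_one]

theorem embedLeft_mul (hZ : IsCARField Z) (X Y : Op K) :
    embedLeft Z (X * Y) = embedLeft Z X * embedLeft Z Y := by
  have hW := parityOp_sq hZ
  set W := parityOp Z with hWdef
  have hW' : ∀ y, W * (W * y) = y := fun y => by rw [← mul_assoc, hW, one_mul]
  have e1 : (2⁻¹ : ℂ) • (X * Y + W * (X * Y) * W) =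
      (2⁻¹ : ℂ) • (X + W * X * W) * (2⁻¹ : ℂ) • (Y + W * Y * W) +
        (2⁻¹ : ℂ) • (X - W * X * W) * (2⁻¹ : ℂ) • (Y - W * Y * W) := by
    simp only [mul_add, add_mul, mul_sub, sub_mul, smul_mul_assoc, mul_smul_comm, mul_assoc, hW']
    module
  have e2 : (2⁻¹ : ℂ) • (X * Y - W * (X * Y) * W) =
      (2⁻¹ : ℂ) • (X + W * X * W) * (2⁻¹ : ℂ) • (Y - W * Y * W) +
        (2⁻¹ : ℂ) • (X - W * X * W) * (2⁻¹ : ℂ) • (Y + W * Y * W) := by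
    simp only [mul_add, add_mul, mul_sub, sub_mul, smul_mul_assoc, mul_smul_comm, mul_assoc, hW']
    module
  rw [embedLeft_apply, embedLeft_apply, embedLeft_apply, ← hWdef, e1, e2,
    TensorProduct.mapL_add_left, TensorProduct.mapL_add_left, mul_add, add_mul, add_mul, ← mapL_mul,
    ← mapL_mul, ← mapL_mul, ← mapL_mul, hW, one_mul, one_mul, mul_one]
  abel

theorem star_embedLeft (hZ : IsCARField Z) (X : Op K) :
    star (embedLeft Z X) = embedLeft Z (star X) := by
  rw [embedLeft_apply, embedLeft_apply, star_add, star_mapL, star_mapL]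
  simp only [star_smul, star_add, star_sub, star_mul, star_parityOp hZ, star_one, mul_assoc]
  simp

theorem doubledField_inl (Z : H₁ →ₗ⋆[ℂ] Op K) (ψ : H₁) :
    doubledField Z (ψ, 0) = mapL (Z ψ) (parityOp Z) := by
  simp [doubledField]

theorem doubledField_inr (Z : H₁ →ₗ⋆[ℂ] Op K) (ψ : H₁) :
    doubledField Z (0, ψ) = mapL 1 (Z ψ) := by
  simp [doubledField]

/-- The modes of the doubled field that belong to an orthonormal basis. -/
def doubledModes (Z : H₁ →ₗ⋆[ℂ] Op K) {n : ℕ} (e : OrthonormalBasis (Fin n) ℂ H₁) :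
    Fin n ⊕ Fin n → Op (K ⊗[ℂ] K) :=
  Sum.elim (fun k => mapL (Z (e k)) (parityOp Z)) fun k => mapL 1 (Z (e k))

theorem isModeFamily_doubledModes (hZ : IsCARField Z) {n : ℕ}
    (e : OrthonormalBasis (Fin n) ℂ H₁) :
    IsModeFamily (mapL (parityOp Z) (parityOp Z)) (doubledModes Z e) := by
  have h := isModeFamily hZ e
  have hW := parityOp_sq hZ
  have hW' := star_parityOp hZ
  refine ⟨?_, ?_, ?_⟩
  · rintro (k | k)
    · have hk := h.mode k
      refine ⟨?_, ?_, ?_, ?_, ?_⟩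
      · rw [← mapL_mul, hW, mapL_one_one]
      · rw [star_mapL, hW']
      · simp only [doubledModes, Sum.elim_inl, ← mapL_mul, hk.parity_mul, mapL_neg_left]
      · simp only [doubledModes, Sum.elim_inl, ← mapL_mul, hk.sq, TensorProduct.mapL_zero_left]
      · simp only [doubledModes, Sum.elim_inl, star_mapL, ← mapL_mul, hW', hW,
          ← TensorProduct.mapL_add_left, hk.anticomm, mapL_one_one]
    · have hk := h.mode k
      refine ⟨?_, ?_, ?_, ?_, ?_⟩
      · rw [← mapL_mul, hW, mapL_one_one]
      · rw [star_mapL, hW']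
      · simp only [doubledModes, Sum.elim_inr, ← mapL_mul, hk.parity_mul, mapL_neg_right, one_mul,
          mul_one]
      · simp only [doubledModes, Sum.elim_inr, ← mapL_mul, hk.sq, TensorProduct.mapL_zero_right]
      · simp only [doubledModes, Sum.elim_inr, star_mapL, ← mapL_mul, star_one, mul_one,
          ← TensorProduct.mapL_add_right, hk.anticomm, mapL_one_one]
  · rintro (j | j) (k | k) hjk <;> simp only [doubledModes, Sum.elim_inl, Sum.elim_inr, ← mapL_mul]
    · rw [h.anticomm j k (by simpa using hjk), mapL_neg_left]
    · rw [(h.mode k).parity_mul, mapL_neg_right, one_mul, mul_one]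
    · rw [(h.mode j).parity_mul, mapL_neg_right, one_mul, mul_one, neg_neg]
    · rw [h.anticomm j k (by simpa using hjk), mapL_neg_right]
  · rintro (j | j) (k | k) hjk <;>
      simp only [doubledModes, Sum.elim_inl, Sum.elim_inr, star_mapL, ← mapL_mul, star_one, hW']
    · rw [h.anticomm_star j k (by simpa using hjk), mapL_neg_left]
    · rw [(h.mode k).parity_mul_star, mapL_neg_right, one_mul, mul_one]
    · rw [(h.mode j).parity_mul, mapL_neg_right, one_mul, mul_one, neg_neg]
    · rw [h.anticomm_star j k (by simpa using hjk), mapL_neg_right]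

theorem embedRight_mem (hZ : IsCARField Z) {n : ℕ} (e : OrthonormalBasis (Fin n) ℂ H₁) (k : Fin n)
    (ρ : Op K) :
    embedRight ρ ∈ modeCommutant (mapL (parityOp Z) (parityOp Z)) (doubledModes Z e (.inl k)) := by
  rw [mem_modeCommutant]
  simp only [doubledModes, Sum.elim_inl, star_mapL, star_parityOp hZ, ← mapL_mul, parityOp_sq hZ,
    embedRight, commute_iff_eq, one_mul, mul_one, and_self]

/-- Adjoining an ancilla in a Gaussian state gives an element that is Gaussian on the ancilla
modes. -/
theorem isModeKMS_embedLeft (hZ : IsCARField Z) {n : ℕ} (e : OrthonormalBasis (Fin n) ℂ H₁)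
    {k : Fin n} {ν : ℝ} {ρ : Op K} (h : IsModeKMS (parityOp Z) (Z (e k)) ν ρ) :
    IsModeKMS (mapL (parityOp Z) (parityOp Z)) (doubledModes Z e (.inl k)) ν (embedLeft Z ρ) where
  ann := by
    rw [doubledModes, Sum.elim_inl, ← embedLeft_field hZ, ← embedLeft_mul hZ, ← embedLeft_mul hZ,
      ← map_smul, ← map_smul, h.ann]
  cre := by
    rw [doubledModes, Sum.elim_inl, ← embedLeft_field hZ, star_embedLeft hZ, ← embedLeft_mul hZ,
      ← embedLeft_mul hZ, ← map_smul, ← map_smul, h.cre]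
  parity := by
    rw [embedLeft_of_even hZ h.parity, commute_iff_eq, ← mapL_mul, ← mapL_mul, h.parity.eq, one_mul,
      mul_one]

theorem map_excitationOp {R R' : Type*} [Ring R] [StarRing R] [Algebra ℂ R] [Ring R'] [StarRing R']
    [Algebra ℂ R'] (f : R →ₗ[ℂ] R') (h1 : f 1 = 1) (hmul : ∀ a b, f (a * b) = f a * f b)
    (hstar : ∀ a, f (star a) = star (f a)) (z : R) (μ : ℝ) (x : Excitation) :
    f (x.op z μ) = x.op (f z) μ := by
  cases x <;> simp [Excitation.op, h1, hmul, hstar]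

theorem map_excitationProd {R R' ι : Type*} [Ring R] [StarRing R] [Algebra ℂ R] [Ring R']
    [StarRing R'] [Algebra ℂ R'] (f : R →ₗ[ℂ] R') (h1 : f 1 = 1)
    (hmul : ∀ a b, f (a * b) = f a * f b) (hstar : ∀ a, f (star a) = star (f a)) (z : ι → R)
    (μ : ι → ℝ) (l : List ι) (m : ι → Excitation) :
    f (excitationProd z μ l m) = excitationProd (fun k => f (z k)) μ l m := by
  induction l with
  | nil => simpa [excitationProd] using h1
  | cons k l ih =>
    simp only [excitationProd, List.map_cons, List.prod_cons, hmul] at ih ⊢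
    rw [ih, map_excitationOp f h1 hmul hstar]

theorem embedRight_excitationProd {ι : Type*} (z : ι → Op K) (μ : ι → ℝ) (l : List ι)
    (m : ι → Excitation) : embedRight (excitationProd z μ l m) =
      excitationProd (fun k => embedRight (z k)) μ l m := by
  let f : Op K →ₗ[ℂ] Op (K ⊗[ℂ] K) :=
    { toFun := embedRight
      map_add' := fun X Y => TensorProduct.mapL_add_right _ _ _
      map_smul' := fun a X => TensorProduct.mapL_smul_right _ _ _ }
  have f1 : f 1 = 1 := mapL_one_one
  have f2 : ∀ a b, f (a * b) = f a * f b := fun a b => by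
    change (mapL 1 (a * b) : Op (K ⊗[ℂ] K)) = mapL 1 a * mapL 1 b
    rw [← mapL_mul, one_mul]
  have f3 : ∀ a, f (star a) = star (f a) := fun a => by
    change (mapL 1 (star a) : Op (K ⊗[ℂ] K)) = star (mapL 1 a)
    rw [star_mapL, star_one]
  exact map_excitationProd (R := Op K) (R' := Op (K ⊗[ℂ] K)) f f1 f2 f3 z μ l m

/-- For a contraction `S` that is diagonal in `e`, the automorphism `α` with `α (Z x) = Z (U_S x)`
exists. -/
theorem quasiFreeAut_spec (hZ : IsCARField Z) {n : ℕ} (e : OrthonormalBasis (Fin n) ℂ H₁)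
    {S : Op H₁} {s c : Fin n → ℝ} (hs : ∀ k, 0 ≤ s k) (hc : ∀ k, 0 ≤ c k)
    (hsc : ∀ k, s k ^ 2 + c k ^ 2 = 1) (hS : ∀ k, S (e k) = (s k : ℂ) • e k)
    (hS' : ∀ k, star S (e k) = (s k : ℂ) • e k)
    (hC : ∀ k, CFC.sqrt (1 - S * star S) (e k) = (c k : ℂ) • e k)
    (hC' : ∀ k, CFC.sqrt (1 - star S * S) (e k) = (c k : ℂ) • e k) :
    (∀ X, quasiFreeAut (doubledField Z) (dilation S) (star X) =
      star (quasiFreeAut (doubledField Z) (dilation S) X)) ∧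
    ∀ x, quasiFreeAut (doubledField Z) (dilation S) (doubledField Z x) =
      doubledField Z (dilation S x) := by
  refine Classical.epsilon_spec (p := fun α : Op (K ⊗[ℂ] K) ≃ₐ[ℂ] Op (K ⊗[ℂ] K) =>
    (∀ X, α (star X) = star (α X)) ∧
      ∀ x, α (doubledField Z x) = doubledField Z (dilation S x)) ?_
  obtain ⟨α, hα, -⟩ := exists_beamSplitter (isModeFamily_doubledModes hZ e) s c hs hc hsc
    (List.nodup_finRange n)
  refine ⟨α.toAlgEquiv, fun X => α.map_star' X, ?_⟩
  have hL : ∀ k, α (doubledField Z (e k, 0)) = doubledField Z (dilation S (e k, 0)) := by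
    intro k
    have h1 := (hα k (List.mem_finRange k)).1
    have h2 : dilation S (e k, 0) = (-c k : ℂ) • (e k, (0 : H₁)) + (s k : ℂ) • ((0 : H₁), e k) := by
      simp [dilation, hC, hS']
    rw [h2, map_add, LinearMap.map_smulₛₗ, LinearMap.map_smulₛₗ, doubledField_inl,
      doubledField_inr]
    simpa [doubledModes] using h1
  have hR : ∀ k, α (doubledField Z (0, e k)) = doubledField Z (dilation S (0, e k)) := by
    intro k
    have h1 := (hα k (List.mem_finRange k)).2
    have h2 : dilation S (0, e k) = (s k : ℂ) • (e k, (0 : H₁)) + (c k : ℂ) • ((0 : H₁), e k) := by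
      simp [dilation, hC', hS]
    rw [h2, map_add, LinearMap.map_smulₛₗ, LinearMap.map_smulₛₗ, doubledField_inl,
      doubledField_inr]
    simpa [doubledModes] using h1
  let F : (H₁ × H₁) →ₗ⋆[ℂ] Op (K ⊗[ℂ] K) := α.toAlgEquiv.toLinearMap.comp (doubledField Z)
  let G : (H₁ × H₁) →ₗ⋆[ℂ] Op (K ⊗[ℂ] K) := (doubledField Z).comp (dilation S)
  have h1 : F.comp (LinearMap.inl ℂ H₁ H₁) = G.comp (LinearMap.inl ℂ H₁ H₁) :=
    e.toBasis.ext fun k => by simpa [F, G] using hL k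
  have h2 : F.comp (LinearMap.inr ℂ H₁ H₁) = G.comp (LinearMap.inr ℂ H₁ H₁) :=
    e.toBasis.ext fun k => by simpa [F, G] using hR k
  rintro ⟨ψ, η⟩
  have e1 : F (ψ, 0) = G (ψ, 0) := LinearMap.congr_fun h1 ψ
  have e2 : F (0, η) = G (0, η) := LinearMap.congr_fun h2 η
  have : F (ψ, η) = G (ψ, η) := by
    rw [← Prod.fst_add_snd (ψ, η), map_add, map_add, e1, e2]
  exact this

/-- An operation `Φ_{S,R}` that is diagonal in `e` damps the monomials in the modes of `e`. -/
theorem tau_star_mul_ehk (hZ : IsCARField Z) [Nontrivial K] {n : ℕ}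
    (e : OrthonormalBasis (Fin n) ℂ H₁) {S R : Op H₁} {s c μ ν : Fin n → ℝ} (hs : ∀ k, 0 ≤ s k)
    (hc : ∀ k, 0 ≤ c k) (hsc : ∀ k, s k ^ 2 + c k ^ 2 = 1)
    (hμν : ∀ k, c k ^ 2 * (ν k - μ k) = 0) (hS : ∀ k, S (e k) = (s k : ℂ) • e k)
    (hS' : ∀ k, star S (e k) = (s k : ℂ) • e k)
    (hC : ∀ k, CFC.sqrt (1 - S * star S) (e k) = (c k : ℂ) • e k)
    (hC' : ∀ k, CFC.sqrt (1 - star S * S) (e k) = (c k : ℂ) • e k)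
    (hT : IsSelfAdjoint (ancillaSymbol S R)) (hTe : ∀ k, ancillaSymbol S R (e k) = (ν k : ℂ) • e k)
    (m : Fin n → Excitation) (ρ : Op K) :
    tau (star (excitationProd (fun k => Z (e k)) μ (List.finRange n) m) * ehk Z S R ρ) =
      (∏ k, (s k : ℂ) ^ (m k).deg) *
        tau (star (excitationProd (fun k => Z (e k)) μ (List.finRange n) m) * ρ) := by
  obtain ⟨hα, hα'⟩ := quasiFreeAut_spec hZ e hs hc hsc hS hS' hC hC'
  set α := quasiFreeAut (doubledField Z) (dilation S) with hαdef
  set σ := gaussianDensity Z (ancillaSymbol S R) with hσ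
  have hKMS : ∀ k, IsModeKMS (parityOp Z) (Z (e k)) (ν k) σ := fun k =>
    isModeKMS_gaussianDensity hZ hT (hTe k)
  have hev : Commute (parityOp Z) σ := by
    rw [hσ, gaussianDensity_eq]
    refine Commute.list_prod_right _ _ fun x hx => ?_
    obtain ⟨j, -, rfl⟩ := List.mem_map.mp hx
    exact (isModeKMS_modeDensity ((isModeFamily hZ _).mode j) _).parity
  have h1 : ehk Z S R ρ =
      hsAdjoint (embedLeft Z) (α.symm (embedLeft Z σ * embedRight ρ)) := rfl
  have hαL : ∀ k, α (embedLeft Z (Z (e k))) = (-c k : ℂ) • doubledModes Z e (.inl k) +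
      (s k : ℂ) • doubledModes Z e (.inr k) := by
    intro k
    have h2 : dilation S (e k, 0) = (-c k : ℂ) • (e k, (0 : H₁)) + (s k : ℂ) • ((0 : H₁), e k) := by
      simp [dilation, hC, hS']
    rw [embedLeft_field hZ, ← doubledField_inl, hα', h2, map_add, LinearMap.map_smulₛₗ,
      LinearMap.map_smulₛₗ, doubledField_inl, doubledField_inr]
    simp only [doubledModes, Sum.elim_inl, Sum.elim_inr, map_neg, Complex.conj_ofReal]
  set l := (List.finRange n).reverse with hl
  set m' : Fin n → Excitation := fun k => (m k).adj with hm'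
  have hstar : ∀ X : Op K, star (embedLeft Z (star X)) = embedLeft Z X := fun X => by
    rw [star_embedLeft hZ, star_star]
  rw [h1, tau_star_mul_hsAdjoint, tau_mul_algEquiv_symm, star_embedLeft hZ, star_excitationProd,
    ← hl, ← hm']
  have h2 : α (embedLeft Z (excitationProd (fun k => Z (e k)) μ l m')) =
      excitationProd (fun k => (-c k : ℂ) • doubledModes Z e (.inl k) +
        (s k : ℂ) • doubledModes Z e (.inr k)) μ l m' := by
    have := map_excitationProd (α.toLinearMap.comp (embedLeft Z))
      (by simp [embedLeft_one hZ]) (by simp [embedLeft_mul hZ])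
      (fun a => by simp [← star_embedLeft hZ, hα]) (fun k => Z (e k)) μ l m'
    simp only [LinearMap.comp_apply, AlgEquiv.toLinearMap_apply, hαL] at this
    exact this
  have h3 : embedRight (excitationProd (fun k => Z (e k)) μ l m') =
      excitationProd (fun k => doubledModes Z e (.inr k)) μ l m' :=
    embedRight_excitationProd _ μ l m'
  have hlnd : l.Nodup := List.nodup_reverse.mpr (List.nodup_finRange n)
  have h4 := trace_beamSplitter_prod (tauLinear (K ⊗[ℂ] K)) tauLinear_mul_comm
    (isModeFamily_doubledModes hZ e) hsc hμν (fun k => isModeKMS_embedLeft hZ e (hKMS k)) m' hlnd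
    (embedRight ρ) fun k _ => embedRight_mem hZ e k ρ
  have h5 : (l.map fun k => (s k : ℂ) ^ (m' k).deg).prod = ∏ k, (s k : ℂ) ^ (m k).deg := by
    rw [hl, List.map_reverse, List.prod_reverse, Fin.prod_univ_def]
    simp only [hm', Excitation.deg_adj]
  rw [h2, tau_mul_comm, mul_assoc]
  refine h4.trans ?_
  rw [h5, ← h3]
  congr 1
  change tau (embedLeft Z σ * (embedRight ρ * _)) = _
  rw [embedLeft_of_even hZ hev, embedRight, embedRight, ← mapL_mul, ← mapL_mul, one_mul, mul_one,
    one_mul, tau_mapL, tau_gaussianDensity hZ, one_mul, tau_mul_comm]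

end Doubled

/-! ### Operators that are diagonal in an orthonormal basis -/

section Diagonal

variable {E : Type*} [NormedAddCommGroup E] [InnerProductSpace ℂ E]
variable {n : ℕ} (e : OrthonormalBasis (Fin n) ℂ E)

/-- The operator with eigenvectors `e k` and real eigenvalues `d k`. -/
def diagOp (d : Fin n → ℝ) : Op E := ∑ k, (d k : ℂ) • InnerProductSpace.rankOne ℂ (e k) (e k)

variable {e}

theorem diagOp_apply (d : Fin n → ℝ) (k : Fin n) : diagOp e d (e k) = (d k : ℂ) • e k := by
  rw [diagOp, _root_.sum_apply, Finset.sum_eq_single k]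
  · simp
  · intro j _ hj
    simp [e.orthonormal.2 hj]
  · simp

theorem ext_basis {X Y : Op E} (h : ∀ k, X (e k) = Y (e k)) : X = Y :=
  ContinuousLinearMap.coe_inj.mp (e.toBasis.ext fun k => by simpa using h k)

theorem eq_diagOp {X : Op E} {d : Fin n → ℝ} (h : ∀ k, X (e k) = (d k : ℂ) • e k) :
    X = diagOp e d :=
  ext_basis (e := e) fun k => by rw [h, diagOp_apply]

theorem diagOp_mul (d d' : Fin n → ℝ) : diagOp e d * diagOp e d' =
    diagOp e fun k => d k * d' k := by
  refine eq_diagOp fun k => ?_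
  rw [mul_apply_eq_comp, diagOp_apply, map_smul, diagOp_apply, smul_smul, Complex.ofReal_mul,
    mul_comm]

theorem one_eq_diagOp : (1 : Op E) = diagOp e fun _ => 1 := eq_diagOp fun k => by simp

theorem diagOp_sub (d d' : Fin n → ℝ) : diagOp e d - diagOp e d' =
    diagOp e fun k => d k - d' k := by
  refine eq_diagOp fun k => ?_
  rw [_root_.sub_apply, diagOp_apply, diagOp_apply, ← sub_smul, Complex.ofReal_sub]

theorem tendsto_diagOp {α : Type*} {F : Filter α} {d : α → Fin n → ℝ} {d' : Fin n → ℝ}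
    (h : ∀ k, Tendsto (fun x => d x k) F (𝓝 (d' k))) :
    Tendsto (fun x => diagOp e (d x)) F (𝓝 (diagOp e d')) := by
  refine tendsto_finsetSum _ fun k _ => ?_
  exact ((Complex.continuous_ofReal.tendsto _).comp (h k)).smul_const _

theorem nonneg_of_diagOp_nonneg {d : Fin n → ℝ} (h : 0 ≤ diagOp e d) (k : Fin n) : 0 ≤ d k := by
  have := ((ContinuousLinearMap.nonneg_iff_isPositive _).mp h).re_inner_nonneg_right (e k)
  rw [diagOp_apply, inner_smul_right] at this
  simpa using this

theorem two_smul_diagOp (h : Fin n → ℝ) : (2 : ℂ) • diagOp e h = diagOp e fun k => 2 * h k := by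
  refine eq_diagOp fun k => ?_
  rw [_root_.smul_apply, diagOp_apply, smul_smul]
  push_cast
  rfl

variable [FiniteDimensional ℂ E]

theorem star_diagOp (d : Fin n → ℝ) : star (diagOp e d) = diagOp e d := by
  simp [diagOp, ContinuousLinearMap.star_eq_adjoint]

theorem diagOp_nonneg {d : Fin n → ℝ} (h : ∀ k, 0 ≤ d k) : 0 ≤ diagOp e d := by
  have : diagOp e d = star (diagOp e fun k => √(d k)) * diagOp e fun k => √(d k) := by
    rw [star_diagOp, diagOp_mul]
    simp only [Real.mul_self_sqrt (h _)]
  rw [this]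
  exact star_mul_self_nonneg _

theorem diagOp_mono {d d' : Fin n → ℝ} (h : ∀ k, d k ≤ d' k) : diagOp e d ≤ diagOp e d' := by
  rw [← sub_nonneg, diagOp_sub]
  exact diagOp_nonneg fun k => sub_nonneg.mpr (h k)

theorem sqrt_diagOp {d : Fin n → ℝ} (h : ∀ k, 0 ≤ d k) :
    CFC.sqrt (diagOp e d) = diagOp e fun k => √(d k) := by
  refine CFC.sqrt_unique ?_ (diagOp_nonneg fun k => Real.sqrt_nonneg _)
  rw [diagOp_mul]
  simp only [Real.mul_self_sqrt (h _)]

theorem rpow_neg_half_diagOp {d : Fin n → ℝ} (h : ∀ k, 0 < d k) :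
    (diagOp e d) ^ (-1 / 2 : ℝ) = diagOp e fun k => (√(d k))⁻¹ := by
  have h0 : 0 ≤ diagOp e d := diagOp_nonneg fun k => (h k).le
  have hu : IsUnit (diagOp e d) := by
    refine ⟨⟨diagOp e d, diagOp e fun k => (d k)⁻¹, ?_, ?_⟩, rfl⟩ <;>
      rw [diagOp_mul, one_eq_diagOp (e := e)] <;> simp [(h _).ne']
  have h1 := CFC.rpow_neg_mul_rpow (a := diagOp e d) (1 / 2) (hu.isStrictlyPositive h0)
  rw [← CFC.sqrt_eq_rpow, sqrt_diagOp fun k => (h k).le] at h1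
  have h2 : (diagOp e fun k => √(d k)) * (diagOp e fun k => (√(d k))⁻¹) = 1 := by
    rw [diagOp_mul, one_eq_diagOp (e := e)]
    simp [fun k => (Real.sqrt_pos.mpr (h k)).ne']
  have h3 : (-1 / 2 : ℝ) = -(1 / 2) := by norm_num
  rw [h3]
  exact left_inv_eq_right_inv h1 h2

theorem exp_diagOp (d : Fin n → ℝ) (c : ℝ) :
    NormedSpace.exp ((c : ℂ) • diagOp e d) = diagOp e fun k => Real.exp (c * d k) := by
  refine eq_diagOp fun k => ?_
  have h1 := (NormedSpace.exp_series_hasSum_exp' (𝕂 := ℂ) ((c : ℂ) • diagOp e d)).mapL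
    (ContinuousLinearMap.apply ℂ E (e k))
  have h2 := (NormedSpace.exp_series_hasSum_exp' (𝕂 := ℂ) (c * d k : ℂ)).smul_const (e k)
  have e1 : ∀ i : ℕ, (((c : ℂ) • diagOp e d) ^ i) (e k) = (c * d k : ℂ) ^ i • e k := by
    intro i
    induction i with
    | zero => simp
    | succ i ih =>
      rw [pow_succ, mul_apply_eq_comp, _root_.smul_apply, diagOp_apply, smul_smul, map_smul, ih,
        smul_smul, pow_succ']
  rw [Complex.ofReal_exp, Complex.exp_eq_exp_ℂ]
  push_cast
  refine h1.unique ?_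
  convert h2 using 2 with i
  rw [ContinuousLinearMap.apply_apply, _root_.smul_apply, e1, smul_assoc]

/-- A self-adjoint operator is determined on an eigenvector by a real eigenvalue. -/
theorem exists_real_eigenvalue {X : Op E} (hX : IsSelfAdjoint X) {v : E} (hv : ‖v‖ = 1) {c : ℂ}
    (h : X v = c • v) : ∃ r : ℝ, X v = (r : ℂ) • v := by
  have h1 : ⟪X v, v⟫_ℂ = ⟪v, X v⟫_ℂ := by
    conv_lhs => rw [← hX.star_eq]
    rw [ContinuousLinearMap.star_eq_adjoint, ContinuousLinearMap.adjoint_inner_left]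
  rw [h, inner_smul_left, inner_smul_right, inner_self_eq_norm_sq_to_K, hv] at h1
  simp only [RCLike.ofReal_one, one_pow, mul_one] at h1
  obtain ⟨r, hr⟩ := Complex.conj_eq_iff_real.mp h1
  exact ⟨r, by rw [h, hr]⟩

/-- Commuting self-adjoint operators are simultaneously diagonalizable. -/
theorem exists_joint_diagOp {A B : Op E} (hA : IsSelfAdjoint A) (hB : IsSelfAdjoint B)
    (hAB : Commute A B) : ∃ (e : OrthonormalBasis (Fin (finrank ℂ E)) ℂ E)
      (a b : Fin (finrank ℂ E) → ℝ), A = diagOp e a ∧ B = diagOp e b := by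
  classical
  have hA' := ContinuousLinearMap.isSelfAdjoint_iff_isSymmetric.mp hA
  have hB' := ContinuousLinearMap.isSelfAdjoint_iff_isSymmetric.mp hB
  have hAB' : Commute (A : E →ₗ[ℂ] E) (B : E →ₗ[ℂ] E) :=
    congrArg ContinuousLinearMap.toLinearMap hAB
  have hint := LinearMap.IsSymmetric.directSum_isInternal_of_commute hA' hB' hAB'
  have horth := LinearMap.IsSymmetric.orthogonalFamily_eigenspace_inf_eigenspace hA' hB'
  have hint' := DirectSum.isInternal_ne_bot_iff.mpr hint
  have horth' := horth.comp (Subtype.val_injective (p := fun i : ℂ × ℂ =>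
    (Module.End.eigenspace (A : E →ₗ[ℂ] E) i.2 ⊓ Module.End.eigenspace (B : E →ₗ[ℂ] E) i.1) ≠ ⊥))
  let _ := hint.submodule_iSupIndep.fintypeNeBotOfFiniteDimensional
  let e := hint'.subordinateOrthonormalBasis rfl horth'
  have he : ∀ k, ∃ i : ℂ × ℂ, A (e k) = i.2 • e k ∧ B (e k) = i.1 • e k := by
    intro k
    have := hint'.subordinateOrthonormalBasis_subordinate rfl k horth'
    exact ⟨_, Module.End.mem_eigenspace_iff.mp this.1, Module.End.mem_eigenspace_iff.mp this.2⟩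
  have h1 : ∀ k, ∃ r : ℝ, A (e k) = (r : ℂ) • e k := fun k => by
    obtain ⟨i, hi, -⟩ := he k
    exact exists_real_eigenvalue hA (e.orthonormal.1 k) hi
  have h2 : ∀ k, ∃ r : ℝ, B (e k) = (r : ℂ) • e k := fun k => by
    obtain ⟨i, -, hi⟩ := he k
    exact exists_real_eigenvalue hB (e.orthonormal.1 k) hi
  choose a ha using h1
  choose b hb using h2
  exact ⟨e, a, b, eq_diagOp ha, eq_diagOp hb⟩

end Diagonal

/-! ### The symbols of the Mehler semigroup -/

section Symbols

variable {H₁ : Type*} [NormedAddCommGroup H₁] [InnerProductSpace ℂ H₁]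
variable {n : ℕ} {e : OrthonormalBasis (Fin n) ℂ H₁} {h a s lam : Fin n → ℝ}

/-- The eigenvalues of the ancilla symbol of the pair `(s, (1 - s²) lam)`. The symbol vanishes on
the kernel of `1 - s²`. -/
def ancillaVal (s lam : Fin n → ℝ) (k : Fin n) : ℝ := if 1 - s k ^ 2 = 0 then 0 else lam k

theorem ancillaVal_spec (s lam : Fin n → ℝ) (k : Fin n) :
    (1 - s k ^ 2) * ancillaVal s lam k = (1 - s k ^ 2) * lam k := by
  by_cases hk : 1 - s k ^ 2 = 0 <;> simp [ancillaVal, hk]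

theorem diagOp_eq_zero_of_ker (ψ : H₁) (hψ : diagOp e (fun k => 1 - s k ^ 2) ψ = 0) :
    diagOp e (ancillaVal s lam) ψ = 0 := by
  let ω : Fin n → ℝ := fun k => if 1 - s k ^ 2 = 0 then 0 else lam k * (1 - s k ^ 2)⁻¹
  have : diagOp e (ancillaVal s lam) = diagOp e ω * diagOp e fun k => 1 - s k ^ 2 := by
    rw [diagOp_mul]
    congr 1
    ext k
    by_cases hk : 1 - s k ^ 2 = 0 <;> simp [ancillaVal, ω, hk]
  rw [this, mul_apply_eq_comp, hψ, map_zero]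

variable [FiniteDimensional ℂ H₁]

/-- On a joint eigenvector with `H = h` and `A = a` the symbol is `a / (2 h)`; if `h = 0` then
`a = 0`, and the division by zero gives the correct value `0`. -/
theorem tendsto_mehlerSymbolApprox (ha : ∀ k, 0 ≤ a k) (hah : ∀ k, a k ≤ 2 * h k) :
    Tendsto (mehlerSymbolApprox (diagOp e h) (diagOp e a)) (𝓝[>] 0)
      (𝓝 (diagOp e fun k => a k / (2 * h k))) := by
  have h1 : ∀ᶠ ε in 𝓝[>] (0 : ℝ), diagOp e (fun k => a k / (2 * h k + ε)) =
      mehlerSymbolApprox (diagOp e h) (diagOp e a) ε := by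
    filter_upwards [self_mem_nhdsWithin] with ε hε
    have hε : 0 < ε := hε
    have h2 : (2 : ℂ) • diagOp e h + (ε : ℂ) • 1 = diagOp e fun k => 2 * h k + ε := by
      refine eq_diagOp fun k => ?_
      rw [_root_.add_apply, two_smul_diagOp, diagOp_apply, _root_.smul_apply, one_apply_eq_self,
        ← add_smul]
      push_cast
      rfl
    have h3 : ∀ k, 0 < 2 * h k + ε := fun k => by linarith [ha k, hah k]
    rw [mehlerSymbolApprox, h2, rpow_neg_half_diagOp h3, diagOp_mul, diagOp_mul]
    congr 1
    ext k
    have h4 := Real.mul_self_sqrt (h3 k).le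
    have h5 := (Real.sqrt_pos.mpr (h3 k)).ne'
    rw [← h4]
    field_simp
    rw [Real.sqrt_sq (Real.sqrt_nonneg _)]
  refine Tendsto.congr' h1 (tendsto_diagOp fun k => ?_)
  rcases eq_or_ne (h k) 0 with h0 | h0
  · have : a k = 0 := le_antisymm (by simpa [h0] using hah k) (ha k)
    simp [this]
  · have h6 : Tendsto (fun ε : ℝ => a k / (2 * h k + ε)) (𝓝 0) (𝓝 (a k / (2 * h k + 0))) :=
      tendsto_const_nhds.div (tendsto_const_nhds.add tendsto_id) (by simpa using h0)
    rw [add_zero] at h6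
    exact h6.mono_left nhdsWithin_le_nhds

theorem mehlerSymbol_diagOp (ha : ∀ k, 0 ≤ a k) (hah : ∀ k, a k ≤ 2 * h k) :
    mehlerSymbol (diagOp e h) (diagOp e a) = diagOp e fun k => a k / (2 * h k) :=
  (tendsto_mehlerSymbolApprox ha hah).limUnder_eq

theorem mehlerS_diagOp (t : ℝ) : mehlerS (diagOp e h) t =
    diagOp e fun k => Real.exp (-t * h k) := by
  rw [mehlerS, ← exp_diagOp]
  push_cast
  rfl

theorem mehlerR_diagOp (ha : ∀ k, 0 ≤ a k) (hah : ∀ k, a k ≤ 2 * h k) (t : ℝ) :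
    mehlerR (diagOp e h) (diagOp e a) t =
      diagOp e fun k => (1 - Real.exp (-t * h k) ^ 2) * (a k / (2 * h k)) := by
  have h1 : (-(2 * t : ℂ)) = ((-(2 * t) : ℝ) : ℂ) := by push_cast; rfl
  rw [mehlerR, mehlerSymbol_diagOp ha hah, h1, exp_diagOp, one_eq_diagOp (e := e), diagOp_sub,
    diagOp_mul]
  congr 1
  ext k
  rw [← Real.exp_nat_mul]
  congr 3
  push_cast
  ring

theorem isCompatiblePair_diagOp (hs : ∀ k, 0 ≤ s k) (hs1 : ∀ k, s k ≤ 1)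
    (hl : ∀ k, 0 ≤ lam k) (hl1 : ∀ k, lam k ≤ 1) :
    IsCompatiblePair (diagOp e s) (diagOp e fun k => (1 - s k ^ 2) * lam k) := by
  have h2 : ∀ k, 0 ≤ 1 - s k ^ 2 := fun k => by nlinarith [hs k, hs1 k]
  refine ⟨?_, diagOp_nonneg fun k => mul_nonneg (h2 k) (hl k), ?_⟩
  · refine (CStarAlgebra.norm_le_one_iff_of_nonneg (A := Op H₁) (diagOp e s)
      (diagOp_nonneg hs)).mpr ?_
    rw [one_eq_diagOp (e := e)]
    exact diagOp_mono hs1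
  · rw [star_diagOp, diagOp_mul, one_eq_diagOp (e := e), diagOp_sub]
    refine diagOp_mono fun k => ?_
    nlinarith [mul_le_of_le_one_right (h2 k) (hl1 k)]

theorem one_sub_diagOp_mul_star : 1 - diagOp e s * star (diagOp e s) =
    diagOp e fun k => 1 - s k ^ 2 := by
  rw [star_diagOp, diagOp_mul, one_eq_diagOp (e := e), diagOp_sub]
  simp only [sq]

/-- Uniqueness of the symbol of the ancilla, for diagonal operators. -/
theorem eq_diagOp_ancillaVal (h2 : ∀ k, 0 ≤ 1 - s k ^ 2) {T : Op H₁} (hT : star T = T)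
    (hker : ∀ ψ, diagOp e (fun k => 1 - s k ^ 2) ψ = 0 → T ψ = 0)
    (hR : (diagOp e fun k => (1 - s k ^ 2) * lam k) =
      (diagOp e fun k => √(1 - s k ^ 2)) * T * diagOp e fun k => √(1 - s k ^ 2)) :
    T = diagOp e (ancillaVal s lam) := by
  have hker' : ∀ k, 1 - s k ^ 2 = 0 → T (e k) = 0 := fun k hk => hker _ (by
    rw [diagOp_apply, hk]; simp)
  have hadj : ∀ j k, ⟪e j, T (e k)⟫_ℂ = ⟪T (e j), e k⟫_ℂ := fun j k => by
    conv_rhs => rw [← hT]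
    rw [ContinuousLinearMap.star_eq_adjoint, ContinuousLinearMap.adjoint_inner_left]
  refine eq_diagOp fun k => InnerProductSpace.ext_inner_left_basis (𝕜 := ℂ) e.toBasis fun j => ?_
  rw [OrthonormalBasis.coe_toBasis, inner_smul_right]
  by_cases hk : 1 - s k ^ 2 = 0
  · rw [hker' k hk]; simp [ancillaVal, hk]
  by_cases hj : 1 - s j ^ 2 = 0
  · have hjk : j ≠ k := fun h => hk (h ▸ hj)
    rw [hadj, hker' j hj, e.orthonormal.2 hjk]; simp
  -- Off the kernel, compare the matrix elements of `R`.
  have hjk := congrArg (fun X : Op H₁ => ⟪e j, X (e k)⟫_ℂ) hR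
  have hsj : (√(1 - s j ^ 2) : ℂ) ≠ 0 := by
    exact_mod_cast (Real.sqrt_pos.mpr (lt_of_le_of_ne (h2 j) (Ne.symm hj))).ne'
  have hsk : (√(1 - s k ^ 2) : ℂ) ≠ 0 := by
    exact_mod_cast (Real.sqrt_pos.mpr (lt_of_le_of_ne (h2 k) (Ne.symm hk))).ne'
  simp only [mul_apply_eq_comp, diagOp_apply, map_smul, inner_smul_right] at hjk
  have h3 : ⟪e j, (diagOp e fun k => √(1 - s k ^ 2)) (T (e k))⟫_ℂ =
      √(1 - s j ^ 2) * ⟪e j, T (e k)⟫_ℂ := by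
    conv_lhs => rw [← star_diagOp]
    rw [ContinuousLinearMap.star_eq_adjoint, ContinuousLinearMap.adjoint_inner_right, diagOp_apply,
      inner_smul_left, Complex.conj_ofReal]
  rw [h3] at hjk
  have hνk : ancillaVal s lam k = lam k := by simp [ancillaVal, hk]
  rw [hνk]
  by_cases hjk' : j = k
  · subst hjk'
    have h4 : (√(1 - s j ^ 2) : ℂ) * √(1 - s j ^ 2) = 1 - s j ^ 2 := by
      exact_mod_cast Real.mul_self_sqrt (h2 j)
    have h5 : (√(1 - s j ^ 2) : ℂ) * √(1 - s j ^ 2) * (⟪e j, T (e j)⟫_ℂ - lam j * ⟪e j, e j⟫_ℂ) =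
        0 := by
      rw [mul_sub, mul_assoc, ← hjk, ← mul_assoc, h4]
      push_cast
      ring
    exact sub_eq_zero.mp ((mul_eq_zero.mp h5).resolve_left (mul_ne_zero hsj hsj))
  · rw [e.orthonormal.2 hjk'] at hjk ⊢
    simp only [mul_zero] at hjk ⊢
    have := (mul_eq_zero.mp hjk.symm).resolve_left hsk
    exact (mul_eq_zero.mp this).resolve_left hsj

/-- The symbol of the ancilla is diagonal, and agrees with the symbol `lam` where this matters. -/
theorem ancillaSymbol_diagOp (hs : ∀ k, 0 ≤ s k) (hs1 : ∀ k, s k ≤ 1)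
    (hl : ∀ k, 0 ≤ lam k) (hl1 : ∀ k, lam k ≤ 1) :
    ancillaSymbol (diagOp e s) (diagOp e fun k => (1 - s k ^ 2) * lam k) =
      diagOp e (ancillaVal s lam) := by
  have h2 : ∀ k, 0 ≤ 1 - s k ^ 2 := fun k => by nlinarith [hs k, hs1 k]
  have hex : ∃ T : Op H₁, 0 ≤ T ∧ T ≤ 1 ∧
      (∀ ψ, diagOp e (fun k => 1 - s k ^ 2) ψ = 0 → T ψ = 0) ∧
      (diagOp e fun k => (1 - s k ^ 2) * lam k) =
        (diagOp e fun k => √(1 - s k ^ 2)) * T * diagOp e fun k => √(1 - s k ^ 2) := by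
    refine ⟨diagOp e (ancillaVal s lam), diagOp_nonneg fun k => ?_, ?_, diagOp_eq_zero_of_ker, ?_⟩
    · by_cases hk : 1 - s k ^ 2 = 0 <;> simp [ancillaVal, hk, hl k]
    · rw [one_eq_diagOp (e := e)]
      refine diagOp_mono fun k => ?_
      by_cases hk : 1 - s k ^ 2 = 0 <;> simp [ancillaVal, hk, hl1 k]
    · rw [diagOp_mul, diagOp_mul]
      congr 1
      ext k
      rw [← ancillaVal_spec s lam k, mul_right_comm, Real.mul_self_sqrt (h2 k)]
  obtain ⟨T0, -, Tker, TR⟩ := Classical.epsilon_spec hex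
  rw [ancillaSymbol, one_sub_diagOp_mul_star, sqrt_diagOp h2]
  exact eq_diagOp_ancillaVal h2 T0.isSelfAdjoint.star_eq Tker TR

end Symbols

/-! ### The generator in a joint eigenbasis -/

section Generator

variable {H₁ : Type*} [NormedAddCommGroup H₁] [InnerProductSpace ℂ H₁]

/-- The trace of a sesquilinear map does not depend on the orthonormal basis. -/
theorem sum_sesquilin_eq {ι κ M : Type*} [Fintype ι] [Fintype κ] [AddCommGroup M] [Module ℂ M]
    (B : H₁ →ₗ[ℂ] H₁ →ₗ⋆[ℂ] M) (f : OrthonormalBasis ι ℂ H₁) (e : OrthonormalBasis κ ℂ H₁) :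
    ∑ j, B (f j) (f j) = ∑ k, B (e k) (e k) := by
  classical
  have h1 : ∀ j, B (f j) (f j) =
      ∑ k, ∑ l, (⟪f j, e l⟫_ℂ * ⟪e k, f j⟫_ℂ) • B (e k) (e l) := by
    intro j
    conv_lhs => rw [← e.sum_repr' (f j)]
    simp only [map_sum, LinearMap.map_smulₛₗ, LinearMap.sum_apply, LinearMap.smul_apply,
      inner_conj_symm, RingHom.id_apply, smul_smul, Finset.smul_sum]
    exact Finset.sum_comm
  simp only [h1]
  rw [Finset.sum_comm]
  refine Finset.sum_congr rfl fun k _ => ?_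
  rw [Finset.sum_comm]
  have h2 : ∀ l, ∑ j, (⟪f j, e l⟫_ℂ * ⟪e k, f j⟫_ℂ) • B (e k) (e l) =
      (if k = l then (1 : ℂ) else 0) • B (e k) (e l) := by
    intro l
    rw [← Finset.sum_smul, ← orthonormal_iff_ite.mp e.orthonormal k l, ← f.sum_inner_mul_inner]
    simp only [mul_comm]
  simp [h2]

variable [FiniteDimensional ℂ H₁]
variable {K : Type*} [NormedAddCommGroup K] [InnerProductSpace ℂ K] [FiniteDimensional ℂ K]

theorem twistedLindblad_apply (Z : H₁ →ₗ⋆[ℂ] Op K) (L L' X : Op K) : twistedLindblad Z L L' X =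
    L * parityOp Z * X * parityOp Z * L' - (2⁻¹ : ℂ) • (L * L' * X) -
      (2⁻¹ : ℂ) • (X * (L * L')) := rfl

/-- The sesquilinear map `(ψ, φ) ↦ L W X W L' - (L L' X + X L L') / 2` with `L = Z*(P ψ)` and
`L' = Z(Q φ)`. -/
def lindbladCre (Z : H₁ →ₗ⋆[ℂ] Op K) (X : Op K) (P Q : Op H₁) : H₁ →ₗ[ℂ] H₁ →ₗ⋆[ℂ] Op K :=
  LinearMap.mk₂'ₛₗ (RingHom.id ℂ) (starRingEnd ℂ)
    (fun ψ φ => twistedLindblad Z (star (Z (P ψ))) (Z (Q φ)) X)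
    (fun ψ ψ' φ => by
      simp only [twistedLindblad_apply, map_add, star_add, add_mul, mul_add]; module)
    (fun c ψ φ => by
      simp only [twistedLindblad_apply, map_smul, LinearMap.map_smulₛₗ, star_smul, smul_mul_assoc,
        mul_smul_comm, RCLike.star_def, Complex.conj_conj, RingHom.id_apply]
      module)
    (fun ψ φ φ' => by
      simp only [twistedLindblad_apply, map_add, add_mul, mul_add]; module)
    (fun c ψ φ => by
      simp only [twistedLindblad_apply, map_smul, LinearMap.map_smulₛₗ, smul_mul_assoc,
        mul_smul_comm]
      module)

/-- The sesquilinear map `(ψ, φ) ↦ L W X W L' - (L L' X + X L L') / 2` with `L = Z(Q φ)` and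
`L' = Z*(P ψ)`. -/
def lindbladAnn (Z : H₁ →ₗ⋆[ℂ] Op K) (X : Op K) (P Q : Op H₁) : H₁ →ₗ[ℂ] H₁ →ₗ⋆[ℂ] Op K :=
  LinearMap.mk₂'ₛₗ (RingHom.id ℂ) (starRingEnd ℂ)
    (fun ψ φ => twistedLindblad Z (Z (Q φ)) (star (Z (P ψ))) X)
    (fun ψ ψ' φ => by
      simp only [twistedLindblad_apply, map_add, star_add, add_mul, mul_add]; module)
    (fun c ψ φ => by
      simp only [twistedLindblad_apply, map_smul, LinearMap.map_smulₛₗ, star_smul, smul_mul_assoc,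
        mul_smul_comm, RCLike.star_def, Complex.conj_conj, RingHom.id_apply]
      module)
    (fun ψ φ φ' => by
      simp only [twistedLindblad_apply, map_add, add_mul, mul_add]; module)
    (fun c ψ φ => by
      simp only [twistedLindblad_apply, map_smul, LinearMap.map_smulₛₗ, smul_mul_assoc,
        mul_smul_comm]
      module)

theorem lindbladCre_apply_smul {Z : H₁ →ₗ⋆[ℂ] Op K} {X : Op K} {P Q : Op H₁} {ψ φ : H₁} {r q : ℝ}
    (hP : P ψ = (r : ℂ) • φ) (hQ : Q ψ = (q : ℂ) • φ) : lindbladCre Z X P Q ψ ψ =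
      ((r * q : ℝ) : ℂ) • twistedLindblad Z (star (Z φ)) (Z φ) X := by
  change twistedLindblad Z (star (Z (P ψ))) (Z (Q ψ)) X = _
  rw [hP, hQ]
  simp only [twistedLindblad_apply, LinearMap.map_smulₛₗ, star_smul, smul_mul_assoc, mul_smul_comm,
    RCLike.star_def, Complex.conj_ofReal, Complex.ofReal_mul]
  module

theorem lindbladAnn_apply_smul {Z : H₁ →ₗ⋆[ℂ] Op K} {X : Op K} {P Q : Op H₁} {ψ φ : H₁} {r q : ℝ}
    (hP : P ψ = (r : ℂ) • φ) (hQ : Q ψ = (q : ℂ) • φ) : lindbladAnn Z X P Q ψ ψ =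
      ((r * q : ℝ) : ℂ) • twistedLindblad Z (Z φ) (star (Z φ)) X := by
  change twistedLindblad Z (Z (Q ψ)) (star (Z (P ψ))) X = _
  rw [hP, hQ]
  simp only [twistedLindblad_apply, LinearMap.map_smulₛₗ, star_smul, smul_mul_assoc, mul_smul_comm,
    RCLike.star_def, Complex.conj_ofReal, Complex.ofReal_mul]
  module

variable {n : ℕ} {e : OrthonormalBasis (Fin n) ℂ H₁} {h a : Fin n → ℝ}

/-- The generator is a sum of thermalizations of the modes of the joint eigenbasis of `H` and `A`,
although it is defined by another eigenbasis of the symbol. -/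
theorem mehlerGeneratorDual_diagOp (Z : H₁ →ₗ⋆[ℂ] Op K) (ha : ∀ k, 0 ≤ a k)
    (hah : ∀ k, a k ≤ 2 * h k) (X : Op K) :
    mehlerGeneratorDual Z (diagOp e h) (diagOp e a) X =
      ∑ k, (2 * h k : ℂ) • modeGenerator (parityOp Z) (Z (e k)) (a k / (2 * h k)) X := by
  set lam : Fin n → ℝ := fun k => a k / (2 * h k) with hlam
  have hh : ∀ k, 0 ≤ 2 * h k := fun k => (ha k).trans (hah k)
  have hT : mehlerSymbol (diagOp e h) (diagOp e a) = diagOp e lam := mehlerSymbol_diagOp ha hah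
  set P := CFC.sqrt ((2 : ℂ) • diagOp e h) with hP
  have hP' : P = diagOp e fun k => √(2 * h k) := by rw [hP, two_smul_diagOp, sqrt_diagOp hh]
  set T := mehlerSymbol (diagOp e h) (diagOp e a)
  have hTs : IsSelfAdjoint T := by rw [IsSelfAdjoint, hT, star_diagOp]
  -- The eigenvalues are absorbed into the operators `P * (1 - T)` and `P * T`, which makes each sum
  -- the trace of a sesquilinear map.
  have h1 : mehlerGeneratorDual Z (diagOp e h) (diagOp e a) X =
      ∑ j, lindbladCre Z X P (P * (1 - T)) (eigenBasis T j) (eigenBasis T j) +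
      ∑ j, lindbladAnn Z X P (P * T) (eigenBasis T j) (eigenBasis T j) := by
    rw [mehlerGeneratorDual, ← Finset.sum_add_distrib, LinearMap.sum_apply]
    refine Finset.sum_congr rfl fun j _ => ?_
    have e0 : P (eigenBasis T j) = ((1 : ℝ) : ℂ) • P (eigenBasis T j) := by simp
    have e1 : (P * (1 - T)) (eigenBasis T j) =
        ((1 - eigenVal T j : ℝ) : ℂ) • P (eigenBasis T j) := by
      rw [mul_apply_eq_comp, _root_.sub_apply, one_apply_eq_self, apply_eigenBasis hTs, map_sub,
        map_smul]
      push_cast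
      module
    have e2 : (P * T) (eigenBasis T j) = ((eigenVal T j : ℝ) : ℂ) • P (eigenBasis T j) := by
      rw [mul_apply_eq_comp, apply_eigenBasis hTs, map_smul]
    rw [lindbladCre_apply_smul e0 e1, lindbladAnn_apply_smul e0 e2, one_mul, one_mul]
    push_cast
    rfl
  rw [h1, sum_sesquilin_eq _ (eigenBasis T) e, sum_sesquilin_eq _ (eigenBasis T) e,
    ← Finset.sum_add_distrib]
  refine Finset.sum_congr rfl fun k _ => ?_
  have e0 : P (e k) = (√(2 * h k) : ℂ) • e k := by rw [hP', diagOp_apply]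
  have e1 : (P * (1 - T)) (e k) = ((√(2 * h k) * (1 - lam k) : ℝ) : ℂ) • e k := by
    rw [hP', hT, one_eq_diagOp (e := e), diagOp_sub, diagOp_mul, diagOp_apply]
  have e2 : (P * T) (e k) = ((√(2 * h k) * lam k : ℝ) : ℂ) • e k := by
    rw [hP', hT, diagOp_mul, diagOp_apply]
  change _ = (2 * h k : ℂ) • modeGenerator (parityOp Z) (Z (e k)) (lam k) X
  rw [lindbladCre_apply_smul e0 e1, lindbladAnn_apply_smul e0 e2, ← mul_assoc, ← mul_assoc,
    Real.mul_self_sqrt (hh k), modeGenerator, twistedLindblad_apply, twistedLindblad_apply]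
  push_cast
  module

end Generator

/-! ### Monomials as eigenvectors -/

section Eigen

variable {H₁ : Type*} [NormedAddCommGroup H₁] [InnerProductSpace ℂ H₁] [FiniteDimensional ℂ H₁]
variable {K : Type*} [NormedAddCommGroup K] [InnerProductSpace ℂ K] [FiniteDimensional ℂ K]
variable {Z : H₁ →ₗ⋆[ℂ] Op K}
variable {n : ℕ} {e : OrthonormalBasis (Fin n) ℂ H₁} {h a : Fin n → ℝ}

/-- The monomials in the modes of the basis `e`, with the occupation numbers centered at `μ`. -/
def monomial (Z : H₁ →ₗ⋆[ℂ] Op K) (e : OrthonormalBasis (Fin n) ℂ H₁) (μ : Fin n → ℝ)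
    (m : Fin n → Excitation) : Op K :=
  excitationProd (fun k => Z (e k)) μ (List.finRange n) m

/-- The decay rate of a monomial under the semigroup: the sum of `h k` over the field operators
in it. -/
def decayRate (h : Fin n → ℝ) (m : Fin n → Excitation) : ℝ := ∑ k, h k * (m k).deg

theorem monomial_induction (hZ : IsCARField Z) (hirr : ActsIrreducibly Z)
    (e : OrthonormalBasis (Fin n) ℂ H₁) (μ : Fin n → ℝ) {p : Op K → Prop}
    (mon : ∀ m, p (monomial Z e μ m)) (add : ∀ X Y, p X → p Y → p (X + Y))
    (smul : ∀ (c : ℂ) X, p X → p (c • X)) (X : Op K) : p X := by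
  have hX : X ∈ Submodule.span ℂ
      (Set.range (excitationProd (fun k => Z (e k)) μ (List.finRange n))) := by
    rw [span_monomials_eq_top hZ hirr e μ]; trivial
  induction hX using Submodule.span_induction with
  | mem x hx => obtain ⟨m, rfl⟩ := hx; exact mon m
  | zero => simpa using smul 0 _ (mon fun _ => .vac)
  | add x y _ _ hx hy => exact add x y hx hy
  | smul c x _ hx => exact smul c x hx

/-- An operator is determined by its inner products with the monomials. -/
theorem ext_monomial (hZ : IsCARField Z) (hirr : ActsIrreducibly Z)
    (e : OrthonormalBasis (Fin n) ℂ H₁) (μ : Fin n → ℝ) {X Y : Op K}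
    (hXY : ∀ m, tau (star (monomial Z e μ m) * X) = tau (star (monomial Z e μ m) * Y)) : X = Y := by
  refine ext_tau fun A => ?_
  induction A using monomial_induction hZ hirr e μ with
  | mon m => exact hXY m
  | add A B hA hB => rw [star_add, add_mul, add_mul, tau_add, tau_add, hA, hB]
  | smul c A hA => rw [star_smul, smul_mul_assoc, smul_mul_assoc, tau_smul, tau_smul, hA]

theorem mehlerGeneratorDual_monomial (hZ : IsCARField Z) (ha : ∀ k, 0 ≤ a k)
    (hah : ∀ k, a k ≤ 2 * h k) (m : Fin n → Excitation) :
    mehlerGeneratorDual Z (diagOp e h) (diagOp e a) (monomial Z e (fun k => a k / (2 * h k)) m) =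
      -(decayRate h m : ℂ) • monomial Z e (fun k => a k / (2 * h k)) m := by
  rw [mehlerGeneratorDual_diagOp Z ha hah, decayRate]
  push_cast
  rw [← Finset.sum_neg_distrib, Finset.sum_smul]
  refine Finset.sum_congr rfl fun k _ => ?_
  have := modeGenerator_excitationProd (μ := fun k => a k / (2 * h k)) (isModeFamily hZ e)
    (List.nodup_finRange n) (List.mem_finRange k) m
  rw [monomial, this, smul_smul]
  congr 1
  ring

theorem tau_star_monomial_mul_mehlerSemigroup (hZ : IsCARField Z) (ha : ∀ k, 0 ≤ a k)
    (hah : ∀ k, a k ≤ 2 * h k) (m : Fin n → Excitation) (t : ℝ) (Y : Op K) :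
    tau (star (monomial Z e (fun k => a k / (2 * h k)) m) *
        mehlerSemigroup Z (diagOp e h) (diagOp e a) t Y) =
      Real.exp (-t * decayRate h m) *
        tau (star (monomial Z e (fun k => a k / (2 * h k)) m) * Y) := by
  set M := monomial Z e (fun k => a k / (2 * h k)) m with hM
  let f : Op K →L[ℂ] ℂ :=
    LinearMap.toContinuousLinearMap ((tauLinear K).comp (LinearMap.mulLeft ℂ (star M)))
  have hf : ∀ X, f X = tau (star M * X) := fun _ => rfl
  have key := apply_exp_of_comp_eq_smul f
    ((t : ℂ) • LinearMap.toContinuousLinearMap (mehlerGenerator Z (diagOp e h) (diagOp e a)))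
    (-t * decayRate h m) (fun X => by
      rw [_root_.smul_apply, map_smul, hf, hf, LinearMap.coe_toContinuousLinearMap',
        mehlerGenerator, tau_star_mul_hsAdjoint, hM, mehlerGeneratorDual_monomial hZ ha hah,
        star_smul, smul_mul_assoc, tau_smul]
      simp only [smul_eq_mul, RCLike.star_def, map_neg, Complex.conj_ofReal]
      ring) Y
  rw [hf, hf, smul_eq_mul] at key
  rw [mehlerSemigroup, key]
  push_cast
  rfl

theorem mehlerSemigroupDual_monomial (hZ : IsCARField Z) (ha : ∀ k, 0 ≤ a k)
    (hah : ∀ k, a k ≤ 2 * h k) (m : Fin n → Excitation) (t : ℝ) :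
    mehlerSemigroupDual Z (diagOp e h) (diagOp e a) t
        (monomial Z e (fun k => a k / (2 * h k)) m) =
      (Real.exp (-t * decayRate h m) : ℂ) • monomial Z e (fun k => a k / (2 * h k)) m := by
  refine ext_tau fun A => ?_
  rw [mehlerSemigroupDual, tau_star_mul_hsAdjoint, mul_smul_comm, tau_smul]
  have h1 := congrArg star (tau_star_monomial_mul_mehlerSemigroup (e := e) hZ ha hah m t A)
  rw [← tau_star, star_mul, star_star, star_mul', ← tau_star, star_mul, star_star, RCLike.star_def,
    Complex.conj_ofReal] at h1
  exact h1

/-- The semigroup consists of the operations `Φ_{S,R}`: both damp every monomial by the same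
factor. -/
theorem mehlerSemigroup_eq_ehk (hZ : IsCARField Z) (hirr : ActsIrreducibly Z) (ha : ∀ k, 0 ≤ a k)
    (hah : ∀ k, a k ≤ 2 * h k) {t : ℝ} (ht : 0 ≤ t) :
    (mehlerSemigroup Z (diagOp e h) (diagOp e a) t : Op K →ₗ[ℂ] Op K) =
      ehk Z (mehlerS (diagOp e h) t) (mehlerR (diagOp e h) (diagOp e a) t) := by
  have := hirr.nontrivial
  have hh : ∀ k, 0 ≤ 2 * h k := fun k => (ha k).trans (hah k)
  set s : Fin n → ℝ := fun k => Real.exp (-t * h k) with hs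
  set lam : Fin n → ℝ := fun k => a k / (2 * h k) with hlam
  have hs0 : ∀ k, 0 ≤ s k := fun k => (Real.exp_pos _).le
  have hs1 : ∀ k, s k ≤ 1 := fun k => Real.exp_le_one_iff.mpr (by nlinarith [hh k])
  have hl0 : ∀ k, 0 ≤ lam k := fun k => div_nonneg (ha k) (hh k)
  have hl1 : ∀ k, lam k ≤ 1 := fun k => div_le_one_of_le₀ (hah k) (hh k)
  have h2 : ∀ k, 0 ≤ 1 - s k ^ 2 := fun k => by nlinarith [hs0 k, hs1 k]
  have hanc := ancillaSymbol_diagOp (e := e) hs0 hs1 hl0 hl1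
  ext1 Y
  rw [mehlerS_diagOp, mehlerR_diagOp ha hah]
  refine ext_monomial hZ hirr e lam fun m => ?_
  refine (tau_star_monomial_mul_mehlerSemigroup hZ ha hah m t Y).trans ?_
  have hsq : CFC.sqrt (1 - diagOp e s * star (diagOp e s)) = diagOp e fun k => √(1 - s k ^ 2) := by
    rw [one_sub_diagOp_mul_star, sqrt_diagOp h2]
  have hsq' : CFC.sqrt (1 - star (diagOp e s) * diagOp e s) = diagOp e fun k => √(1 - s k ^ 2) := by
    rw [← hsq, star_diagOp]
  have key := tau_star_mul_ehk hZ e (S := diagOp e s) (R := diagOp e fun k => (1 - s k ^ 2) * lam k)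
    (s := s) (c := fun k => √(1 - s k ^ 2)) (μ := lam) (ν := ancillaVal s lam) hs0
    (fun k => Real.sqrt_nonneg _) (fun k => by rw [Real.sq_sqrt (h2 k)]; ring)
    (fun k => by rw [Real.sq_sqrt (h2 k), mul_sub, ancillaVal_spec, sub_self])
    (fun k => diagOp_apply s k) (fun k => by rw [star_diagOp, diagOp_apply])
    (fun k => by rw [hsq, diagOp_apply]) (fun k => by rw [hsq', diagOp_apply])
    (by rw [hanc, IsSelfAdjoint, star_diagOp]) (fun k => by rw [hanc, diagOp_apply]) m Y
  refine Eq.trans ?_ key.symm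
  congr 1
  have : Real.exp (-t * decayRate h m) = ∏ k, s k ^ (m k).deg := by
    rw [decayRate, Finset.mul_sum, Real.exp_sum]
    refine Finset.prod_congr rfl fun k _ => ?_
    rw [hs, ← Real.exp_nat_mul]
    congr 1
    ring
  rw [this]
  push_cast
  rfl

end Eigen

/-! ### Detailed balance, steady state and convergence -/

section Dynamics

variable {H₁ : Type*} [NormedAddCommGroup H₁] [InnerProductSpace ℂ H₁]
variable {K : Type*} [NormedAddCommGroup K] [InnerProductSpace ℂ K]

theorem tendsto_slope_monomial (c : ℝ) (X : Op K) :
    Tendsto (fun t : ℝ => ((t : ℂ)⁻¹) • ((Real.exp (-t * c) : ℂ) • X - X)) (𝓝[>] 0)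
      (𝓝 (-(c : ℂ) • X)) := by
  have h1 : HasDerivAt (fun t : ℝ => Real.exp (-t * c)) (-c) 0 := by
    have := (((hasDerivAt_id (0 : ℝ)).neg).mul_const c).exp
    simpa using this
  have h2 := h1.tendsto_slope_zero_right
  have h3 : Tendsto (fun t : ℝ => ((t⁻¹ * (Real.exp (-t * c) - 1) : ℝ) : ℂ) • X) (𝓝[>] 0)
      (𝓝 (((-c : ℝ) : ℂ) • X)) := by
    refine Tendsto.smul_const ((Complex.continuous_ofReal.tendsto _).comp ?_) X
    simpa using h2
  have h4 : ((-c : ℝ) : ℂ) • X = -(c : ℂ) • X := by push_cast; rfl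
  rw [← h4]
  refine h3.congr fun t => ?_
  push_cast
  module

variable {n : ℕ} [FiniteDimensional ℂ K]

theorem monomial_vac (Z : H₁ →ₗ⋆[ℂ] Op K) (e : OrthonormalBasis (Fin n) ℂ H₁) (μ : Fin n → ℝ)
    {m : Fin n → Excitation} (hm : ∀ k, m k = .vac) : monomial Z e μ m = 1 := by
  simp [monomial, excitationProd, hm, Excitation.op]

variable [FiniteDimensional ℂ H₁] {Z : H₁ →ₗ⋆[ℂ] Op K} {e : OrthonormalBasis (Fin n) ℂ H₁}
variable {h a : Fin n → ℝ}

/-- The generator is the derivative at zero of the adjoint operations. -/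
theorem tendsto_hsAdjoint_ehk (hZ : IsCARField Z) (hirr : ActsIrreducibly Z) (ha : ∀ k, 0 ≤ a k)
    (hah : ∀ k, a k ≤ 2 * h k) (X : Op K) :
    Tendsto (fun t : ℝ => ((t : ℂ)⁻¹) • (hsAdjoint (ehk Z (mehlerS (diagOp e h) t)
      (mehlerR (diagOp e h) (diagOp e a) t)) X - X)) (𝓝[>] 0)
      (𝓝 (mehlerGeneratorDual Z (diagOp e h) (diagOp e a) X)) := by
  have h1 : ∀ᶠ t : ℝ in 𝓝[>] 0,
      ((t : ℂ)⁻¹) • (mehlerSemigroupDual Z (diagOp e h) (diagOp e a) t X - X) =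
      ((t : ℂ)⁻¹) • (hsAdjoint (ehk Z (mehlerS (diagOp e h) t)
        (mehlerR (diagOp e h) (diagOp e a) t)) X - X) := by
    filter_upwards [self_mem_nhdsWithin] with t ht
    rw [mehlerSemigroupDual, mehlerSemigroup_eq_ehk hZ hirr ha hah (le_of_lt ht)]
  refine Tendsto.congr' h1 ?_
  clear h1
  induction X using monomial_induction hZ hirr e (fun k => a k / (2 * h k)) with
  | mon m =>
    simp only [mehlerSemigroupDual_monomial hZ ha hah, mehlerGeneratorDual_monomial hZ ha hah]
    exact tendsto_slope_monomial _ _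
  | add X Y hX hY =>
    rw [map_add]
    refine (hX.add hY).congr fun t => ?_
    rw [map_add]
    module
  | smul c X hX =>
    rw [map_smul]
    refine (hX.const_smul c).congr fun t => ?_
    rw [map_smul]
    module

theorem mehlerState_diagOp (Z : H₁ →ₗ⋆[ℂ] Op K) (ha : ∀ k, 0 ≤ a k) (hah : ∀ k, a k ≤ 2 * h k) :
    mehlerState Z (diagOp e h) (diagOp e a) =
      gaussianDensity Z (diagOp e fun k => a k / (2 * h k)) := by
  rw [mehlerState, mehlerSymbol_diagOp ha hah]

theorem isModeKMS_mehlerState (hZ : IsCARField Z) (ha : ∀ k, 0 ≤ a k) (hah : ∀ k, a k ≤ 2 * h k)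
    (k : Fin n) : IsModeKMS (parityOp Z) (Z (e k)) (a k / (2 * h k))
      (mehlerState Z (diagOp e h) (diagOp e a)) := by
  rw [mehlerState_diagOp Z ha hah]
  exact isModeKMS_gaussianDensity hZ (star_diagOp _) (diagOp_apply _ k)

theorem gnsInner_mehlerGeneratorDual (hZ : IsCARField Z) (ha : ∀ k, 0 ≤ a k)
    (hah : ∀ k, a k ≤ 2 * h k) (X Y : Op K) :
    gnsInner (mehlerState Z (diagOp e h) (diagOp e a)) X
      (mehlerGeneratorDual Z (diagOp e h) (diagOp e a) Y) =
    gnsInner (mehlerState Z (diagOp e h) (diagOp e a))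
      (mehlerGeneratorDual Z (diagOp e h) (diagOp e a) X) Y := by
  have key := fun k => trace_modeGenerator (tauLinear K) tauLinear_mul_comm
    ((isModeFamily hZ e).mode k) (isModeKMS_mehlerState hZ ha hah k) X Y
  simp only [gnsInner, mehlerGeneratorDual_diagOp Z ha hah, Finset.mul_sum, Finset.sum_mul,
    star_sum, tau_sum, star_smul, mul_smul_comm, smul_mul_assoc, tau_smul]
  refine Finset.sum_congr rfl fun k _ => ?_
  have hk : star (2 * h k : ℂ) = 2 * h k := by simp
  rw [hk]
  exact congrArg _ (key k)

theorem gnsInner_add_left (ρ X X' Y : Op K) :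
    gnsInner ρ (X + X') Y = gnsInner ρ X Y + gnsInner ρ X' Y := by
  simp only [gnsInner, star_add, add_mul, tau_add]

theorem gnsInner_add_right (ρ X Y Y' : Op K) :
    gnsInner ρ X (Y + Y') = gnsInner ρ X Y + gnsInner ρ X Y' := by
  simp only [gnsInner, mul_add, add_mul, tau_add]

theorem gnsInner_smul_left (ρ : Op K) (c : ℂ) (X Y : Op K) :
    gnsInner ρ (c • X) Y = star c * gnsInner ρ X Y := by
  simp only [gnsInner, star_smul, smul_mul_assoc, tau_smul]

theorem gnsInner_smul_right (ρ : Op K) (c : ℂ) (X Y : Op K) :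
    gnsInner ρ X (c • Y) = c * gnsInner ρ X Y := by
  simp only [gnsInner, mul_smul_comm, smul_mul_assoc, tau_smul]

/-- Detailed balance. By the symmetry of the generator, monomials with different decay rates are
orthogonal for the GNS inner product, and on the others the semigroup acts by a common factor. -/
theorem gnsInner_mehlerSemigroupDual (hZ : IsCARField Z) (hirr : ActsIrreducibly Z)
    (ha : ∀ k, 0 ≤ a k) (hah : ∀ k, a k ≤ 2 * h k) (t : ℝ) (X Y : Op K) :
    gnsInner (mehlerState Z (diagOp e h) (diagOp e a)) X
      (mehlerSemigroupDual Z (diagOp e h) (diagOp e a) t Y) =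
    gnsInner (mehlerState Z (diagOp e h) (diagOp e a))
      (mehlerSemigroupDual Z (diagOp e h) (diagOp e a) t X) Y := by
  induction X using monomial_induction hZ hirr e (fun k => a k / (2 * h k)) with
  | add X X' hX hX' => rw [map_add, gnsInner_add_left, gnsInner_add_left, hX, hX']
  | smul c X hX => rw [map_smul, gnsInner_smul_left, gnsInner_smul_left, hX]
  | mon m =>
    induction Y using monomial_induction hZ hirr e (fun k => a k / (2 * h k)) with
    | add Y Y' hY hY' => rw [map_add, gnsInner_add_right, gnsInner_add_right, hY, hY']
    | smul c Y hY => rw [map_smul, gnsInner_smul_right, gnsInner_smul_right, hY]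
    | mon m' =>
      have key := gnsInner_mehlerGeneratorDual (e := e) hZ ha hah
        (monomial Z e (fun k => a k / (2 * h k)) m) (monomial Z e (fun k => a k / (2 * h k)) m')
      rw [mehlerGeneratorDual_monomial hZ ha hah, mehlerGeneratorDual_monomial hZ ha hah,
        gnsInner_smul_left, gnsInner_smul_right] at key
      rw [mehlerSemigroupDual_monomial hZ ha hah, mehlerSemigroupDual_monomial hZ ha hah,
        gnsInner_smul_left, gnsInner_smul_right]
      simp only [RCLike.star_def, map_neg, Complex.conj_ofReal] at key ⊢
      by_cases hr : decayRate h m = decayRate h m'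
      · rw [hr]
      · have hr' : (decayRate h m : ℂ) - decayRate h m' ≠ 0 := by
          rw [sub_ne_zero]
          exact_mod_cast hr
        have : ((decayRate h m : ℂ) - decayRate h m') *
            gnsInner (mehlerState Z (diagOp e h) (diagOp e a))
              (monomial Z e (fun k => a k / (2 * h k)) m)
              (monomial Z e (fun k => a k / (2 * h k)) m') = 0 := by
          linear_combination key
        rw [(mul_eq_zero.mp this).resolve_left hr', mul_zero, mul_zero]

theorem tau_star_monomial_mul_mehlerState (hZ : IsCARField Z) (ha : ∀ k, 0 ≤ a k)
    (hah : ∀ k, a k ≤ 2 * h k) {m : Fin n → Excitation} {k : Fin n} (hk : m k ≠ .vac) :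
    tau (star (monomial Z e (fun k => a k / (2 * h k)) m) *
      mehlerState Z (diagOp e h) (diagOp e a)) = 0 := by
  rw [monomial, star_excitationProd]
  refine trace_excitationProd_eq_zero (tauLinear K) tauLinear_mul_comm (isModeFamily hZ e)
    (List.nodup_reverse.mpr (List.nodup_finRange n)) (k := k) (by simp)
    (isModeKMS_mehlerState hZ ha hah k) ?_
  cases hmk : m k <;> simp_all [Excitation.adj]

theorem decayRate_vac (h : Fin n → ℝ) {m : Fin n → Excitation} (hm : ∀ k, m k = .vac) :
    decayRate h m = 0 := by
  simp [decayRate, hm, Excitation.deg]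

theorem mehlerSemigroup_mehlerState (hZ : IsCARField Z) (hirr : ActsIrreducibly Z)
    (ha : ∀ k, 0 ≤ a k) (hah : ∀ k, a k ≤ 2 * h k) (t : ℝ) :
    mehlerSemigroup Z (diagOp e h) (diagOp e a) t (mehlerState Z (diagOp e h) (diagOp e a)) =
      mehlerState Z (diagOp e h) (diagOp e a) := by
  refine ext_monomial hZ hirr e (fun k => a k / (2 * h k)) fun m => ?_
  rw [tau_star_monomial_mul_mehlerSemigroup hZ ha hah]
  by_cases hm : ∀ k, m k = .vac
  · rw [decayRate_vac h hm]; simp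
  · push Not at hm
    obtain ⟨k, hk⟩ := hm
    rw [tau_star_monomial_mul_mehlerState hZ ha hah hk, mul_zero]

/-- Weak convergence, tested against monomials, is convergence. -/
theorem tendsto_of_tendsto_tau (hZ : IsCARField Z) (hirr : ActsIrreducibly Z)
    (e : OrthonormalBasis (Fin n) ℂ H₁) (μ : Fin n → ℝ) {α : Type*} {F : Filter α} {f : α → Op K}
    {X : Op K} (hf : ∀ m, Tendsto (fun t => tau (star (monomial Z e μ m) * f t)) F
      (𝓝 (tau (star (monomial Z e μ m) * X)))) : Tendsto f F (𝓝 X) := by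
  have h1 : ∀ A : Op K, Tendsto (fun t => tau (star A * f t)) F (𝓝 (tau (star A * X))) := by
    intro A
    induction A using monomial_induction hZ hirr e μ with
    | mon m => exact hf m
    | add A B hA hB =>
      simp only [star_add, add_mul, tau_add]
      exact hA.add hB
    | smul c A hA =>
      simp only [star_smul, smul_mul_assoc, tau_smul]
      exact hA.const_mul _
  rw [← sum_tau_matrixUnit X]
  have h2 : f = fun t => (finrank ℂ K : ℂ) •
      ∑ i, ∑ j, tau (star (matrixUnit K i j) * f t) • matrixUnit K i j :=
    funext fun t => (sum_tau_matrixUnit (f t)).symm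
  rw [h2]
  exact (tendsto_finsetSum _ fun i _ => tendsto_finsetSum _ fun j _ =>
    (h1 _).smul_const _).const_smul _

theorem tendsto_mehlerSemigroup (hZ : IsCARField Z) (hirr : ActsIrreducibly Z)
    (ha : ∀ k, 0 ≤ a k) (hah : ∀ k, a k ≤ 2 * h k) (hpos : ∀ k, 0 < h k) {ρ : Op K}
    (hρ : tau ρ = 1) :
    Tendsto (fun t : ℝ => mehlerSemigroup Z (diagOp e h) (diagOp e a) t ρ) atTop
      (𝓝 (mehlerState Z (diagOp e h) (diagOp e a))) := by
  have := hirr.nontrivial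
  refine tendsto_of_tendsto_tau hZ hirr e (fun k => a k / (2 * h k)) fun m => ?_
  simp only [tau_star_monomial_mul_mehlerSemigroup hZ ha hah]
  by_cases hm : ∀ k, m k = .vac
  · rw [decayRate_vac h hm, monomial_vac Z e _ hm, mehlerState_diagOp Z ha hah, star_one, one_mul,
      one_mul, hρ, tau_gaussianDensity hZ]
    simp
  · push Not at hm
    obtain ⟨k, hk⟩ := hm
    have hr : 0 < decayRate h m := by
      refine Finset.sum_pos' (fun j _ => mul_nonneg (hpos j).le (Nat.cast_nonneg _))
        ⟨k, Finset.mem_univ k, mul_pos (hpos k) ?_⟩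
      exact_mod_cast Nat.pos_of_ne_zero fun h0 => hk (Excitation.deg_eq_zero h0)
    rw [tau_star_monomial_mul_mehlerState hZ ha hah hk]
    have h1 : Tendsto (fun t : ℝ => Real.exp (-t * decayRate h m)) atTop (𝓝 0) :=
      Real.tendsto_exp_atBot.comp (tendsto_neg_atTop_atBot.atBot_mul_const hr)
    have h2 := ((Complex.continuous_ofReal.tendsto _).comp h1).mul_const
      (tau (star (monomial Z e (fun k => a k / (2 * h k)) m) * ρ))
    simpa using h2

end Dynamics

end FermiMehler

end

open FermiMehler

theorem theorem4p6 {H₁ K : Type*}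
    [NormedAddCommGroup H₁] [InnerProductSpace ℂ H₁] [FiniteDimensional ℂ H₁]
    [NormedAddCommGroup K] [InnerProductSpace ℂ K] [FiniteDimensional ℂ K]
    (Z : H₁ →ₗ⋆[ℂ] Op K) (hZ : IsCARField Z) (hirr : ActsIrreducibly Z)
    (H A : Op H₁) (hA : 0 ≤ A) (hAH : A ≤ (2 : ℂ) • H) (hHA : Commute H A) :
    -- `T` is well defined and `0 ≤ T ≤ 1`
    (Tendsto (mehlerSymbolApprox H A) (𝓝[>] 0) (𝓝 (mehlerSymbol H A)) ∧
      0 ≤ mehlerSymbol H A ∧ mehlerSymbol H A ≤ 1) ∧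
    -- the semigroup generated by `ℒ_{-H,A}` consists of the EHK operations, on the whole algebra
    (∀ t : ℝ, 0 ≤ t → IsCompatiblePair (mehlerS H t) (mehlerR H A t) ∧
      (mehlerSemigroup Z H A t : Op K →ₗ[ℂ] Op K) = ehk Z (mehlerS H t) (mehlerR H A t)) ∧
    -- `ℒ†_{-H,A}` is the derivative at zero of the adjoint EHK operations
    (∀ X : Op K, Tendsto
      (fun t : ℝ => ((t : ℂ)⁻¹) • (hsAdjoint (ehk Z (mehlerS H t) (mehlerR H A t)) X - X))
      (𝓝[>] 0) (𝓝 (mehlerGeneratorDual Z H A X))) ∧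
    -- detailed balance with respect to `ρ_T`
    (∀ t : ℝ, 0 ≤ t → ∀ X Y : Op K,
      gnsInner (mehlerState Z H A) X (mehlerSemigroupDual Z H A t Y) =
        gnsInner (mehlerState Z H A) (mehlerSemigroupDual Z H A t X) Y) ∧
    -- `ρ_T` is a steady state
    (IsDensity (mehlerState Z H A) ∧
      ∀ t : ℝ, 0 ≤ t → mehlerSemigroup Z H A t (mehlerState Z H A) = mehlerState Z H A) ∧
    -- if `H > 0`: uniqueness of the steady state, and convergence to it
    ((∀ ψ : H₁, ψ ≠ 0 → 0 < (⟪ψ, H ψ⟫_ℂ).re) →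
      (∀ ρ : Op K, IsDensity ρ → (∀ t : ℝ, 0 ≤ t → mehlerSemigroup Z H A t ρ = ρ) →
        ρ = mehlerState Z H A) ∧
      ∀ ρ : Op K, IsDensity ρ →
        Tendsto (fun t : ℝ => mehlerSemigroup Z H A t ρ) atTop (𝓝 (mehlerState Z H A))) := by
  have := hirr.nontrivial
  have hHs : IsSelfAdjoint H := by
    have h2 : IsSelfAdjoint ((2 : ℂ) • H) := (hA.trans hAH).isSelfAdjoint
    have h3 := h2.star_eq
    rw [star_smul, RCLike.star_def, Complex.conj_ofNat] at h3
    exact smul_right_injective _ (two_ne_zero (α := ℂ)) h3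
  obtain ⟨e, h, a, rfl, rfl⟩ := exists_joint_diagOp hHs hA.isSelfAdjoint hHA
  have ha : ∀ k, 0 ≤ a k := nonneg_of_diagOp_nonneg hA
  have hah : ∀ k, a k ≤ 2 * h k := fun k => by
    rw [two_smul_diagOp, ← sub_nonneg, diagOp_sub] at hAH
    exact sub_nonneg.mp (nonneg_of_diagOp_nonneg hAH k)
  have hh : ∀ k, 0 ≤ 2 * h k := fun k => (ha k).trans (hah k)
  have hl0 : ∀ k, 0 ≤ a k / (2 * h k) := fun k => div_nonneg (ha k) (hh k)
  have hl1 : ∀ k, a k / (2 * h k) ≤ 1 := fun k => div_le_one_of_le₀ (hah k) (hh k)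
  have hT := mehlerSymbol_diagOp (e := e) ha hah
  have hT0 : 0 ≤ mehlerSymbol (diagOp e h) (diagOp e a) := by rw [hT]; exact diagOp_nonneg hl0
  have hT1 : mehlerSymbol (diagOp e h) (diagOp e a) ≤ 1 := by
    rw [hT, one_eq_diagOp (e := e)]; exact diagOp_mono hl1
  refine ⟨⟨?_, hT0, hT1⟩, fun t ht => ⟨?_, mehlerSemigroup_eq_ehk hZ hirr ha hah ht⟩,
    tendsto_hsAdjoint_ehk hZ hirr ha hah,
    fun t _ X Y => gnsInner_mehlerSemigroupDual hZ hirr ha hah t X Y,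
    ⟨isDensity_gaussianDensity hZ hT0 hT1,
      fun t _ => mehlerSemigroup_mehlerState hZ hirr ha hah t⟩, fun hH => ?_⟩
  · rw [hT]
    exact tendsto_mehlerSymbolApprox ha hah
  · rw [mehlerS_diagOp, mehlerR_diagOp ha hah]
    exact isCompatiblePair_diagOp (fun k => (Real.exp_pos _).le)
      (fun k => Real.exp_le_one_iff.mpr (by nlinarith [hh k])) hl0 hl1
  · have hpos : ∀ k, 0 < h k := fun k => by
      have := hH (e k) (e.orthonormal.ne_zero k)
      rw [diagOp_apply, inner_smul_right] at this
      simpa using this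
    have hconv : ∀ ρ : Op K, IsDensity ρ → Tendsto (fun t : ℝ =>
        mehlerSemigroup Z (diagOp e h) (diagOp e a) t ρ) atTop
          (𝓝 (mehlerState Z (diagOp e h) (diagOp e a))) :=
      fun ρ hρ => tendsto_mehlerSemigroup hZ hirr ha hah hpos hρ.2
    refine ⟨fun ρ hρ hst => ?_, hconv⟩
    refine tendsto_nhds_unique (tendsto_const_nhds.congr' ?_) (hconv ρ hρ)
    filter_upwards [eventually_ge_atTop 0] with t ht
    exact (hst t ht).symm
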